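/- Let $V$ be a complex vector space of dimension $5$ and let $\mathbb P(V)$ be the space of its lines. Write $T(-1)=T_{\mathbb P(V)}(-1)$ for the bundle with fibre $V/V_1$ at $[V_1]$. Let $\mathscr Y_3=\mathrm G(3,\wedge^2T(-1))$ be the Grassmannian bundle over $\mathbb P(V)$ whose points are the pairs $([\bar U],[V_1])$ with $\bar U\subset\wedge^2(V/V_1)$ and $\dim\bar U=3$. Let $\overline{\mathscr Y}\subset\mathrm G(3,\wedge^3V)$ be the image of the map $\pi:([\bar U],[V_1])\mapsto[\bar U\wedge V_1]$. Put $$\overline{\mathcal P}_\rho=\{[V\wedge(\wedge^2V_2)]\mid V_2\subset V,\ \dim V_2=2\},\qquad \overline{\mathcal P}_\sigma=\{[(\wedge^2V_4)\wedge V_1]\mid V_1\subset V_4\subset V,\ \dim V_1=1,\ \dim V_4=4\}.$$ Let $\mathcal P_\rho\subset\mathscr Y_3$ be the exceptional set of the resolution $\pi:\mathscr Y_3\to\overline{\mathscr Y}$, that is, the set of the points $y$ with $\pi^{-1}(\pi(y))\neq\{y\}$, and let $\mathcal P_\sigma\subset\mathscr Y_3$ be the proper transform of $\overline{\mathcal P}_\sigma$,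 that is, the Zariski closure of $\pi^{-1}(\overline{\mathcal P}_\sigma\setminus\pi(\mathcal P_\rho))$. Then $\mathcal P_\rho=\pi^{-1}(\overline{\mathcal P}_\rho)$ and $\pi(\mathcal P_\rho)=\overline{\mathcal P}_\rho$. For a complex vector space $E$ of dimension $4$, let $$\Phi_E:\wedge^3(\wedge^2E)\to \mathsf S^2E\otimes\wedge^4E\ \oplus\ \mathsf S^2E^*\otimes(\wedge^4E)^{\otimes2}$$ be the following natural linear map. Elements of $\mathsf S^2E\otimes M$ (of $\mathsf S^2E^*\otimes M$) are regarded as symmetric bilinear maps $E^*\times E^*\to M$ ($E\times E\to M$). The two components of $\Phi_E(a_1\wedge a_2\wedge a_3)$ are the symmetrizations $B+B^{t}$ of $$(\varphi,\psi)\mapsto\sum_{\tau\in S_3}\mathrm{sgn}(\tau)\;a_{\tau(3)}\wedge(\varphi\lrcorner a_{\tau(1)})\wedge(\psi\lrcorner a_{\tau(2)}),$$ $$(x,x')\mapsto\sum_{\tau\in S_3}\mathrm{sgn}(\tau)\;\big((a_{\tau(1)}\wedge x\wedge\cdot)\otimes(a_{\tau(3)}\wedge x'\wedge\cdot)\big)(\delta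 a_{\tau(2)}),$$ where $\delta(y\wedge z)=y\otimes z-z\otimes y$ and $\varphi\lrcorner(y\wedge z)=\varphi(y)z-\varphi(z)y$. For each $[V_1]$ the map $\Phi_{V/V_1}$ is an isomorphism (the double spin decomposition). Let $$i:\mathscr Y_3\to\mathbb P\big(\mathsf S^2T(-1)\otimes\wedge^4T(-1)\ \oplus\ \mathsf S^2T(-1)^*\otimes(\wedge^4T(-1))^{\otimes2}\big),\qquad ([\bar U],[V_1])\mapsto[\Phi_{V/V_1}(\wedge^3\bar U)]$$ be the double spin embedding. (1) $i(\mathcal P_\rho)=v_2(\mathbb P(T(-1)))$, where $v_2$ sends a line $[e]$ of $V/V_1$ to $[e^2\otimes\wedge^4(V/V_1)]$ in the first summand, and $i(\mathcal P_\sigma)=v_2(\mathbb P(T(-1)^*))$, where $v_2$ sends a line $[l]$ of $(V/V_1)^*$ to $[l^2\otimes(\wedge^4(V/V_1))^{\otimes2}]$ in the second summand. (2) Let $\mathrm{OG}(3,\wedge^2T(-1))\subset\mathscr Y_3$ be the relative orthogonal Grassmannian of the $3$-spaces $\bar U\subset\wedge^2(V/V_1)$ that are isotropic (hence maximal isotropic)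 for the symmetric form $\wedge^2(V/V_1)\times\wedge^2(V/V_1)\to\wedge^4(V/V_1)$. It coincides with $\mathrm{OG}(3,\wedge^2T(-1)^*)$ under the canonical isomorphism $\wedge^2T(-1)^*\simeq\wedge^2T(-1)\otimes(\wedge^4T(-1))^*$. It has exactly two connected components $\mathrm{OG}^{+}$ and $\mathrm{OG}^{-}$ (for the Zariski topology), and these are $\mathcal P_\rho=\mathrm{OG}^{+}$ and $\mathcal P_\sigma=\mathrm{OG}^{-}$. Likewise, over every point $[V_1]$ the fibre $\mathrm{OG}(3,\wedge^2(V/V_1))$ has exactly two connected components, the fibres of $\mathcal P_\rho$ and of $\mathcal P_\sigma$. -/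

import Mathlib

open scoped TensorProduct LinearAlgebra.Projectivization
open Module

set_option maxSynthPendingDepth 3

namespace DoubleSpin

/-! ### Multilinear algebra on a complex vector space `E` -/

section Algebra

variable (E : Type*) [AddCommGroup E] [Module ℂ E]

/-- The wedge product `(x, y) ↦ x ∧ y` of vectors, with values in `⋀² E`. -/
noncomputable def wedgeVec : E →ₗ[ℂ] E →ₗ[ℂ] ⋀[ℂ]^2 E :=
  LinearMap.mk₂ ℂ (fun x y => exteriorPower.ιMulti ℂ 2 ![x, y])
    (fun x x' y => by ext; simp [ExteriorAlgebra.ιMulti_apply, add_mul])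
    (fun c x y => by ext; simp [ExteriorAlgebra.ιMulti_apply])
    (fun x y y' => by ext; simp [ExteriorAlgebra.ιMulti_apply, mul_add])
    (fun c x y => by ext; simp [ExteriorAlgebra.ιMulti_apply])

/-- The symmetric pairing `⋀² E × ⋀² E → ⋀⁴ E`, `(a, b) ↦ a ∧ b`. -/
noncomputable def wedgeForm : ⋀[ℂ]^2 E →ₗ[ℂ] ⋀[ℂ]^2 E →ₗ[ℂ] ⋀[ℂ]^4 E :=
  LinearMap.mk₂ ℂ
    (fun a b => ⟨(a : ExteriorAlgebra ℂ E) * (b : ExteriorAlgebra ℂ E),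
      SetLike.mul_mem_graded (A := fun n : ℕ => ⋀[ℂ]^n E) a.2 b.2⟩)
    (fun a a' b => by ext; simp [add_mul])
    (fun c a b => by ext; simp)
    (fun a b b' => by ext; simp [mul_add])
    (fun c a b => by ext; simp)

/-- The trilinear map `(a, x, y) ↦ a ∧ x ∧ y`, where `a ∈ ⋀² E` and `x, y ∈ E`. -/
noncomputable def wedgeTriple : ⋀[ℂ]^2 E →ₗ[ℂ] E →ₗ[ℂ] E →ₗ[ℂ] ⋀[ℂ]^4 E where
  toFun a := (wedgeVec E).compr₂ (wedgeForm E a)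
  map_add' a b := LinearMap.ext fun x => LinearMap.ext fun y => by
    simp [LinearMap.compr₂_apply]
  map_smul' c a := LinearMap.ext fun x => LinearMap.ext fun y => by
    simp [LinearMap.compr₂_apply]

/-- The inclusion `⋀² E → E ⊗ E`, `x ∧ y ↦ x ⊗ y - y ⊗ x`. -/
noncomputable def skewTensor : ⋀[ℂ]^2 E →ₗ[ℂ] E ⊗[ℂ] E :=
  exteriorPower.alternatingMapLinearEquiv
    { toFun := fun m => m 0 ⊗ₜ[ℂ] m 1 - m 1 ⊗ₜ[ℂ] m 0
      map_update_add' := by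
        intro inst m i x y
        obtain rfl : inst = instDecidableEqFin 2 := Subsingleton.elim _ _
        fin_cases i <;>
          simp [TensorProduct.add_tmul, TensorProduct.tmul_add] <;> abel
      map_update_smul' := by
        intro inst m i c x
        obtain rfl : inst = instDecidableEqFin 2 := Subsingleton.elim _ _
        fin_cases i <;>
          simp [TensorProduct.smul_tmul', smul_sub]
      map_eq_zero_of_eq' := by
        intro m i j h hij
        fin_cases i <;> fin_cases j <;> simp_all }

/-- The contraction `E* × ⋀² E → E`, `(φ, x ∧ y) ↦ φ(x) y - φ(y) x`. -/
noncomputable def contract : Dual ℂ E →ₗ[ℂ] ⋀[ℂ]^2 E →ₗ[ℂ] E :=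
  LinearMap.mk₂ ℂ (fun φ a => TensorProduct.lid ℂ E (LinearMap.rTensor E φ (skewTensor E a)))
    (fun φ φ' a => by simp [LinearMap.rTensor_add])
    (fun c φ a => by simp [LinearMap.rTensor_smul])
    (fun φ a b => by simp)
    (fun c φ a => by simp)

/-- Symmetric bilinear maps `A × A → M`.  For finite dimensional spaces this is `S² A* ⊗ M`. -/
def SymForms (A M : Type*) [AddCommGroup A] [Module ℂ A] [AddCommGroup M] [Module ℂ M] :
    Submodule ℂ (A →ₗ[ℂ] A →ₗ[ℂ] M) where
  carrier := {B | ∀ x y, B x y = B y x}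
  add_mem' := by
    intro B C hB hC x y
    simp [hB x y, hC x y]
  zero_mem' := by
    intro x y
    simp
  smul_mem' := by
    intro c B hB x y
    simp [hB x y]

/-- Symmetrization `B ↦ B + Bᵗ` of bilinear maps. -/
def symmetrize (A M : Type*) [AddCommGroup A] [Module ℂ A] [AddCommGroup M] [Module ℂ M] :
    (A →ₗ[ℂ] A →ₗ[ℂ] M) →ₗ[ℂ] SymForms A M where
  toFun B := ⟨B + B.flip, fun x y => by simp [add_comm]⟩
  map_add' B C := by
    ext x y
    simp only [LinearMap.add_apply, LinearMap.flip_apply, Submodule.coe_add]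
    abel
  map_smul' c B := by
    ext x y
    simp

/-- The square of a linear form `l` on `A`, times `m`: the form `(x, y) ↦ l(x) l(y) m`. -/
def squareForm {A M : Type*} [AddCommGroup A] [Module ℂ A] [AddCommGroup M] [Module ℂ M]
    (l : Dual ℂ A) (m : M) : SymForms A M :=
  ⟨LinearMap.mk₂ ℂ (fun x y => (l x * l y) • m)
    (fun x x' y => by simp [add_mul, add_smul])
    (fun c x y => by simp [mul_assoc, mul_smul])
    (fun x y y' => by simp [mul_add, add_smul])
    (fun c x y => by simp [mul_left_comm, mul_smul]),
   fun x y => by simp [mul_comm]⟩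

/-- The space `(S² E ⊗ ⋀⁴ E) ⊕ (S² E* ⊗ (⋀⁴ E)^{⊗ 2})`, for `E` finite dimensional; an element of
`S² E ⊗ M` is a symmetric bilinear map `E* × E* → M`, and an element of `S² E* ⊗ M` is a
symmetric bilinear map `E × E → M`. -/
abbrev SpinSpace : Type _ :=
  SymForms (Dual ℂ E) (⋀[ℂ]^4 E) × SymForms E (⋀[ℂ]^4 E ⊗[ℂ] ⋀[ℂ]^4 E)

/-- The trilinear map sending `(a, b, c)` to the bilinear form `(φ, ψ) ↦ c ∧ (φ ⌟ a) ∧ (ψ ⌟ b)`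
on `E*`. -/
noncomputable def vTrilinear :
    MultilinearMap ℂ (fun _ : Fin 3 => ⋀[ℂ]^2 E) (Dual ℂ E →ₗ[ℂ] Dual ℂ E →ₗ[ℂ] ⋀[ℂ]^4 E) where
  toFun m :=
    (wedgeTriple E (m 2)).compl₁₂ ((contract E).flip (m 0)) ((contract E).flip (m 1))
  map_update_add' := by
    intro inst m i x y
    obtain rfl : inst = instDecidableEqFin 3 := Subsingleton.elim _ _
    refine LinearMap.ext fun φ => LinearMap.ext fun ψ => ?_
    fin_cases i <;> simp
  map_update_smul' := by
    intro inst m i c x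
    obtain rfl : inst = instDecidableEqFin 3 := Subsingleton.elim _ _
    refine LinearMap.ext fun φ => LinearMap.ext fun ψ => ?_
    fin_cases i <;> simp

/-- The trilinear map sending `(a, b, c)`, with `b = Σ y_k ∧ z_k`, to the bilinear form
`(x, x') ↦ Σ (a ∧ x ∧ y_k) ⊗ (c ∧ x' ∧ z_k) - (a ∧ x ∧ z_k) ⊗ (c ∧ x' ∧ y_k)` on `E`. -/
noncomputable def wTrilinear :
    MultilinearMap ℂ (fun _ : Fin 3 => ⋀[ℂ]^2 E)
      (E →ₗ[ℂ] E →ₗ[ℂ] (⋀[ℂ]^4 E ⊗[ℂ] ⋀[ℂ]^4 E)) where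
  toFun m := ((TensorProduct.mapBilinear (RingHom.id ℂ) E E (⋀[ℂ]^4 E) (⋀[ℂ]^4 E)).compl₁₂
    (wedgeTriple E (m 0)) (wedgeTriple E (m 2))).compr₂
    (LinearMap.applyₗ (skewTensor E (m 1)))
  map_update_add' := by
    intro inst m i x y
    obtain rfl : inst = instDecidableEqFin 3 := Subsingleton.elim _ _
    refine LinearMap.ext fun u => LinearMap.ext fun u' => ?_
    fin_cases i <;>
      simp [TensorProduct.map_add_left, TensorProduct.map_add_right]
  map_update_smul' := by
    intro inst m i c x
    obtain rfl : inst = instDecidableEqFin 3 := Subsingleton.elim _ _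
    refine LinearMap.ext fun u => LinearMap.ext fun u' => ?_
    fin_cases i <;>
      simp [TensorProduct.map_smul_left, TensorProduct.map_smul_right]

/-- The double spin decomposition
`⋀³(⋀² E) → (S² E ⊗ ⋀⁴ E) ⊕ (S² E* ⊗ (⋀⁴ E)^{⊗ 2})`, natural in `E`, obtained from
the two trilinear maps above by antisymmetrizing in the three elements of `⋀² E`. -/
noncomputable def spinDecomposition : ⋀[ℂ]^3 (⋀[ℂ]^2 E) →ₗ[ℂ] SpinSpace E :=
  (symmetrize _ _ ∘ₗ exteriorPower.alternatingMapLinearEquiv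
      (MultilinearMap.alternatization (N' := Dual ℂ E →ₗ[ℂ] Dual ℂ E →ₗ[ℂ] ⋀[ℂ]^4 E)
        (vTrilinear E))).prod
    (symmetrize _ _ ∘ₗ exteriorPower.alternatingMapLinearEquiv
      (MultilinearMap.alternatization (N' := E →ₗ[ℂ] E →ₗ[ℂ] (⋀[ℂ]^4 E ⊗[ℂ] ⋀[ℂ]^4 E))
        (wTrilinear E)))

variable {E}

/-- The Plücker line `⋀³ U ⊆ ⋀³ W` of a subspace `U ⊆ W` of dimension three. -/
noncomputable def pluckerLine {W : Type*} [AddCommGroup W] [Module ℂ W] (U : Submodule ℂ W) :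
    Submodule ℂ (⋀[ℂ]^3 W) :=
  LinearMap.range (exteriorPower.map 3 U.subtype)

/-- `U ⊆ ⋀² E` is isotropic for the symmetric form `⋀² E × ⋀² E → ⋀⁴ E`. -/
def IsIsotropic (U : Submodule ℂ (⋀[ℂ]^2 E)) : Prop :=
  ∀ a ∈ U, ∀ b ∈ U, wedgeForm E a b = 0

/-- The subspace of `⋀² E*` which corresponds to `U ⊆ ⋀² E` under the canonical isomorphism
`⋀² E* ≃ ⋀² E ⊗ (⋀⁴ E)*` (for `dim E = 4`): it consists of the elements that pair with
`x` in `⋀² E` as `x ↦ θ (u ∧ x)`, where `u ∈ U` and `θ ∈ (⋀⁴ E)*`. -/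
noncomputable def dualSubspace (U : Submodule ℂ (⋀[ℂ]^2 E)) : Submodule ℂ (⋀[ℂ]^2 (Dual ℂ E)) :=
  Submodule.span ℂ {η | ∃ u ∈ U, ∃ θ : Dual ℂ (⋀[ℂ]^4 E),
    exteriorPower.pairingDual ℂ E 2 η = θ ∘ₗ wedgeForm E u}

end Algebra

/-! ### Zariski topology -/

/-- The Zariski topology on a complex vector space: the sets where some polynomial in finitely many
linear forms does not vanish are a basis of open sets. -/
def zariskiTopology (W : Type*) [AddCommGroup W] [Module ℂ W] : TopologicalSpace W :=
  TopologicalSpace.generateFrom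
    (Set.range fun p : MvPolynomial (Dual ℂ W) ℂ => {w | MvPolynomial.eval (fun l => l w) p ≠ 0})

/-- The connected components of a subset `S` of a topological space. -/
def componentsOf {X : Type*} [TopologicalSpace X] (S : Set X) : Set (Set X) :=
  {C | ∃ x ∈ S, C = connectedComponentIn S x}

/-! ### The bundle `T(-1)` on `ℙ(V)` and the Grassmannian bundle `G(3, ⋀² T(-1))` -/

section Geometry

variable (V : Type*) [AddCommGroup V] [Module ℂ V]

variable {V} in
/-- The fibre `V / V₁` of `T(-1)` at the point `[V₁]` of `ℙ(V)`. -/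
abbrev TFibre (L : ℙ ℂ V) : Type _ := V ⧸ L.submodule

/-- The points `([V₁], [Ū])` of the Grassmannian bundle `G(3, ⋀² T(-1))` over `ℙ(V)`. -/
@[ext]
structure Y3 where
  /-- The point `[V₁]` of `ℙ(V)`. -/
  base : ℙ ℂ V
  /-- The subspace `Ū` of `⋀² (V / V₁)`. -/
  space : Submodule ℂ (⋀[ℂ]^2 (TFibre base))
  finrank_space : finrank ℂ space = 3

/-- A frame: a nonzero vector `v` of `V`, and three elements of `⋀² V` with linearly independent
images in `⋀² (V / ℂ v)`. -/
structure Frame where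
  /-- The vector `v`. -/
  vec : V
  vec_ne : vec ≠ 0
  /-- The three elements of `⋀² V`. -/
  bivec : Fin 3 → ⋀[ℂ]^2 V
  indep : LinearIndependent ℂ fun k =>
    exteriorPower.map 2 (Projectivization.mk ℂ vec vec_ne).submodule.mkQ (bivec k)

variable {V} in
/-- The point of `G(3, ⋀² T(-1))` spanned by a frame. -/
noncomputable def Frame.toPoint (F : Frame V) : Y3 V where
  base := Projectivization.mk ℂ F.vec F.vec_ne
  space := Submodule.span ℂ (Set.range fun k =>
    exteriorPower.map 2 (Projectivization.mk ℂ F.vec F.vec_ne).submodule.mkQ (F.bivec k))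
  finrank_space := by
    rw [finrank_span_eq_card F.indep, Fintype.card_fin]

/-- Frames form a subset of the vector space `V × (⋀² V)³`, with its Zariski topology. -/
noncomputable instance : TopologicalSpace (Frame V) :=
  TopologicalSpace.induced (fun F => (F.vec, F.bivec)) (zariskiTopology (V × (Fin 3 → ⋀[ℂ]^2 V)))

/-- The Zariski topology of the Grassmannian bundle, as the quotient topology from frames. -/
noncomputable instance : TopologicalSpace (Y3 V) :=
  TopologicalSpace.coinduced Frame.toPoint inferInstance

variable {V}

/-- The projection `𝒴₃ → G(3, ⋀³ V)`, `([V₁], [Ū]) ↦ [Ū ∧ V₁]`; its image is `𝒴̄`. -/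
noncomputable def toYbar (y : Y3 V) : Submodule ℂ (⋀[ℂ]^3 V) :=
  Submodule.span ℂ {z | ∃ a : ⋀[ℂ]^2 V, exteriorPower.map 2 y.base.submodule.mkQ a ∈ y.space ∧
    ∃ v ∈ y.base.submodule,
      (z : ExteriorAlgebra ℂ V) = (a : ExteriorAlgebra ℂ V) * ExteriorAlgebra.ι ℂ v}

variable (V)

/-- The locus in `G(3, ⋀³ V)` of the `ρ`-planes `(V / V₂) ∧ (⋀² V₂)`, where `dim V₂ = 2`. -/
def PrhoBar : Set (Submodule ℂ (⋀[ℂ]^3 V)) :=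
  {U | ∃ V₂ : Submodule ℂ V, finrank ℂ V₂ = 2 ∧
    U = Submodule.span ℂ {z | ∃ x : V, ∃ y ∈ V₂, ∃ y' ∈ V₂, z = exteriorPower.ιMulti ℂ 3 ![x, y, y']}}

/-- The locus in `G(3, ⋀³ V)` of the `σ`-planes `⋀² (V₄ / V₁) ∧ V₁`, where `V₁ ⊆ V₄`, `dim V₁ = 1`
and `dim V₄ = 4`. -/
def PsigmaBar : Set (Submodule ℂ (⋀[ℂ]^3 V)) :=
  {U | ∃ V₁ V₄ : Submodule ℂ V, finrank ℂ V₁ = 1 ∧ finrank ℂ V₄ = 4 ∧ V₁ ≤ V₄ ∧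
    U = Submodule.span ℂ {z | ∃ x ∈ V₄, ∃ y ∈ V₄, ∃ v ∈ V₁, z = exteriorPower.ιMulti ℂ 3 ![x, y, v]}}

/-- `𝒫_ρ`: the exceptional set of `𝒴₃ → 𝒴̄`, that is the set of the points which do not form the
whole fibre through them. -/
def Prho : Set (Y3 V) := {y | ∃ y' : Y3 V, y' ≠ y ∧ toYbar y' = toYbar y}

/-- `𝒫_σ`: the proper transform in `𝒴₃` of the locus of `σ`-planes, that is the closure of the
inverse image of its part over which `𝒴₃ → 𝒴̄` is an isomorphism. -/
def Psigma : Set (Y3 V) := closure (toYbar ⁻¹' (PsigmaBar V \ toYbar '' Prho V))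

/-- The relative orthogonal Grassmannian `OG(3, ⋀² T(-1))` in `G(3, ⋀² T(-1))`. -/
def OG : Set (Y3 V) := {y | IsIsotropic y.space}

/-- The relative orthogonal Grassmannian `OG(3, ⋀² T(-1)*)`, as a subset of `G(3, ⋀² T(-1))` by
means of `⋀² T(-1)* ≃ ⋀² T(-1) ⊗ (⋀⁴ T(-1))*`. -/
def OGDual : Set (Y3 V) := {y | IsIsotropic (dualSubspace y.space)}

variable {V}

/-- The fibre of `𝒴₃` over a point of `ℙ(V)`. -/
def fibre (L : ℙ ℂ V) : Set (Y3 V) := {y | y.base = L}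

/-- The double spin embedding `i` of `𝒴₃ = G(3, ⋀² T(-1))` in the bundle of the projective spaces of
lines in `S² T(-1) ⊗ ⋀⁴ T(-1) ⊕ S² T(-1)* ⊗ (⋀⁴ T(-1))^{⊗ 2}`: the image of the Plücker line under
the double spin decomposition. -/
noncomputable def spinEmbedding (y : Y3 V) :
    Σ L : ℙ ℂ V, Submodule ℂ (SpinSpace (TFibre L)) :=
  ⟨y.base, (pluckerLine y.space).map (spinDecomposition (TFibre y.base))⟩

/-- The second Veronese map on `ℙ(T(-1))`: `[e] ↦ [e²]`, with values in the first summand. -/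
noncomputable def veroneseT (p : Σ L : ℙ ℂ V, ℙ ℂ (TFibre L)) :
    Σ L : ℙ ℂ V, Submodule ℂ (SpinSpace (TFibre L)) :=
  ⟨p.1, Submodule.span ℂ {s | ∃ e ∈ p.2.submodule, ∃ m : ⋀[ℂ]^4 (TFibre p.1),
    s = (squareForm (Dual.eval ℂ (TFibre p.1) e) m, 0)}⟩

/-- The second Veronese map on `ℙ(T(-1)*)`: `[l] ↦ [l²]`, with values in the second summand. -/
noncomputable def veroneseTDual (p : Σ L : ℙ ℂ V, ℙ ℂ (Dual ℂ (TFibre L))) :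
    Σ L : ℙ ℂ V, Submodule ℂ (SpinSpace (TFibre L)) :=
  ⟨p.1, Submodule.span ℂ {s | ∃ l ∈ p.2.submodule,
    ∃ m : ⋀[ℂ]^4 (TFibre p.1) ⊗[ℂ] ⋀[ℂ]^4 (TFibre p.1), s = (0, squareForm l m)}⟩

end Geometry

end DoubleSpin

/-! Write `E = V/V₁`. In suitable bases all the loci become explicit. Call `Ū` a ρ-plane if it is
spanned by `b 0 ∧ b 1`, `b 0 ∧ b 2`, `b 0 ∧ b 3` for some basis `b` of `E`, and a σ-plane if it is
spanned by the products of `b 1`, `b 2`, `b 3`. The proof identifies `Prho` and `Psigma` with the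
sets `planeLocus` of these two types; every claim is then checked on bases.

The map `toYbar` is injective on each fibre over `ℙ(V)` (`eq_of_base_eq_of_toYbar_eq`). Two points
with the same image thus have different base vectors `v` and `v'`, both annihilating that image.
Hence the class `e` of `v'` in `E` annihilates `Ū`, which forces `Ū = e ∧ E`
(`Prho_subset_planeLocus`). Conversely, a ρ-plane has an image `V ∧ ⋀² V₂`, and any line of `V₂` may
serve as `V₁` (`exists_ne_toYbar_eq`). Off `Prho` the fibres of `toYbar` are single points, so the
preimage of the remaining σ-planes is the σ-locus (`preimage_PsigmaBar`); this locus is already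
closed and equals its closure.

A maximal isotropic `Ū` is a ρ-plane or a σ-plane (`exists_plane_of_isIsotropic`), never both
(`plane_rhoPairs_ne_plane_sigmaPairs`). Both loci are closed, being defined on frames by rank
conditions on a linear map with polynomial entries (`Frame.toPoint_mem_rho_iff`,
`Frame.toPoint_mem_sigma_iff`). Both are connected, because two bases of `V` are joined by a complex
line from which finitely many parameters are removed (`exists_isPreconnected_planeLocus`). Two
disjoint closed connected sets are the components of their union, globally and on each fibre
(`componentsOf_union`).

For the double spin map, direct computation gives `12 e²` on a ρ-plane and `-12 l²` on a σ-plane.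
Squares span the symmetric forms, so the map is onto, and the dimension count 20 = 10 + 10 makes it
bijective. -/

namespace DoubleSpin

/-! ### Coordinates on `⋀² E` and `⋀⁴ E` for `dim E = 4`. -/

section Coordinates

variable {E : Type*} [AddCommGroup E] [Module ℂ E]

theorem wedgeVec_apply (x y : E) : wedgeVec E x y = exteriorPower.ιMulti ℂ 2 ![x, y] := rfl

@[simp]
theorem coe_wedgeVec (x y : E) :
    (wedgeVec E x y : ExteriorAlgebra ℂ E) = ExteriorAlgebra.ι ℂ x * ExteriorAlgebra.ι ℂ y := by
  simp [wedgeVec_apply, ExteriorAlgebra.ιMulti_apply]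

@[simp]
theorem coe_wedgeForm (a b : ⋀[ℂ]^2 E) :
    (wedgeForm E a b : ExteriorAlgebra ℂ E) = (a : ExteriorAlgebra ℂ E) * b := rfl

@[simp]
theorem wedgeVec_self (x : E) : wedgeVec E x x = 0 := by
  ext; simp

theorem wedgeVec_swap (x y : E) : wedgeVec E x y = -wedgeVec E y x := by
  have h := wedgeVec_self (x + y)
  simp only [map_add, LinearMap.add_apply, wedgeVec_self, zero_add, add_zero] at h
  exact eq_neg_of_add_eq_zero_right h

theorem wedgeForm_wedgeVec (x y z t : E) :
    wedgeForm E (wedgeVec E x y) (wedgeVec E z t) = exteriorPower.ιMulti ℂ 4 ![x, y, z, t] := by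
  ext
  simp [ExteriorAlgebra.ιMulti_apply, mul_assoc]

/-- Linear maps on `⋀² E` are determined by their values on the products of two vectors. -/
theorem bivector_hom_ext {N : Type*} [AddCommGroup N] [Module ℂ N] {f g : ⋀[ℂ]^2 E →ₗ[ℂ] N}
    (h : ∀ x y, f (wedgeVec E x y) = g (wedgeVec E x y)) : f = g := by
  refine exteriorPower.linearMap_ext (AlternatingMap.ext fun m => ?_)
  have hm : m = ![m 0, m 1] := by
    ext i
    fin_cases i <;> rfl
  have := h (m 0) (m 1)
  rw [wedgeVec_apply, ← hm] at this
  simpa using this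

/-- The sign of `(i, j, k, l)` as a permutation of `(0, 1, 2, 3)`, and zero if there is a repetition,
written as a quotient of Vandermonde determinants. -/
def signFour (i j k l : Fin 4) : ℤ :=
  ((j : ℤ) - i) * ((k : ℤ) - i) * ((l : ℤ) - i) * ((k : ℤ) - j) * ((l : ℤ) - j) * ((l : ℤ) - k) / 12

/-- The top exterior power is generated by the product of the vectors of a basis. -/
theorem eq_smul_ιMulti_basis {n : ℕ} (b : Basis (Fin n) ℂ E) (m : ⋀[ℂ]^n E) :
    m = exteriorPower.alternatingMapLinearEquiv b.det m • exteriorPower.ιMulti ℂ n b := by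
  have : LinearMap.id = (LinearMap.toSpanSingleton ℂ _ (exteriorPower.ιMulti ℂ n b)) ∘ₗ
      exteriorPower.alternatingMapLinearEquiv b.det := by
    refine exteriorPower.linearMap_ext ?_
    refine Basis.ext_alternating b fun v hv => ?_
    let σ : Equiv.Perm (Fin n) := Equiv.ofBijective v (Finite.injective_iff_bijective.1 hv)
    change exteriorPower.ιMulti ℂ n (b ∘ σ) = exteriorPower.alternatingMapLinearEquiv b.det
      (exteriorPower.ιMulti ℂ n (b ∘ σ)) • exteriorPower.ιMulti ℂ n b
    rw [AlternatingMap.map_perm]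
    rcases Int.units_eq_one_or (Equiv.Perm.sign σ) with h | h <;> rw [h] <;> simp [Basis.det_self]
  exact LinearMap.congr_fun this m

/-- The generator of `⋀⁴ E` given by a basis of `E`. -/
noncomputable def vol (b : Basis (Fin 4) ℂ E) : ⋀[ℂ]^4 E := exteriorPower.ιMulti ℂ 4 b

/-- The coordinate on `⋀⁴ E` with respect to the generator `vol b`. -/
noncomputable def volCoord (b : Basis (Fin 4) ℂ E) : Dual ℂ (⋀[ℂ]^4 E) :=
  exteriorPower.alternatingMapLinearEquiv b.det

@[simp]
theorem volCoord_vol (b : Basis (Fin 4) ℂ E) : volCoord b (vol b) = 1 := by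
  simp [volCoord, vol, Basis.det_self]

theorem vol_ne_zero (b : Basis (Fin 4) ℂ E) : vol b ≠ 0 := by
  intro h
  simpa [h] using volCoord_vol b

theorem eq_smul_vol (b : Basis (Fin 4) ℂ E) (m : ⋀[ℂ]^4 E) : m = volCoord b m • vol b :=
  eq_smul_ιMulti_basis b m

theorem signFour_perm : ∀ σ : Equiv.Perm (Fin 4),
    signFour (σ 0) (σ 1) (σ 2) (σ 3) = Equiv.Perm.sign σ := by decide

theorem signFour_of_not_injective (v : Fin 4 → Fin 4) (hv : ¬ Function.Injective v) :
    signFour (v 0) (v 1) (v 2) (v 3) = 0 := by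
  have key : ∀ a b c d : Fin 4, (a = b ∨ a = c ∨ a = d ∨ b = c ∨ b = d ∨ c = d) →
      signFour a b c d = 0 := by decide
  apply key
  by_contra! h
  apply hv
  intro i j hij
  by_contra hne
  fin_cases i <;> fin_cases j <;> simp_all

theorem ιMulti_basis (b : Basis (Fin 4) ℂ E) (i j k l : Fin 4) :
    exteriorPower.ιMulti ℂ 4 ![b i, b j, b k, b l] = (signFour i j k l : ℂ) • vol b := by
  have hb : ![b i, b j, b k, b l] = b ∘ ![i, j, k, l] := by
    ext n
    fin_cases n <;> rfl
  rw [hb]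
  by_cases hv : Function.Injective ![i, j, k, l]
  · let σ : Equiv.Perm (Fin 4) := Equiv.ofBijective _ (Finite.injective_iff_bijective.1 hv)
    have h1 := signFour_perm σ
    change signFour i j k l = _ at h1
    rw [h1]
    change exteriorPower.ιMulti ℂ 4 (b ∘ σ) = _
    rw [AlternatingMap.map_perm, vol, Units.smul_def, ← Int.cast_smul_eq_zsmul ℂ]
  · have := signFour_of_not_injective _ hv
    simp only [Matrix.cons_val] at this
    rw [this]
    simp only [Function.Injective, not_forall] at hv
    obtain ⟨p, q, hpq, hne⟩ := hv
    rw [AlternatingMap.map_eq_zero_of_eq _ (b ∘ ![i, j, k, l]) (congrArg b hpq) hne]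
    simp

theorem wedgeForm_basis (b : Basis (Fin 4) ℂ E) (i j k l : Fin 4) :
    wedgeForm E (wedgeVec E (b i) (b j)) (wedgeVec E (b k) (b l)) =
      (signFour i j k l : ℂ) • vol b := by
  rw [wedgeForm_wedgeVec, ιMulti_basis]

/-- The bivector with given coordinates in a basis of `E`, in the order `01, 02, 03, 12, 13, 23`. -/
noncomputable def bivector (b : Basis (Fin 4) ℂ E) (c : Fin 6 → ℂ) : ⋀[ℂ]^2 E :=
  c 0 • wedgeVec E (b 0) (b 1) + c 1 • wedgeVec E (b 0) (b 2) + c 2 • wedgeVec E (b 0) (b 3) +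
  c 3 • wedgeVec E (b 1) (b 2) + c 4 • wedgeVec E (b 1) (b 3) + c 5 • wedgeVec E (b 2) (b 3)

/-- The polarization of the Plücker quadric `c 0 c 5 - c 1 c 4 + c 2 c 3`, up to a factor of two.
Complementary index pairs are dual to each other, so isotropy and nondegeneracy can be read off from
coordinates. -/
theorem wedgeForm_bivector (b : Basis (Fin 4) ℂ E) (c d : Fin 6 → ℂ) :
    wedgeForm E (bivector b c) (bivector b d) =
      (c 0 * d 5 - c 1 * d 4 + c 2 * d 3 + c 3 * d 2 - c 4 * d 1 + c 5 * d 0) • vol b := by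
  simp only [bivector, map_add, map_smul, LinearMap.add_apply, LinearMap.smul_apply,
    wedgeForm_basis, signFour]
  norm_num
  module

theorem exists_eq_bivector (b : Basis (Fin 4) ℂ E) (a : ⋀[ℂ]^2 E) : ∃ c, a = bivector b c := by
  have ha : a ∈ Submodule.span ℂ (Set.range (exteriorPower.ιMulti ℂ 2 (M := E))) := by
    rw [exteriorPower.ιMulti_span]; trivial
  induction ha using Submodule.span_induction with
  | mem x hx =>
    obtain ⟨m, rfl⟩ := hx
    have hm : exteriorPower.ιMulti ℂ 2 m = wedgeVec E (m 0) (m 1) := by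
      rw [wedgeVec_apply]
      congr 1
      ext i
      fin_cases i <;> rfl
    rw [hm, ← b.sum_repr (m 0), ← b.sum_repr (m 1)]
    generalize b.repr (m 0) = x
    generalize b.repr (m 1) = y
    refine ⟨![x 0 * y 1 - x 1 * y 0, x 0 * y 2 - x 2 * y 0, x 0 * y 3 - x 3 * y 0,
      x 1 * y 2 - x 2 * y 1, x 1 * y 3 - x 3 * y 1, x 2 * y 3 - x 3 * y 2], ?_⟩
    simp only [Fin.sum_univ_four, bivector, map_add, map_smul, LinearMap.add_apply,
      LinearMap.smul_apply, wedgeVec_self, wedgeVec_swap (b 1) (b 0), wedgeVec_swap (b 2) (b 0),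
      wedgeVec_swap (b 3) (b 0), wedgeVec_swap (b 2) (b 1), wedgeVec_swap (b 3) (b 1),
      wedgeVec_swap (b 3) (b 2), Matrix.cons_val]
    module
  | zero => exact ⟨0, by simp [bivector]⟩
  | add x y _ _ hx hy =>
    obtain ⟨c, rfl⟩ := hx
    obtain ⟨d, rfl⟩ := hy
    exact ⟨c + d, by simp only [bivector, Pi.add_apply]; module⟩
  | smul r x _ hx =>
    obtain ⟨c, rfl⟩ := hx
    exact ⟨r • c, by simp only [bivector, Pi.smul_apply, smul_eq_mul]; module⟩

/-- Nondegeneracy of the wedge form: pairing with the six coordinate bivectors recovers each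
coordinate up to sign. -/
theorem bivector_injective (b : Basis (Fin 4) ℂ E) : Function.Injective (bivector b) := by
  intro c d h
  have key : ∀ e : Fin 6 → ℂ, wedgeForm E (bivector b c) (bivector b e) =
      wedgeForm E (bivector b d) (bivector b e) := fun e => by rw [h]
  simp only [wedgeForm_bivector, smul_left_injective ℂ (vol_ne_zero b) |>.eq_iff] at key
  ext i
  have h0 := key ![0, 0, 0, 0, 0, 1]
  have h1 := key ![0, 0, 0, 0, 1, 0]
  have h2 := key ![0, 0, 0, 1, 0, 0]
  have h3 := key ![0, 0, 1, 0, 0, 0]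
  have h4 := key ![0, 1, 0, 0, 0, 0]
  have h5 := key ![1, 0, 0, 0, 0, 0]
  simp at h0 h1 h2 h3 h4 h5
  fin_cases i <;> simp [*]

end Coordinates

/-! ### Maximal isotropic subspaces of `⋀² E`: the two families of planes. -/

section Classification

variable {E : Type*} [AddCommGroup E] [Module ℂ E]

/-- A linearly independent family of `k` vectors in a space of dimension `n` is the beginning of a
basis. -/
theorem exists_basis_extending {n k : ℕ} [FiniteDimensional ℂ E] (hn : finrank ℂ E = n)
    (v : Fin k → E) (hv : LinearIndependent ℂ v) (hk : k ≤ n) :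
    ∃ b : Basis (Fin n) ℂ E, ∀ i, b (Fin.castLE hk i) = v i := by
  obtain ⟨d, rfl⟩ := Nat.exists_eq_add_of_le hk
  induction d generalizing k with
  | zero =>
    refine ⟨basisOfLinearIndependentOfCardEqFinrank' v hv (by simpa using hn.symm), fun i => ?_⟩
    simp
  | succ d ih =>
    have hlt : Submodule.span ℂ (Set.range v) < ⊤ := by
      refine Submodule.lt_top_of_finrank_lt_finrank ?_
      rw [finrank_span_eq_card hv, Fintype.card_fin]
      omega
    obtain ⟨x, -, hx⟩ := SetLike.exists_of_lt hlt
    obtain ⟨b, hb⟩ := ih (k := k + 1) (v := Fin.snoc v x) (hv := hv.finSnoc hx)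
      (hk := by omega) (hn := by omega)
    refine ⟨b.reindex (finCongr (by omega)), fun i => ?_⟩
    have := hb i.castSucc
    simpa using this

theorem finiteDimensional_of_finrank {n : ℕ} (hn : finrank ℂ E = n + 1) : FiniteDimensional ℂ E :=
  Module.finite_of_finrank_pos (by omega)

/-- The span of the products `b i ∧ b j`, where `(i, j)` runs through three given pairs. -/
noncomputable def plane (s : Fin 3 → Fin 4 × Fin 4) (b : Fin 4 → E) : Submodule ℂ (⋀[ℂ]^2 E) :=
  Submodule.span ℂ (Set.range fun k => wedgeVec E (b (s k).1) (b (s k).2))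

/-- The pairs for `ρ`-planes. -/
def rhoPairs : Fin 3 → Fin 4 × Fin 4 := ![(0, 1), (0, 2), (0, 3)]

/-- The pairs for `σ`-planes. -/
def sigmaPairs : Fin 3 → Fin 4 × Fin 4 := ![(1, 2), (1, 3), (2, 3)]

theorem wedgeVec_basis_eq_bivector (b : Basis (Fin 4) ℂ E) :
    wedgeVec E (b 0) (b 1) = bivector b ![1, 0, 0, 0, 0, 0] ∧
    wedgeVec E (b 0) (b 2) = bivector b ![0, 1, 0, 0, 0, 0] ∧
    wedgeVec E (b 0) (b 3) = bivector b ![0, 0, 1, 0, 0, 0] ∧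
    wedgeVec E (b 1) (b 2) = bivector b ![0, 0, 0, 1, 0, 0] ∧
    wedgeVec E (b 1) (b 3) = bivector b ![0, 0, 0, 0, 1, 0] ∧
    wedgeVec E (b 2) (b 3) = bivector b ![0, 0, 0, 0, 0, 1] := by
  simp [bivector]

theorem plane_rhoPairs (b : Fin 4 → E) : plane rhoPairs b = Submodule.span ℂ
    {wedgeVec E (b 0) (b 1), wedgeVec E (b 0) (b 2), wedgeVec E (b 0) (b 3)} := by
  unfold plane
  congr 1
  ext x
  simp [Fin.exists_fin_succ, rhoPairs, eq_comm]

theorem plane_sigmaPairs (b : Fin 4 → E) : plane sigmaPairs b = Submodule.span ℂ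
    {wedgeVec E (b 1) (b 2), wedgeVec E (b 1) (b 3), wedgeVec E (b 2) (b 3)} := by
  unfold plane
  congr 1
  ext x
  simp [Fin.exists_fin_succ, sigmaPairs, eq_comm]

theorem mem_plane_rhoPairs (b : Basis (Fin 4) ℂ E) (c : Fin 6 → ℂ) :
    bivector b c ∈ plane rhoPairs b ↔ c 3 = 0 ∧ c 4 = 0 ∧ c 5 = 0 := by
  rw [plane_rhoPairs]
  simp only [Submodule.mem_span_triple]
  constructor
  · rintro ⟨x, y, z, h⟩
    have : bivector b ![x, y, z, 0, 0, 0] = bivector b c := by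
      rw [← h]; simp [bivector]
    have := bivector_injective b this
    simp [← this]
  · rintro ⟨h3, h4, h5⟩
    exact ⟨c 0, c 1, c 2, by simp [bivector, h3, h4, h5]⟩

theorem mem_plane_sigmaPairs (b : Basis (Fin 4) ℂ E) (c : Fin 6 → ℂ) :
    bivector b c ∈ plane sigmaPairs b ↔ c 0 = 0 ∧ c 1 = 0 ∧ c 2 = 0 := by
  rw [plane_sigmaPairs]
  simp only [Submodule.mem_span_triple]
  constructor
  · rintro ⟨x, y, z, h⟩
    have : bivector b ![0, 0, 0, x, y, z] = bivector b c := by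
      rw [← h]; simp [bivector]
    have := bivector_injective b this
    simp [← this]
  · rintro ⟨h3, h4, h5⟩
    exact ⟨c 3, c 4, c 5, by simp [bivector, h3, h4, h5]⟩

theorem linearIndependent_rhoPairs (b : Basis (Fin 4) ℂ E) :
    LinearIndependent ℂ fun k => wedgeVec E (b (rhoPairs k).1) (b (rhoPairs k).2) := by
  rw [Fintype.linearIndependent_iff]
  intro g hg
  have : bivector b ![g 0, g 1, g 2, 0, 0, 0] = bivector b 0 := by
    simpa [bivector, Fin.sum_univ_three, rhoPairs] using hg
  have h := bivector_injective b this
  have h0 := congrFun h 0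
  have h1 := congrFun h 1
  have h2 := congrFun h 2
  simp at h0 h1 h2
  intro i
  fin_cases i <;> simpa

theorem linearIndependent_sigmaPairs (b : Basis (Fin 4) ℂ E) :
    LinearIndependent ℂ fun k => wedgeVec E (b (sigmaPairs k).1) (b (sigmaPairs k).2) := by
  rw [Fintype.linearIndependent_iff]
  intro g hg
  have : bivector b ![0, 0, 0, g 0, g 1, g 2] = bivector b 0 := by
    simpa [bivector, Fin.sum_univ_three, sigmaPairs] using hg
  have h := bivector_injective b this
  have h0 := congrFun h 3
  have h1 := congrFun h 4
  have h2 := congrFun h 5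
  simp at h0 h1 h2
  intro i
  fin_cases i <;> simpa

theorem finrank_plane {s : Fin 3 → Fin 4 × Fin 4} {b : Fin 4 → E}
    (h : LinearIndependent ℂ fun k => wedgeVec E (b (s k).1) (b (s k).2)) :
    finrank ℂ (plane s b) = 3 := by
  rw [plane, finrank_span_eq_card h, Fintype.card_fin]

/-- A nonzero bivector has a nonzero product with some decomposable bivector. -/
theorem exists_wedgeForm_ne_zero (hE : finrank ℂ E = 4) {a : ⋀[ℂ]^2 E} (ha : a ≠ 0) :
    ∃ z t, wedgeForm E a (wedgeVec E z t) ≠ 0 := by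
  by_contra! h
  have : FiniteDimensional ℂ E := finiteDimensional_of_finrank hE
  let b := finBasisOfFinrankEq ℂ E hE
  have h0 : wedgeForm E a = 0 := bivector_hom_ext h
  obtain ⟨c, rfl⟩ := exists_eq_bivector b a
  apply ha
  have key : ∀ e : Fin 6 → ℂ, wedgeForm E (bivector b c) (bivector b e) = 0 := fun e => by
    rw [h0, LinearMap.zero_apply]
  simp only [wedgeForm_bivector, smul_eq_zero, vol_ne_zero b, or_false] at key
  have h0 := key ![0, 0, 0, 0, 0, 1]
  have h1 := key ![0, 0, 0, 0, 1, 0]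
  have h2 := key ![0, 0, 0, 1, 0, 0]
  have h3 := key ![0, 0, 1, 0, 0, 0]
  have h4 := key ![0, 1, 0, 0, 0, 0]
  have h5 := key ![1, 0, 0, 0, 0, 0]
  simp at h0 h1 h2 h3 h4 h5
  simp [bivector, *]

theorem linearIndependent_of_wedgeVec_ne_zero {x y : E} (h : wedgeVec E x y ≠ 0) :
    LinearIndependent ℂ ![x, y] := by
  rw [LinearIndependent.pair_iff]
  intro s t hst
  have h1 : wedgeVec E (s • x + t • y) y = s • wedgeVec E x y := by
    simp
  have h2 : wedgeVec E x (s • x + t • y) = t • wedgeVec E x y := by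
    simp
  rw [hst] at h1 h2
  simp only [map_zero, LinearMap.zero_apply] at h1 h2
  exact ⟨(smul_eq_zero.1 h1.symm).resolve_right h, (smul_eq_zero.1 h2.symm).resolve_right h⟩

/-- The Plücker relation characterizes decomposable bivectors. A basis is chosen in which the
coordinate `c 5` is invertible; the relation then determines `c 0`, and the two factors can be
written down. -/
theorem exists_eq_wedgeVec (hE : finrank ℂ E = 4) {a : ⋀[ℂ]^2 E} (h : wedgeForm E a a = 0) :
    ∃ x y, a = wedgeVec E x y := by
  by_cases ha : a = 0
  · exact ⟨0, 0, by simp [ha]⟩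
  have : FiniteDimensional ℂ E := finiteDimensional_of_finrank hE
  obtain ⟨z, t, hzt⟩ := exists_wedgeForm_ne_zero hE ha
  have hli : LinearIndependent ℂ ![z, t] := by
    refine linearIndependent_of_wedgeVec_ne_zero fun h0 => hzt ?_
    rw [h0, map_zero]
  obtain ⟨b, hb⟩ := exists_basis_extending hE _ hli (by norm_num)
  have hz : b 0 = z := hb 0
  have ht : b 1 = t := hb 1
  obtain ⟨c, rfl⟩ := exists_eq_bivector b a
  rw [← hz, ← ht, (wedgeVec_basis_eq_bivector b).1, wedgeForm_bivector] at hzt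
  have h5 : c 5 ≠ 0 := by
    rintro h5
    simp [h5] at hzt
  rw [wedgeForm_bivector, smul_eq_zero, or_iff_left (vol_ne_zero b)] at h
  have h0 : c 0 = (c 5)⁻¹ * (c 4 * c 1 - c 2 * c 3) := by
    field_simp
    linear_combination h / 2
  -- The product of these vectors has the coordinates `c 1`, ..., `c 5` by construction; its
  -- coordinate on `b 0 ∧ b 1` is the expression for `c 0` in `h0`.
  refine ⟨b 2 + (c 5)⁻¹ • (c 2 • b 0 + c 4 • b 1), c 5 • b 3 - c 1 • b 0 - c 3 • b 1, ?_⟩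
  simp only [bivector, map_add, map_sub, map_smul, LinearMap.add_apply, LinearMap.smul_apply,
    wedgeVec_self, wedgeVec_swap (b 1) (b 0), wedgeVec_swap (b 2) (b 0),
    wedgeVec_swap (b 2) (b 1), h0]
  match_scalars <;> field_simp

/-- A decomposable bivector is divisible by each nonzero vector of its plane. -/
theorem exists_wedgeVec_eq (x y : E) (s t : ℂ) (h : s • x + t • y ≠ 0) :
    ∃ p, wedgeVec E x y = wedgeVec E (s • x + t • y) p := by
  by_cases hs : s = 0
  · subst hs
    have ht : t ≠ 0 := by rintro rfl; simp at h
    refine ⟨-t⁻¹ • x, ?_⟩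
    simp [wedgeVec_swap y x, ht]
  · exact ⟨s⁻¹ • y, by simp [hs]⟩

/-- Two isotropic and orthogonal bivectors which are independent are the products of two vectors
of a basis with a third one. -/
theorem exists_basis_of_isotropic_pair (hE : finrank ℂ E = 4) {a₁ a₂ : ⋀[ℂ]^2 E}
    (hli : LinearIndependent ℂ ![a₁, a₂]) (h₁ : wedgeForm E a₁ a₁ = 0) (h₂ : wedgeForm E a₂ a₂ = 0)
    (h₁₂ : wedgeForm E a₁ a₂ = 0) :
    ∃ b : Basis (Fin 4) ℂ E, a₁ = wedgeVec E (b 0) (b 1) ∧ a₂ = wedgeVec E (b 0) (b 2) := by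
  have : FiniteDimensional ℂ E := finiteDimensional_of_finrank hE
  have ha₁ : a₁ ≠ 0 := hli.ne_zero 0
  have ha₂ : a₂ ≠ 0 := hli.ne_zero 1
  obtain ⟨x, y, rfl⟩ := exists_eq_wedgeVec hE h₁
  obtain ⟨z, t, rfl⟩ := exists_eq_wedgeVec hE h₂
  have hxy := LinearIndependent.pair_iff.1 (linearIndependent_of_wedgeVec_ne_zero ha₁)
  have hzt := LinearIndependent.pair_iff.1 (linearIndependent_of_wedgeVec_ne_zero ha₂)
  -- Four independent vectors would have a nonzero product, so the two planes meet.
  have hdep : ¬ LinearIndependent ℂ ![x, y, z, t] := by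
    intro hli
    obtain ⟨b, hb⟩ := exists_basis_extending hE _ hli le_rfl
    have hb' : ⇑b = ![x, y, z, t] := funext hb
    rw [wedgeForm_wedgeVec, ← hb'] at h₁₂
    exact vol_ne_zero b h₁₂
  rw [Fintype.linearIndependent_iff] at hdep
  push Not at hdep
  obtain ⟨g, hg, i, hi⟩ := hdep
  simp only [Fin.sum_univ_four, Matrix.cons_val] at hg
  -- Separating the two sides of the dependence relation gives a vector common to both planes; each
  -- bivector is then divisible by it.
  have he : g 0 • x + g 1 • y = (-g 2) • z + (-g 3) • t := by
    rw [← sub_eq_zero, ← hg]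
    module
  have hne : g 0 • x + g 1 • y ≠ 0 := by
    intro h0
    have h01 := hxy _ _ h0
    have h23 := hzt _ _ (he ▸ h0)
    simp only [neg_eq_zero] at h23
    fin_cases i
    exacts [hi h01.1, hi h01.2, hi h23.1, hi h23.2]
  obtain ⟨p, hp⟩ := exists_wedgeVec_eq x y _ _ hne
  obtain ⟨q, hq⟩ := exists_wedgeVec_eq z t _ _ (he ▸ hne)
  rw [← he] at hq
  generalize g 0 • x + g 1 • y = e at hp hq hne
  rw [hp, hq] at hli ⊢
  have h3 : LinearIndependent ℂ ![e, p, q] := by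
    rw [LinearIndependent.pair_iff] at hli
    rw [Fintype.linearIndependent_iff]
    intro c hc
    simp only [Fin.sum_univ_three, Matrix.cons_val] at hc
    have h12 := hli (c 1) (c 2) (by
      have := congrArg (wedgeVec E e) hc
      simpa using this)
    simp only [h12.1, h12.2, zero_smul, add_zero, smul_eq_zero, hne, or_false] at hc
    intro i
    fin_cases i <;> simp [hc, h12]
  obtain ⟨b, hb⟩ := exists_basis_extending hE _ h3 (by norm_num)
  have h0 : b 0 = e := hb 0
  have h1 : b 1 = p := hb 1
  have h2 : b 2 = q := hb 2
  exact ⟨b, by rw [h0, h1], by rw [h0, h2]⟩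

/-- A maximal isotropic subspace of `⋀² E` is a `ρ`-plane or a `σ`-plane. -/
theorem exists_plane_of_isIsotropic (hE : finrank ℂ E = 4) {U : Submodule ℂ (⋀[ℂ]^2 E)}
    (hU : finrank ℂ U = 3) (h : IsIsotropic U) :
    ∃ b : Basis (Fin 4) ℂ E, U = plane rhoPairs b ∨ U = plane sigmaPairs b := by
  have : FiniteDimensional ℂ E := finiteDimensional_of_finrank hE
  have : FiniteDimensional ℂ U := finiteDimensional_of_finrank hU
  let u := finBasisOfFinrankEq ℂ U hU
  have hu : LinearIndependent ℂ (fun i => (u i : ⋀[ℂ]^2 E)) :=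
    u.linearIndependent.map' U.subtype U.ker_subtype
  have hli : LinearIndependent ℂ ![(u 0 : ⋀[ℂ]^2 E), u 1] := by
    have := hu.comp ![0, 1] (by decide)
    convert this using 1
    ext i
    fin_cases i <;> rfl
  obtain ⟨b, h0, h1⟩ := exists_basis_of_isotropic_pair hE hli (h _ (u 0).2 _ (u 0).2)
    (h _ (u 1).2 _ (u 1).2) (h _ (u 0).2 _ (u 1).2)
  obtain ⟨c, hc⟩ := exists_eq_bivector b (u 2)
  have hw := wedgeVec_basis_eq_bivector b
  have hv := vol_ne_zero b
  have c5 : c 5 = 0 := by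
    have := h _ (u 0).2 _ (u 2).2
    rw [h0, hc, hw.1, wedgeForm_bivector] at this
    simpa [hv] using this
  have c4 : c 4 = 0 := by
    have := h _ (u 1).2 _ (u 2).2
    rw [h1, hc, hw.2.1, wedgeForm_bivector] at this
    simpa [hv] using this
  -- Once orthogonality to `b 0 ∧ b 1` and `b 0 ∧ b 2` has killed `c 5` and `c 4`, isotropy of the
  -- third vector reads `2 c 2 c 3 = 0`. Its two solutions are the two families.
  have c23 : c 2 = 0 ∨ c 3 = 0 := by
    have := h _ (u 2).2 _ (u 2).2
    rw [hc, wedgeForm_bivector, smul_eq_zero, or_iff_left hv] at this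
    rw [← mul_eq_zero]
    rw [c4, c5] at this
    linear_combination this / 2
  have hUspan : U = Submodule.span ℂ (Set.range fun i => (u i : ⋀[ℂ]^2 E)) := by
    have := congrArg (Submodule.map U.subtype) u.span_eq
    rw [Submodule.map_span, ← Set.range_comp, Submodule.map_top, Submodule.range_subtype] at this
    exact this.symm
  rcases c23 with c2 | c3
  -- The plane consists of bivectors on `b 0`, `b 1`, `b 2`. The rotation moves these to positions
  -- 1, 2, 3, as `sigmaPairs` requires.
  · refine ⟨b.reindex (finRotate 4), Or.inr ?_⟩
    have r1 : b.reindex (finRotate 4) 1 = b 0 := by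
      rw [Basis.reindex_apply]; rfl
    have r2 : b.reindex (finRotate 4) 2 = b 1 := by
      rw [Basis.reindex_apply]; rfl
    have r3 : b.reindex (finRotate 4) 3 = b 2 := by
      rw [Basis.reindex_apply]; rfl
    refine Submodule.eq_of_le_of_finrank_eq ?_ ?_
    · rw [hUspan, Submodule.span_le, plane_sigmaPairs, r1, r2, r3]
      rintro _ ⟨i, rfl⟩
      simp only [SetLike.mem_coe, Submodule.mem_span_triple]
      fin_cases i
      · exact ⟨1, 0, 0, by simp [h0]⟩
      · exact ⟨0, 1, 0, by simp [h1]⟩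
      · exact ⟨c 0, c 1, c 3, by simp [hc, bivector, c2, c4, c5]⟩
    · rw [hU, finrank_plane (linearIndependent_sigmaPairs _)]
  · refine ⟨b, Or.inl ?_⟩
    refine Submodule.eq_of_le_of_finrank_eq ?_ ?_
    · rw [hUspan, Submodule.span_le, plane_rhoPairs]
      rintro _ ⟨i, rfl⟩
      simp only [SetLike.mem_coe, Submodule.mem_span_triple]
      fin_cases i
      · exact ⟨1, 0, 0, by simp [h0]⟩
      · exact ⟨0, 1, 0, by simp [h1]⟩
      · exact ⟨c 0, c 1, c 2, by simp [hc, bivector, c3, c4, c5]⟩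
    · rw [hU, finrank_plane (linearIndependent_rhoPairs _)]

theorem isIsotropic_rhoPairs (b : Basis (Fin 4) ℂ E) : IsIsotropic (plane rhoPairs b) := by
  intro x hx y hy
  obtain ⟨c, rfl⟩ := exists_eq_bivector b x
  obtain ⟨d, rfl⟩ := exists_eq_bivector b y
  obtain ⟨c3, c4, c5⟩ := (mem_plane_rhoPairs b c).1 hx
  obtain ⟨d3, d4, d5⟩ := (mem_plane_rhoPairs b d).1 hy
  simp [wedgeForm_bivector, *]

theorem isIsotropic_sigmaPairs (b : Basis (Fin 4) ℂ E) : IsIsotropic (plane sigmaPairs b) := by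
  intro x hx y hy
  obtain ⟨c, rfl⟩ := exists_eq_bivector b x
  obtain ⟨d, rfl⟩ := exists_eq_bivector b y
  obtain ⟨c3, c4, c5⟩ := (mem_plane_sigmaPairs b c).1 hx
  obtain ⟨d3, d4, d5⟩ := (mem_plane_sigmaPairs b d).1 hy
  simp [wedgeForm_bivector, *]

/-- If the planes were equal, isotropy would make every `b 0 ∧ t` orthogonal to the products of `b'
1`, `b' 2`, `b' 3`, and this forces `b 0 = 0`. -/
theorem plane_rhoPairs_ne_plane_sigmaPairs (b b' : Basis (Fin 4) ℂ E) :
    plane rhoPairs b ≠ plane sigmaPairs b' := by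
  intro h
  have key : ∀ c : Fin 6 → ℂ, c 0 = 0 → c 1 = 0 → c 2 = 0 → ∀ t,
      wedgeForm E (bivector b' c) (wedgeVec E (b 0) t) = 0 := by
    intro c c0 c1 c2 t
    have hm := (mem_plane_sigmaPairs b' c).2 ⟨c0, c1, c2⟩
    rw [← h] at hm
    refine isIsotropic_rhoPairs b _ hm _ ?_
    rw [plane_rhoPairs, Submodule.mem_span_triple]
    refine ⟨b.repr t 1, b.repr t 2, b.repr t 3, ?_⟩
    conv_rhs => rw [← b.sum_repr t, Fin.sum_univ_four]
    simp
  have hb0 := b'.sum_repr (b 0)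
  have hne := b.ne_zero 0
  rw [← hb0] at key hne
  generalize b'.repr (b 0) = x at key hne
  rw [Fin.sum_univ_four] at key hne
  have hw := wedgeVec_basis_eq_bivector b'
  -- These four tests isolate, up to sign, the coordinates 0, 3, 2, 1 of `b 0` in the basis `b'`.
  have h1 := key ![0, 0, 0, 1, 0, 0] rfl rfl rfl (b' 3)
  have h2 := key ![0, 0, 0, 1, 0, 0] rfl rfl rfl (b' 0)
  have h3 := key ![0, 0, 0, 0, 1, 0] rfl rfl rfl (b' 0)
  have h4 := key ![0, 0, 0, 0, 0, 1] rfl rfl rfl (b' 0)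
  simp only [map_add, LinearMap.add_apply, map_smul, LinearMap.smul_apply,
    wedgeVec_self, wedgeVec_swap (b' 1) (b' 0), wedgeVec_swap (b' 2) (b' 0),
    wedgeVec_swap (b' 3) (b' 0), hw, map_neg] at h1 h2 h3 h4
  simp [wedgeForm_bivector, vol_ne_zero b'] at h1 h2 h3 h4
  apply hne
  simp [*]

end Classification

/-! ### The double spin map on ρ-planes and σ-planes. -/

section SpinDecomposition

variable {E : Type*} [AddCommGroup E] [Module ℂ E]

@[simp]
theorem skewTensor_wedgeVec (x y : E) :
    skewTensor E (wedgeVec E x y) = x ⊗ₜ[ℂ] y - y ⊗ₜ[ℂ] x := by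
  simp [skewTensor, wedgeVec_apply]

@[simp]
theorem contract_wedgeVec (φ : Dual ℂ E) (x y : E) :
    contract E φ (wedgeVec E x y) = φ x • y - φ y • x := by
  simp [contract]

theorem vTrilinear_apply (m : Fin 3 → ⋀[ℂ]^2 E) (φ ψ : Dual ℂ E) :
    vTrilinear E m φ ψ =
      wedgeForm E (m 2) (wedgeVec E (contract E φ (m 0)) (contract E ψ (m 1))) := rfl

theorem wTrilinear_apply (m : Fin 3 → ⋀[ℂ]^2 E) (x x' : E) :
    wTrilinear E m x x' =
      TensorProduct.map ((wedgeForm E (m 0)) ∘ₗ wedgeVec E x) ((wedgeForm E (m 2)) ∘ₗ wedgeVec E x')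
        (skewTensor E (m 1)) := rfl

theorem sum_perm_three {M : Type*} [AddCommMonoid M] (f : Equiv.Perm (Fin 3) → M) :
    ∑ σ, f σ = f 1 + f (Equiv.swap 0 1) + f (Equiv.swap 0 2) + f (Equiv.swap 1 2) +
      f (Equiv.swap 0 1 * Equiv.swap 1 2) + f (Equiv.swap 1 2 * Equiv.swap 0 1) := by
  have : (Finset.univ : Finset (Equiv.Perm (Fin 3))) = {1, Equiv.swap 0 1, Equiv.swap 0 2,
      Equiv.swap 1 2, Equiv.swap 0 1 * Equiv.swap 1 2, Equiv.swap 1 2 * Equiv.swap 0 1} := by decide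
  rw [this]
  repeat rw [Finset.sum_insert (by decide)]
  rw [Finset.sum_singleton]
  abel

theorem alternatization_three {M N : Type*} [AddCommGroup M] [Module ℂ M] [AddCommGroup N]
    [Module ℂ N] (f : MultilinearMap ℂ (fun _ : Fin 3 => M) N) (x y z : M) :
    MultilinearMap.alternatization f ![x, y, z] =
      f ![x, y, z] - f ![y, x, z] - f ![z, y, x] - f ![x, z, y] + f ![y, z, x] + f ![z, x, y] := by
  rw [MultilinearMap.alternatization_apply, sum_perm_three]
  have h (σ : Equiv.Perm (Fin 3)) :
      f.domDomCongr σ ![x, y, z] = f ![![x, y, z] (σ 0), ![x, y, z] (σ 1), ![x, y, z] (σ 2)] := by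
    rw [MultilinearMap.domDomCongr_apply]
    congr 1
    ext i
    fin_cases i <;> rfl
  simp only [h, Equiv.Perm.sign_mul]
  rw [Equiv.Perm.sign_swap (by decide), Equiv.Perm.sign_swap (by decide),
    Equiv.Perm.sign_swap (by decide)]
  have e1 : (Equiv.swap (0 : Fin 3) 1) 2 = 2 := by decide
  have e2 : (Equiv.swap (0 : Fin 3) 2) 1 = 1 := by decide
  have e3 : (Equiv.swap (1 : Fin 3) 2) 0 = 0 := by decide
  simp [e1, e2, e3]
  abel

theorem alternatization_three_apply {M A N : Type*} [AddCommGroup M] [Module ℂ M] [AddCommGroup N]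
    [Module ℂ N] [AddCommGroup A] [Module ℂ A]
    (f : MultilinearMap ℂ (fun _ : Fin 3 => M) (A →ₗ[ℂ] A →ₗ[ℂ] N)) (x y z : M) (u v : A) :
    MultilinearMap.alternatization (N' := A →ₗ[ℂ] A →ₗ[ℂ] N) f ![x, y, z] u v =
      f ![x, y, z] u v - f ![y, x, z] u v - f ![z, y, x] u v - f ![x, z, y] u v +
        f ![y, z, x] u v + f ![z, x, y] u v := by
  rw [alternatization_three]
  rfl

theorem spinDecomposition_fst (x y z : ⋀[ℂ]^2 E) (φ ψ : Dual ℂ E) :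
    ((spinDecomposition E (exteriorPower.ιMulti ℂ 3 ![x, y, z])).1 :
        Dual ℂ E →ₗ[ℂ] Dual ℂ E →ₗ[ℂ] ⋀[ℂ]^4 E) φ ψ =
      MultilinearMap.alternatization (N' := Dual ℂ E →ₗ[ℂ] Dual ℂ E →ₗ[ℂ] ⋀[ℂ]^4 E)
        (vTrilinear E) ![x, y, z] φ ψ +
      MultilinearMap.alternatization (N' := Dual ℂ E →ₗ[ℂ] Dual ℂ E →ₗ[ℂ] ⋀[ℂ]^4 E)
        (vTrilinear E) ![x, y, z] ψ φ := by
  simp [spinDecomposition, symmetrize]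

theorem spinDecomposition_snd (x y z : ⋀[ℂ]^2 E) (u v : E) :
    ((spinDecomposition E (exteriorPower.ιMulti ℂ 3 ![x, y, z])).2 :
        E →ₗ[ℂ] E →ₗ[ℂ] (⋀[ℂ]^4 E ⊗[ℂ] ⋀[ℂ]^4 E)) u v =
      MultilinearMap.alternatization (N' := E →ₗ[ℂ] E →ₗ[ℂ] (⋀[ℂ]^4 E ⊗[ℂ] ⋀[ℂ]^4 E))
        (wTrilinear E) ![x, y, z] u v +
      MultilinearMap.alternatization (N' := E →ₗ[ℂ] E →ₗ[ℂ] (⋀[ℂ]^4 E ⊗[ℂ] ⋀[ℂ]^4 E))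
        (wTrilinear E) ![x, y, z] v u := by
  simp [spinDecomposition, symmetrize]

/-- This annihilates the second spin component of a ρ-plane: each term there has a tensor factor in
which `b 0` occurs twice. -/
theorem wedgeForm_wedgeVec_of_eq (x y z : E) :
    wedgeForm E (wedgeVec E x y) (wedgeVec E z x) = 0 := by
  rw [wedgeForm_wedgeVec]
  exact AlternatingMap.map_eq_zero_of_eq _ ![x, y, z, x] (i := 0) (j := 3) rfl (by decide)

theorem wedgeForm_basis_apply (b : Basis (Fin 4) ℂ E) (i j k : Fin 4) (x : E) :
    wedgeForm E (wedgeVec E (b i) (b j)) (wedgeVec E x (b k)) =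
      (∑ n, b.repr x n * signFour i j n k) • vol b := by
  conv_lhs => rw [← b.sum_repr x]
  simp only [map_sum, LinearMap.sum_apply, map_smul, LinearMap.smul_apply, wedgeForm_basis,
    Finset.sum_smul, mul_smul]

/-- In `φ ⌟ (b 0 ∧ b i)` only the part `φ(b 0) b i` survives multiplication by `b 0 ∧ b k`. The six
permutations contribute the same signed term, and symmetrization doubles the sum, whence 12. -/
theorem spinDecomposition_rhoPairs (b : Basis (Fin 4) ℂ E) :
    spinDecomposition E (exteriorPower.ιMulti ℂ 3
      ![wedgeVec E (b 0) (b 1), wedgeVec E (b 0) (b 2), wedgeVec E (b 0) (b 3)]) =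
    (squareForm (Dual.eval ℂ E (b 0)) ((12 : ℂ) • vol b), 0) := by
  refine Prod.ext (Subtype.ext ?_) (Subtype.ext ?_)
  · refine LinearMap.ext fun φ => LinearMap.ext fun ψ => ?_
    rw [spinDecomposition_fst, alternatization_three]
    simp only [LinearMap.sub_apply, LinearMap.add_apply, vTrilinear_apply, Matrix.cons_val,
      contract_wedgeVec, map_sub, map_smul, LinearMap.smul_apply, wedgeForm_basis, signFour,
      wedgeVec_self]
    simp [squareForm]
    module
  · refine LinearMap.ext fun x => LinearMap.ext fun y => ?_
    rw [spinDecomposition_snd, alternatization_three]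
    simp only [LinearMap.sub_apply, LinearMap.add_apply, wTrilinear_apply, Matrix.cons_val,
      skewTensor_wedgeVec, map_sub, TensorProduct.map_tmul, LinearMap.comp_apply,
      wedgeForm_wedgeVec_of_eq]
    simp

theorem wTrilinear_basis (b : Basis (Fin 4) ℂ E) (i j k l m n : Fin 4) (u v : E) :
    wTrilinear E ![wedgeVec E (b i) (b j), wedgeVec E (b k) (b l), wedgeVec E (b m) (b n)] u v =
      ((∑ p, b.repr u p * signFour i j p k) * (∑ p, b.repr v p * signFour m n p l) -
        (∑ p, b.repr u p * signFour i j p l) * (∑ p, b.repr v p * signFour m n p k)) •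
          (vol b ⊗ₜ[ℂ] vol b) := by
  rw [wTrilinear_apply]
  change TensorProduct.map (wedgeForm E (wedgeVec E (b i) (b j)) ∘ₗ wedgeVec E u)
    (wedgeForm E (wedgeVec E (b m) (b n)) ∘ₗ wedgeVec E v)
    (skewTensor E (wedgeVec E (b k) (b l))) = _
  rw [skewTensor_wedgeVec, LinearMap.map_sub, TensorProduct.map_tmul, TensorProduct.map_tmul]
  simp only [LinearMap.comp_apply]
  rw [wedgeForm_basis_apply, wedgeForm_basis_apply, wedgeForm_basis_apply, wedgeForm_basis_apply,
    TensorProduct.smul_tmul_smul, TensorProduct.smul_tmul_smul, sub_smul]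

/-- The first component is a product of four vectors in the span of `b 1`, `b 2`, `b 3`, hence zero.
In the second component only the coordinate on `b 0` of each argument survives; six permutations and
the symmetrization contribute `-1` each time, whence `-12`. -/
theorem spinDecomposition_sigmaPairs (b : Basis (Fin 4) ℂ E) :
    spinDecomposition E (exteriorPower.ιMulti ℂ 3
      ![wedgeVec E (b 1) (b 2), wedgeVec E (b 1) (b 3), wedgeVec E (b 2) (b 3)]) =
    (0, squareForm (b.coord 0) ((-12 : ℂ) • (vol b ⊗ₜ[ℂ] vol b))) := by
  refine Prod.ext (Subtype.ext ?_) (Subtype.ext ?_)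
  · refine LinearMap.ext fun φ => LinearMap.ext fun ψ => ?_
    rw [spinDecomposition_fst, alternatization_three]
    simp only [LinearMap.sub_apply, LinearMap.add_apply, vTrilinear_apply, Matrix.cons_val,
      contract_wedgeVec, map_sub, map_smul, LinearMap.smul_apply, wedgeForm_basis, signFour,
      wedgeVec_self]
    simp
  · refine LinearMap.ext fun x => LinearMap.ext fun y => ?_
    rw [spinDecomposition_snd, alternatization_three_apply, alternatization_three_apply]
    change _ = (b.repr x 0 * b.repr y 0) • ((-12 : ℂ) • (vol b ⊗ₜ[ℂ] vol b))
    simp only [wTrilinear_basis b]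
    generalize vol b ⊗ₜ[ℂ] vol b = w
    simp only [← sub_smul, ← add_smul, smul_smul]
    congr 1
    simp only [Fin.sum_univ_four, signFour]
    norm_num
    ring

end SpinDecomposition

/-! ### Symmetric forms: generation by squares and dimension. -/

section SymForms

variable {A M : Type*} [AddCommGroup A] [Module ℂ A] [AddCommGroup M] [Module ℂ M]

theorem squareForm_apply (l : Dual ℂ A) (m : M) (x y : A) :
    (squareForm l m : A →ₗ[ℂ] A →ₗ[ℂ] M) x y = (l x * l y) • m := rfl

theorem squareForm_smul_left (c : ℂ) (l : Dual ℂ A) (m : M) :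
    squareForm (c • l) m = (c * c) • squareForm l m := by
  ext x y
  simp only [Submodule.coe_smul, LinearMap.smul_apply, squareForm_apply, smul_eq_mul, smul_smul]
  congr 1
  ring

theorem squareForm_smul_right (c : ℂ) (l : Dual ℂ A) (m : M) :
    squareForm l (c • m) = c • squareForm l m := by
  ext x y
  simp only [Submodule.coe_smul, LinearMap.smul_apply, squareForm_apply, smul_smul]
  congr 1
  ring

/-- Symmetric forms are sums of squares of linear forms, times vectors. -/
theorem eq_top_of_squareForm_mem {n : ℕ} (a : Basis (Fin n) ℂ A) (S : Submodule ℂ (SymForms A M))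
    (h : ∀ l m, squareForm l m ∈ S) : S = ⊤ := by
  rw [eq_top_iff]
  rintro B -
  -- Polarization: `(l + l')² - l² - l'²` is the symmetrized product of `l` and `l'`.
  have key : (2 : ℂ) • B = ∑ i, ∑ j, (squareForm (a.coord i + a.coord j) (B.1 (a i) (a j)) -
      squareForm (a.coord i) (B.1 (a i) (a j)) - squareForm (a.coord j) (B.1 (a i) (a j))) := by
    refine Subtype.ext (LinearMap.ext fun x => LinearMap.ext fun y => ?_)
    have hB : B.1 x y = ∑ i, ∑ j, (a.coord i x * a.coord j y) • B.1 (a i) (a j) := by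
      rw [Finset.sum_comm]
      conv_lhs => rw [← a.sum_repr x, ← a.sum_repr y]
      simp only [map_sum, map_smul, LinearMap.sum_apply, LinearMap.smul_apply, mul_smul,
        Finset.smul_sum, Basis.coord_apply]
      exact Finset.sum_congr rfl fun i _ => Finset.sum_congr rfl fun j _ => smul_comm _ _ _
    have hB' : B.1 x y = ∑ i, ∑ j, (a.coord j x * a.coord i y) • B.1 (a i) (a j) := by
      rw [hB, Finset.sum_comm]
      refine Finset.sum_congr rfl fun i _ => Finset.sum_congr rfl fun j _ => ?_
      rw [B.2 (a j) (a i)]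
    have h2 : ((2 : ℂ) • B : SymForms A M).1 x y = B.1 x y + B.1 x y := by
      simp [two_smul]
    rw [h2]
    nth_rewrite 1 [hB]
    rw [hB', ← Finset.sum_add_distrib]
    simp only [AddSubmonoidClass.coe_finsetSum, LinearMap.sum_apply]
    refine Finset.sum_congr rfl fun i _ => ?_
    rw [← Finset.sum_add_distrib]
    refine Finset.sum_congr rfl fun j _ => ?_
    simp only [Submodule.coe_sub, LinearMap.sub_apply, squareForm_apply, LinearMap.add_apply]
    module
  have : B = (2 : ℂ)⁻¹ • (2 : ℂ) • B := by
    rw [smul_smul, inv_mul_cancel₀ two_ne_zero, one_smul]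
  rw [this, key]
  exact S.smul_mem _ (S.sum_mem fun i _ => S.sum_mem fun j _ =>
    S.sub_mem (S.sub_mem (h _ _) (h _ _)) (h _ _))

/-- The space of symmetric forms on a space of dimension four has dimension at least ten. -/
theorem ten_le_finrank_symForms (a : Basis (Fin 4) ℂ A) (hM : finrank ℂ M = 1) :
    10 ≤ finrank ℂ (SymForms A M) := by
  have : FiniteDimensional ℂ M := finiteDimensional_of_finrank hM
  have : FiniteDimensional ℂ A := Module.Finite.of_basis a
  -- The symmetric forms are the kernel of `D` on a space of dimension 16. The image of `D` consists
  -- of skew forms, which are determined by their six values with `i < j`, so its dimension is at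
  -- most 6.
  let D : (A →ₗ[ℂ] A →ₗ[ℂ] M) →ₗ[ℂ] (A →ₗ[ℂ] A →ₗ[ℂ] M) :=
    { toFun := fun B => B - B.flip
      map_add' := fun B C => by
        refine LinearMap.ext fun x => LinearMap.ext fun y => ?_
        simp only [LinearMap.sub_apply, LinearMap.add_apply, LinearMap.flip_apply]
        abel
      map_smul' := fun c B => by
        refine LinearMap.ext fun x => LinearMap.ext fun y => ?_
        simp [smul_sub] }
  have hker : LinearMap.ker D = SymForms A M := by
    ext B
    rw [LinearMap.mem_ker]
    constructor
    · intro h x y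
      have := LinearMap.congr_fun (LinearMap.congr_fun h x) y
      exact sub_eq_zero.1 this
    · intro h
      refine LinearMap.ext fun x => LinearMap.ext fun y => ?_
      exact sub_eq_zero.2 (h x y)
  let T : (A →ₗ[ℂ] A →ₗ[ℂ] M) →ₗ[ℂ] ({p : Fin 4 × Fin 4 // p.1 < p.2} → M) :=
    { toFun := fun B p => B (a p.1.1) (a p.1.2)
      map_add' := fun B C => rfl
      map_smul' := fun c B => rfl }
  have hT : Function.Injective (T ∘ₗ (LinearMap.range D).subtype) := by
    rw [← LinearMap.ker_eq_bot, LinearMap.ker_eq_bot']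
    rintro ⟨_, B, rfl⟩ h
    have h' : ∀ i j, i < j → B (a i) (a j) - B (a j) (a i) = 0 :=
      fun i j hij => congrFun h ⟨(i, j), hij⟩
    refine Subtype.ext (a.ext fun i => a.ext fun j => ?_)
    change B (a i) (a j) - B (a j) (a i) = 0
    rcases lt_trichotomy i j with hij | rfl | hij
    · exact h' i j hij
    · exact sub_self _
    · rw [← neg_sub, h' j i hij, neg_zero]
  have h6 := LinearMap.finrank_le_finrank_of_injective hT
  have hc : Fintype.card {p : Fin 4 × Fin 4 // p.1 < p.2} = 6 := by decide
  rw [Module.finrank_pi_fintype, Finset.sum_const, hM, Finset.card_univ, hc] at h6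
  have h16 := LinearMap.finrank_range_add_finrank_ker D
  rw [hker, Module.finrank_linearMap, Module.finrank_linearMap, hM,
    Module.finrank_eq_card_basis a, Fintype.card_fin] at h16
  simp at h6
  omega

/-- Since `e` and `μ` both span lines, changing the representatives only rescales the square. The
free factor `k` absorbs the constants of the spin computation. -/
theorem span_squareForm_fst {A' N : Type*} [AddCommGroup A'] [Module ℂ A'] [AddCommMonoid N]
    [Module ℂ N] (f : A' →ₗ[ℂ] Dual ℂ A) (e : A') {μ : M} (hμ : ∀ m, ∃ c : ℂ, m = c • μ) {k : ℂ}
    (hk : k ≠ 0) :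
    Submodule.span ℂ {s : SymForms A M × N | ∃ x ∈ Submodule.span ℂ {e}, ∃ m,
      s = (squareForm (f x) m, 0)} = Submodule.span ℂ {(squareForm (f e) (k • μ), 0)} := by
  apply le_antisymm
  · rw [Submodule.span_le]
    rintro _ ⟨x, hx, m, rfl⟩
    obtain ⟨c, rfl⟩ := Submodule.mem_span_singleton.1 hx
    obtain ⟨d, rfl⟩ := hμ m
    refine Submodule.mem_span_singleton.2 ⟨(c * c) * (k⁻¹ * d), ?_⟩
    rw [map_smul, squareForm_smul_left, Prod.smul_mk, smul_zero, ← squareForm_smul_right,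
      ← squareForm_smul_right, smul_smul, smul_smul]
    have hck : c * c * (k⁻¹ * d) * k = c * c * d := by
      field_simp
    rw [hck]
  · rw [Submodule.span_singleton_le_iff_mem]
    exact Submodule.subset_span ⟨e, Submodule.mem_span_singleton_self _, _, rfl⟩

theorem span_squareForm_snd {A' N : Type*} [AddCommGroup A'] [Module ℂ A'] [AddCommMonoid N]
    [Module ℂ N] (f : A' →ₗ[ℂ] Dual ℂ A) (e : A') {μ : M} (hμ : ∀ m, ∃ c : ℂ, m = c • μ) {k : ℂ}
    (hk : k ≠ 0) :
    Submodule.span ℂ {s : N × SymForms A M | ∃ x ∈ Submodule.span ℂ {e}, ∃ m,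
      s = (0, squareForm (f x) m)} = Submodule.span ℂ {(0, squareForm (f e) (k • μ))} := by
  apply le_antisymm
  · rw [Submodule.span_le]
    rintro _ ⟨x, hx, m, rfl⟩
    obtain ⟨c, rfl⟩ := Submodule.mem_span_singleton.1 hx
    obtain ⟨d, rfl⟩ := hμ m
    refine Submodule.mem_span_singleton.2 ⟨(c * c) * (k⁻¹ * d), ?_⟩
    rw [map_smul, squareForm_smul_left, Prod.smul_mk, smul_zero, ← squareForm_smul_right,
      ← squareForm_smul_right, smul_smul, smul_smul]
    have hck : c * c * (k⁻¹ * d) * k = c * c * d := by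
      field_simp
    rw [hck]
  · rw [Submodule.span_singleton_le_iff_mem]
    exact Submodule.subset_span ⟨e, Submodule.mem_span_singleton_self _, _, rfl⟩

theorem squareForm_mem_fst {N : Type*} [AddCommMonoid N] [Module ℂ N]
    (R : Submodule ℂ (SymForms A M × N)) (l : Dual ℂ A) {μ : M} (hμ : ∀ m, ∃ c : ℂ, m = c • μ)
    {k : ℂ} (hk : k ≠ 0) (h : (squareForm l (k • μ), 0) ∈ R) (m : M) : (squareForm l m, 0) ∈ R := by
  have hle := (span_squareForm_fst (N := N) LinearMap.id l hμ hk).le.trans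
    ((Submodule.span_singleton_le_iff_mem _ _).2 h)
  exact hle (Submodule.subset_span ⟨l, Submodule.mem_span_singleton_self _, m, rfl⟩)

theorem squareForm_mem_snd {N : Type*} [AddCommMonoid N] [Module ℂ N]
    (R : Submodule ℂ (N × SymForms A M)) (l : Dual ℂ A) {μ : M} (hμ : ∀ m, ∃ c : ℂ, m = c • μ)
    {k : ℂ} (hk : k ≠ 0) (h : (0, squareForm l (k • μ)) ∈ R) (m : M) : (0, squareForm l m) ∈ R := by
  have hle := (span_squareForm_snd (N := N) LinearMap.id l hμ hk).le.trans
    ((Submodule.span_singleton_le_iff_mem _ _).2 h)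
  exact hle (Submodule.subset_span ⟨l, Submodule.mem_span_singleton_self _, m, rfl⟩)

theorem squareForm_zero_left (m : M) : squareForm (0 : Dual ℂ A) m = 0 := by
  simpa using squareForm_smul_left 0 (0 : Dual ℂ A) m

theorem finrank_symForms_prod {A' M' : Type*} [AddCommGroup A'] [Module ℂ A'] [AddCommGroup M']
    [Module ℂ M'] [FiniteDimensional ℂ A] [FiniteDimensional ℂ M] [FiniteDimensional ℂ A']
    [FiniteDimensional ℂ M'] : finrank ℂ (SymForms A M × SymForms A' M') =
      finrank ℂ (SymForms A M) + finrank ℂ (SymForms A' M') :=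
  Module.finrank_prod

theorem prod_eq_top_of_comap {X Y : Type*} [AddCommMonoid X] [Module ℂ X]
    [AddCommMonoid Y] [Module ℂ Y] {R : Submodule ℂ (X × Y)} (h₁ : R.comap (LinearMap.inl ℂ X Y) = ⊤)
    (h₂ : R.comap (LinearMap.inr ℂ X Y) = ⊤) : R = ⊤ := by
  rw [eq_top_iff]
  rintro ⟨x, y⟩ -
  have hx : x ∈ R.comap (LinearMap.inl ℂ X Y) := by
    rw [h₁]; trivial
  have hy : y ∈ R.comap (LinearMap.inr ℂ X Y) := by
    rw [h₂]; trivial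
  rw [Submodule.mem_comap] at hx hy
  simpa using R.add_mem hx hy

theorem bijective_of_range_eq_top {X A' M' : Type*} [AddCommGroup X] [Module ℂ X] [AddCommGroup A']
    [Module ℂ A'] [AddCommGroup M'] [Module ℂ M'] [FiniteDimensional ℂ X]
    (f : X →ₗ[ℂ] SymForms A M × SymForms A' M') (hf : LinearMap.range f = ⊤)
    (h : finrank ℂ X ≤ finrank ℂ (SymForms A M × SymForms A' M')) : Function.Bijective f := by
  have hrank := LinearMap.finrank_range_add_finrank_ker f
  rw [hf, finrank_top] at hrank
  refine ⟨LinearMap.ker_eq_bot.1 (Submodule.finrank_eq_zero.1 ?_), LinearMap.range_eq_top.1 hf⟩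
  omega

end SymForms

/-! ### The double spin decomposition is an isomorphism; images of Plücker lines. -/

section SpinIso

variable {E : Type*} [AddCommGroup E] [Module ℂ E]

theorem eq_smul_vol_tmul_vol (b : Basis (Fin 4) ℂ E) (m : ⋀[ℂ]^4 E ⊗[ℂ] ⋀[ℂ]^4 E) :
    ∃ c : ℂ, m = c • (vol b ⊗ₜ[ℂ] vol b) := by
  induction m using TensorProduct.induction_on with
  | zero => exact ⟨0, by simp⟩
  | tmul x y =>
    refine ⟨volCoord b x * volCoord b y, ?_⟩
    conv_lhs => rw [eq_smul_vol b x, eq_smul_vol b y]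
    rw [TensorProduct.smul_tmul_smul]
  | add x y hx hy =>
    obtain ⟨c, rfl⟩ := hx
    obtain ⟨d, rfl⟩ := hy
    exact ⟨c + d, by rw [add_smul]⟩

theorem exists_basis_zero_eq (hE : finrank ℂ E = 4) {e : E} (he : e ≠ 0) :
    ∃ b : Basis (Fin 4) ℂ E, b 0 = e := by
  have : FiniteDimensional ℂ E := finiteDimensional_of_finrank hE
  obtain ⟨b, hb⟩ := exists_basis_extending hE ![e]
    (LinearIndependent.of_subsingleton 0 he) (by norm_num)
  exact ⟨b, hb 0⟩

/-- Extend `l` to a basis of `E*` and carry the dual basis of that basis back to `E` by biduality.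
-/
theorem exists_basis_coord_zero_eq (hE : finrank ℂ E = 4) {l : Dual ℂ E} (hl : l ≠ 0) :
    ∃ b : Basis (Fin 4) ℂ E, b.coord 0 = l := by
  have : FiniteDimensional ℂ E := finiteDimensional_of_finrank hE
  obtain ⟨d, rfl⟩ := exists_basis_zero_eq (by rwa [Subspace.dual_finrank_eq]) hl
  refine ⟨d.dualBasis.map (evalEquiv ℂ E).symm, ?_⟩
  refine (d.dualBasis.map (evalEquiv ℂ E).symm).ext fun i => ?_
  rw [Basis.coord_apply, Basis.repr_self, Basis.map_apply, apply_evalEquiv_symm_apply,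
    Basis.dualBasis_apply_self, Finsupp.single_apply]
  simp only [eq_comm]

theorem span_squareForm_eval (b : Basis (Fin 4) ℂ E) :
    (Submodule.span ℂ {s : SpinSpace E | ∃ e ∈ Submodule.span ℂ {b 0}, ∃ m : ⋀[ℂ]^4 E,
      s = (squareForm (Dual.eval ℂ E e) m, 0)}) =
      Submodule.span ℂ {(squareForm (Dual.eval ℂ E (b 0)) ((12 : ℂ) • vol b), 0)} :=
  span_squareForm_fst (Dual.eval ℂ E) (b 0) (fun m => ⟨_, eq_smul_vol b m⟩) (by norm_num)

theorem span_squareForm_coord (b : Basis (Fin 4) ℂ E) :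
    (Submodule.span ℂ {s : SpinSpace E | ∃ l ∈ Submodule.span ℂ {b.coord 0},
      ∃ m : ⋀[ℂ]^4 E ⊗[ℂ] ⋀[ℂ]^4 E, s = (0, squareForm l m)}) =
      Submodule.span ℂ {(0, squareForm (b.coord 0) ((-12 : ℂ) • (vol b ⊗ₜ[ℂ] vol b)))} :=
  span_squareForm_snd LinearMap.id (b.coord 0) (eq_smul_vol_tmul_vol b) (by norm_num)

set_option maxHeartbeats 400000 in
-- By biduality `l` is the evaluation at some `e`. If `e ≠ 0`, it starts a basis, and the
-- corresponding ρ-plane maps to a nonzero multiple of `e²`.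
theorem squareForm_mem_range_left (hE : finrank ℂ E = 4) (l : Dual ℂ (Dual ℂ E)) (m : ⋀[ℂ]^4 E) :
    ((squareForm l m, 0) : SpinSpace E) ∈ LinearMap.range (spinDecomposition E) := by
  have : FiniteDimensional ℂ E := finiteDimensional_of_finrank hE
  obtain ⟨e, rfl⟩ : ∃ e, Dual.eval ℂ E e = l := (evalEquiv ℂ E).surjective l
  by_cases he : e = 0
  · rw [he, map_zero, squareForm_zero_left]
    exact Submodule.zero_mem _
  obtain ⟨b, rfl⟩ := exists_basis_zero_eq hE he
  exact squareForm_mem_fst _ _ (fun m => ⟨_, eq_smul_vol b m⟩) (by norm_num : (12 : ℂ) ≠ 0)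
    (LinearMap.mem_range.2 ⟨_, spinDecomposition_rhoPairs b⟩) m

theorem squareForm_mem_range_right (hE : finrank ℂ E = 4) (l : Dual ℂ E)
    (m : ⋀[ℂ]^4 E ⊗[ℂ] ⋀[ℂ]^4 E) :
    ((0, squareForm l m) : SpinSpace E) ∈ LinearMap.range (spinDecomposition E) := by
  by_cases hl : l = 0
  · rw [hl, squareForm_zero_left]
    exact Submodule.zero_mem _
  obtain ⟨b, rfl⟩ := exists_basis_coord_zero_eq hE hl
  exact squareForm_mem_snd _ _ (eq_smul_vol_tmul_vol b) (by norm_num : (-12 : ℂ) ≠ 0)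
    (LinearMap.mem_range.2 ⟨_, spinDecomposition_sigmaPairs b⟩) m

theorem finrank_exteriorPower_four (hE : finrank ℂ E = 4) : finrank ℂ (⋀[ℂ]^4 E) = 1 := by
  have : FiniteDimensional ℂ E := finiteDimensional_of_finrank hE
  rw [exteriorPower.finrank_eq, hE]
  rfl

/-- Squares span each summand, which gives surjectivity. The source has dimension `C(6, 3) = 20`, so
the lower bound 10 for each summand already implies injectivity. -/
theorem bijective_spinDecomposition (hE : finrank ℂ E = 4) :
    Function.Bijective (spinDecomposition E) := by
  have : FiniteDimensional ℂ E := finiteDimensional_of_finrank hE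
  let b := finBasisOfFinrankEq ℂ E hE
  have hsurj : LinearMap.range (spinDecomposition E) = ⊤ :=
    prod_eq_top_of_comap (eq_top_of_squareForm_mem b.dualBasis _ (squareForm_mem_range_left hE))
      (eq_top_of_squareForm_mem b _ (squareForm_mem_range_right hE))
  have h4 := finrank_exteriorPower_four hE
  have hl : 10 ≤ finrank ℂ (SymForms (Dual ℂ E) (⋀[ℂ]^4 E)) :=
    ten_le_finrank_symForms b.dualBasis h4
  have hr : 10 ≤ finrank ℂ (SymForms E (⋀[ℂ]^4 E ⊗[ℂ] ⋀[ℂ]^4 E)) :=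
    ten_le_finrank_symForms b (by rw [Module.finrank_tensorProduct, h4])
  have h20 : finrank ℂ (⋀[ℂ]^3 (⋀[ℂ]^2 E)) = 20 := by
    rw [exteriorPower.finrank_eq, exteriorPower.finrank_eq, hE]
    rfl
  refine bijective_of_range_eq_top (X := ⋀[ℂ]^3 (⋀[ℂ]^2 E)) _ hsurj ?_
  rw [h20, finrank_symForms_prod]
  omega

theorem pluckerLine_span {W : Type*} [AddCommGroup W] [Module ℂ W] {u : Fin 3 → W}
    (hu : LinearIndependent ℂ u) :
    pluckerLine (Submodule.span ℂ (Set.range u)) =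
      Submodule.span ℂ {exteriorPower.ιMulti ℂ 3 u} := by
  let b := Basis.span hu
  have hb : exteriorPower.map 3 (Submodule.span ℂ (Set.range u)).subtype
      (exteriorPower.ιMulti ℂ 3 b) = exteriorPower.ιMulti ℂ 3 u := by
    rw [exteriorPower.map_apply_ιMulti]
    congr 1
    ext i
    simp [b, Basis.span_apply]
  apply le_antisymm
  · rintro _ ⟨m, rfl⟩
    rw [eq_smul_ιMulti_basis b m, map_smul, hb]
    exact Submodule.smul_mem _ _ (Submodule.mem_span_singleton_self _)
  · rw [Submodule.span_singleton_le_iff_mem, ← hb]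
    exact ⟨_, rfl⟩

theorem map_span_singleton_eq {X Y : Type*} [AddCommMonoid X] [Module ℂ X] [AddCommMonoid Y]
    [Module ℂ Y] (f : X →ₗ[ℂ] Y) {x : X} {y : Y} (h : f x = y) :
    (Submodule.span ℂ {x}).map f = Submodule.span ℂ {y} := by
  rw [Submodule.map_span, Set.image_singleton, h]

theorem map_pluckerLine_rhoPairs (b : Basis (Fin 4) ℂ E) :
    (pluckerLine (plane rhoPairs b)).map (spinDecomposition E) =
      Submodule.span ℂ {(squareForm (Dual.eval ℂ E (b 0)) ((12 : ℂ) • vol b), 0)} := by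
  have h : (fun k => wedgeVec E (b (rhoPairs k).1) (b (rhoPairs k).2)) =
      ![wedgeVec E (b 0) (b 1), wedgeVec E (b 0) (b 2), wedgeVec E (b 0) (b 3)] := by
    ext i
    fin_cases i <;> rfl
  have h' : pluckerLine (plane rhoPairs b) = Submodule.span ℂ {exteriorPower.ιMulti ℂ 3
      ![wedgeVec E (b 0) (b 1), wedgeVec E (b 0) (b 2), wedgeVec E (b 0) (b 3)]} := by
    rw [plane, pluckerLine_span (linearIndependent_rhoPairs b), h]
  exact (congrArg (Submodule.map _) h').trans
    (map_span_singleton_eq _ (spinDecomposition_rhoPairs b))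

theorem map_pluckerLine_sigmaPairs (b : Basis (Fin 4) ℂ E) :
    (pluckerLine (plane sigmaPairs b)).map (spinDecomposition E) =
      Submodule.span ℂ {(0, squareForm (b.coord 0) ((-12 : ℂ) • (vol b ⊗ₜ[ℂ] vol b)))} := by
  have h : (fun k => wedgeVec E (b (sigmaPairs k).1) (b (sigmaPairs k).2)) =
      ![wedgeVec E (b 1) (b 2), wedgeVec E (b 1) (b 3), wedgeVec E (b 2) (b 3)] := by
    ext i
    fin_cases i <;> rfl
  have h' : pluckerLine (plane sigmaPairs b) = Submodule.span ℂ {exteriorPower.ιMulti ℂ 3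
      ![wedgeVec E (b 1) (b 2), wedgeVec E (b 1) (b 3), wedgeVec E (b 2) (b 3)]} := by
    rw [plane, pluckerLine_span (linearIndependent_sigmaPairs b), h]
  exact (congrArg (Submodule.map _) h').trans
    (map_span_singleton_eq _ (spinDecomposition_sigmaPairs b))

end SpinIso

/-! ### The isotropy condition on `⋀² E` and on `⋀² E*`. -/

section DualForm

variable {E : Type*} [AddCommGroup E] [Module ℂ E]

theorem pairingDual_wedgeVec (φ ψ : Dual ℂ E) (x y : E) :
    exteriorPower.pairingDual ℂ E 2 (wedgeVec (Dual ℂ E) φ ψ) (wedgeVec E x y) =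
      φ x * ψ y - φ y * ψ x := by
  rw [wedgeVec_apply, wedgeVec_apply, exteriorPower.pairingDual_ιMulti_ιMulti, Matrix.det_fin_two]
  simp
  try ring

theorem pairingDual_bivector (b : Basis (Fin 4) ℂ E) (n c : Fin 6 → ℂ) :
    exteriorPower.pairingDual ℂ E 2 (bivector b.dualBasis n) (bivector b c) =
      n 0 * c 0 + n 1 * c 1 + n 2 * c 2 + n 3 * c 3 + n 4 * c 4 + n 5 * c 5 := by
  simp only [bivector, map_add, map_smul, LinearMap.add_apply, LinearMap.smul_apply,
    pairingDual_wedgeVec, Basis.dualBasis_apply_self, smul_eq_mul]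
  simp
  ring

/-- The coordinates of the bivector on `E*` which corresponds to a bivector on `E`. -/
def starCoords (t : ℂ) (c : Fin 6 → ℂ) : Fin 6 → ℂ :=
  ![t * c 5, -t * c 4, t * c 3, t * c 2, -t * c 1, t * c 0]

theorem pairingDual_starCoords (b : Basis (Fin 4) ℂ E) (θ : Dual ℂ (⋀[ℂ]^4 E)) (c : Fin 6 → ℂ) :
    exteriorPower.pairingDual ℂ E 2 (bivector b.dualBasis (starCoords (θ (vol b)) c)) =
      θ ∘ₗ wedgeForm E (bivector b c) := by
  refine LinearMap.ext fun a => ?_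
  obtain ⟨d, rfl⟩ := exists_eq_bivector b a
  rw [pairingDual_bivector, LinearMap.comp_apply, wedgeForm_bivector, map_smul]
  simp [starCoords]
  ring

theorem eq_bivector_starCoords (b : Basis (Fin 4) ℂ E) (θ : Dual ℂ (⋀[ℂ]^4 E)) (c : Fin 6 → ℂ)
    {η : ⋀[ℂ]^2 (Dual ℂ E)}
    (h : exteriorPower.pairingDual ℂ E 2 η = θ ∘ₗ wedgeForm E (bivector b c)) :
    η = bivector b.dualBasis (starCoords (θ (vol b)) c) := by
  obtain ⟨n, rfl⟩ := exists_eq_bivector b.dualBasis η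
  rw [← pairingDual_starCoords] at h
  congr 1
  have key := fun d => LinearMap.congr_fun h (bivector b d)
  simp only [pairingDual_bivector] at key
  have h0 := key ![0, 0, 0, 0, 0, 1]
  have h1 := key ![0, 0, 0, 0, 1, 0]
  have h2 := key ![0, 0, 0, 1, 0, 0]
  have h3 := key ![0, 0, 1, 0, 0, 0]
  have h4 := key ![0, 1, 0, 0, 0, 0]
  have h5 := key ![1, 0, 0, 0, 0, 0]
  simp at h0 h1 h2 h3 h4 h5
  ext i
  fin_cases i <;> simpa

/-- In coordinates the star operation exchanges complementary index pairs with a sign, and so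
preserves the wedge form up to scalars. Choosing `θ = volCoord b` makes these scalars equal to one.
-/
theorem isIsotropic_dualSubspace_iff (hE : finrank ℂ E = 4) (U : Submodule ℂ (⋀[ℂ]^2 E)) :
    IsIsotropic (dualSubspace U) ↔ IsIsotropic U := by
  have : FiniteDimensional ℂ E := finiteDimensional_of_finrank hE
  let b := finBasisOfFinrankEq ℂ E hE
  have key (c d : Fin 6 → ℂ) (s t : ℂ) : wedgeForm (Dual ℂ E)
      (bivector b.dualBasis (starCoords s c)) (bivector b.dualBasis (starCoords t d)) =
      (s * t * volCoord b (wedgeForm E (bivector b c) (bivector b d))) • vol b.dualBasis := by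
    simp only [wedgeForm_bivector, map_smul, volCoord_vol, starCoords]
    congr 1
    simp
    ring
  constructor
  · intro h x hx y hy
    obtain ⟨c, rfl⟩ := exists_eq_bivector b x
    obtain ⟨d, rfl⟩ := exists_eq_bivector b y
    have h1 := h _ (Submodule.subset_span ⟨_, hx, volCoord b, pairingDual_starCoords b _ c⟩)
      _ (Submodule.subset_span ⟨_, hy, volCoord b, pairingDual_starCoords b _ d⟩)
    rw [key, smul_eq_zero, or_iff_left (vol_ne_zero _)] at h1
    rw [eq_smul_vol b (wedgeForm E _ _)]
    rw [(by simpa using h1 : volCoord b (wedgeForm E (bivector b c) (bivector b d)) = 0), zero_smul]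
  · intro h x hx y hy
    induction hx, hy using Submodule.span_induction₂ with
    | mem_mem x y hx hy =>
      obtain ⟨u, hu, θ, hθ⟩ := hx
      obtain ⟨v, hv, θ', hθ'⟩ := hy
      obtain ⟨c, rfl⟩ := exists_eq_bivector b u
      obtain ⟨d, rfl⟩ := exists_eq_bivector b v
      rw [eq_bivector_starCoords b θ c hθ, eq_bivector_starCoords b θ' d hθ', key, h _ hu _ hv]
      simp
    | zero_left y hy => simp
    | zero_right x hx => simp
    | add_left x y z _ _ _ h1 h2 => simp [h1, h2]
    | add_right x y z _ _ _ h1 h2 => simp [h1, h2]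
    | smul_left r x y _ _ h1 => simp [h1]
    | smul_right r x y _ _ h1 => simp [h1]

end DualForm

/-! ### Multiplication by `v` and reduction modulo `v` have the same kernel on bivectors. -/

section WedgeRight

variable {V W : Type*} [AddCommGroup V] [Module ℂ V] [AddCommGroup W] [Module ℂ W]

variable (V) in
/-- The product `(a, v) ↦ a ∧ v`, where `a ∈ ⋀² V` and `v ∈ V`. -/
noncomputable def wedgeRight : ⋀[ℂ]^2 V →ₗ[ℂ] V →ₗ[ℂ] ⋀[ℂ]^3 V :=
  LinearMap.mk₂ ℂ
    (fun a v => ⟨(a : ExteriorAlgebra ℂ V) * ExteriorAlgebra.ι ℂ v,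
      SetLike.mul_mem_graded (A := fun n : ℕ => ⋀[ℂ]^n V) (j := 1) a.2
        (by change _ ∈ LinearMap.range _ ^ 1; rw [pow_one]; exact LinearMap.mem_range_self _ _)⟩)
    (fun a a' b => by ext; simp [add_mul])
    (fun c a b => by ext; simp)
    (fun a b b' => by ext; simp [mul_add])
    (fun c a b => by ext; simp)

@[simp]
theorem coe_wedgeRight (a : ⋀[ℂ]^2 V) (v : V) :
    (wedgeRight V a v : ExteriorAlgebra ℂ V) = (a : ExteriorAlgebra ℂ V) * ExteriorAlgebra.ι ℂ v :=
  rfl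

theorem wedgeRight_wedgeVec (x y z : V) :
    wedgeRight V (wedgeVec V x y) z = exteriorPower.ιMulti ℂ 3 ![x, y, z] := by
  ext
  simp [ExteriorAlgebra.ιMulti_apply, mul_assoc]

theorem wedgeRight_wedgeVec_left (x y : V) : wedgeRight V (wedgeVec V x y) x = 0 := by
  rw [wedgeRight_wedgeVec]
  exact AlternatingMap.map_eq_zero_of_eq _ ![x, y, x] (i := 0) (j := 2) rfl (by decide)

theorem wedgeRight_wedgeVec_right (x y : V) : wedgeRight V (wedgeVec V x y) y = 0 := by
  rw [wedgeRight_wedgeVec]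
  exact AlternatingMap.map_eq_zero_of_eq _ ![x, y, y] (i := 1) (j := 2) rfl (by decide)

theorem wedgeRight_wedgeVec_swap (x y z : V) :
    wedgeRight V (wedgeVec V x y) z = -wedgeRight V (wedgeVec V x z) y := by
  have h := wedgeRight_wedgeVec_right x (y + z)
  simp only [map_add, LinearMap.add_apply, wedgeRight_wedgeVec_right, zero_add, add_zero] at h
  exact eq_neg_of_add_eq_zero_right h

@[simp]
theorem map_wedgeVec (f : V →ₗ[ℂ] W) (x y : V) :
    exteriorPower.map 2 f (wedgeVec V x y) = wedgeVec W (f x) (f y) := by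
  rw [wedgeVec_apply, exteriorPower.map_apply_ιMulti, wedgeVec_apply]
  congr 1
  ext i
  fin_cases i <;> rfl

theorem coe_map (f : V →ₗ[ℂ] W) (a : ⋀[ℂ]^2 V) :
    (exteriorPower.map 2 f a : ExteriorAlgebra ℂ W) = ExteriorAlgebra.map f a := by
  have : (⋀[ℂ]^2 W).subtype ∘ₗ exteriorPower.map 2 f =
      (ExteriorAlgebra.map f).toLinearMap ∘ₗ (⋀[ℂ]^2 V).subtype :=
    bivector_hom_ext fun x y => by simp
  exact LinearMap.congr_fun this a

/-- Contraction on the right by a linear form with value one on `v`, followed by reduction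
modulo `v`, is a left inverse of the multiplication by `v`. -/
theorem map_contractRight_mul (L : Submodule ℂ V) (φ : Dual ℂ V) {v : V} (hv : v ∈ L)
    (a : ExteriorAlgebra ℂ V) :
    ExteriorAlgebra.map L.mkQ
      (CliffordAlgebra.contractRight (Q := (0 : QuadraticForm ℂ V)) (a * ExteriorAlgebra.ι ℂ v) φ) =
      φ v • ExteriorAlgebra.map L.mkQ a := by
  have h := CliffordAlgebra.contractRight_mul_ι (Q := (0 : QuadraticForm ℂ V)) (d := φ) v a
  change ExteriorAlgebra.map L.mkQ (CliffordAlgebra.contractRight (Q := (0 : QuadraticForm ℂ V))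
    (a * CliffordAlgebra.ι (0 : QuadraticForm ℂ V) v) φ) = _
  rw [h, map_sub, map_smul, map_mul]
  change _ - _ * ExteriorAlgebra.map L.mkQ (ExteriorAlgebra.ι ℂ v) = _
  rw [ExteriorAlgebra.map_apply_ι, Submodule.mkQ_apply, (Submodule.Quotient.mk_eq_zero L).2 hv,
    map_zero, mul_zero, sub_zero]

theorem exists_dual_eq_one {v : V} (hv : v ≠ 0) : ∃ φ : Dual ℂ V, φ v = 1 := by
  obtain ⟨φ, hφ⟩ : ∃ φ : Dual ℂ V, φ v ≠ 0 := by
    by_contra! h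
    exact hv ((forall_dual_apply_eq_zero_iff ℂ v).1 h)
  exact ⟨(φ v)⁻¹ • φ, by simp [hφ]⟩

/-- Contracting `a ∧ v` with a form that takes the value one on `v` recovers `a` modulo `v`. -/
theorem map_mkQ_eq_zero_of_mul_eq_zero {L : Submodule ℂ V} {v : V} (hv : v ∈ L) (hv0 : v ≠ 0)
    {a : ExteriorAlgebra ℂ V} (h : a * ExteriorAlgebra.ι ℂ v = 0) :
    ExteriorAlgebra.map L.mkQ a = 0 := by
  obtain ⟨φ, hφ⟩ := exists_dual_eq_one hv0
  have := map_contractRight_mul L φ hv a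
  rw [h, hφ, one_smul, map_zero, LinearMap.zero_apply, map_zero] at this
  exact this.symm

/-- A linear section `s` of the quotient map changes each vector only by a multiple of `v`, which
multiplication by `v` does not see. Thus `a ∧ v` factors through the reduction of `a`. -/
theorem wedgeRight_eq_zero_of_map_eq_zero {L : Submodule ℂ V} {v : V}
    (hL : L = Submodule.span ℂ {v}) {a : ⋀[ℂ]^2 V} (h : exteriorPower.map 2 L.mkQ a = 0) :
    wedgeRight V a v = 0 := by
  subst hL
  obtain ⟨s, hs⟩ := (Submodule.span ℂ {v}).mkQ.exists_rightInverse_of_surjective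
    (Submodule.range_mkQ _)
  have key : (wedgeRight V).flip v ∘ₗ exteriorPower.map 2 (s ∘ₗ (Submodule.span ℂ {v}).mkQ) =
      (wedgeRight V).flip v := by
    have hx : ∀ x, ∃ c : ℂ, s ((Submodule.span ℂ {v}).mkQ x) = x + c • v := by
      intro x
      have : s ((Submodule.span ℂ {v}).mkQ x) - x ∈ Submodule.span ℂ {v} := by
        rw [← Submodule.Quotient.mk_eq_zero, Submodule.Quotient.mk_sub, sub_eq_zero]
        exact LinearMap.congr_fun hs _
      obtain ⟨c, hc⟩ := Submodule.mem_span_singleton.1 this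
      exact ⟨c, by rw [hc]; abel⟩
    refine bivector_hom_ext fun x y => ?_
    obtain ⟨c, hc⟩ := hx x
    obtain ⟨d, hd⟩ := hx y
    simp only [LinearMap.comp_apply, LinearMap.flip_apply, map_wedgeVec, hc, hd, map_add, map_smul,
      LinearMap.add_apply, LinearMap.smul_apply, wedgeRight_wedgeVec_left,
      wedgeRight_wedgeVec_right, wedgeVec_self]
    simp
  have := LinearMap.congr_fun key a
  rw [LinearMap.comp_apply, exteriorPower.map_comp, LinearMap.comp_apply, h, map_zero, map_zero]
    at this
  exact this.symm

end WedgeRight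

/-! ### Bases of `V` adapted to `V₁`, and the frames they define. -/

section Bases

variable {V : Type*} [AddCommGroup V] [Module ℂ V]

theorem finrank_tFibre (hV : finrank ℂ V = 5) (L : ℙ ℂ V) : finrank ℂ (TFibre L) = 4 := by
  have : FiniteDimensional ℂ V := finiteDimensional_of_finrank hV
  have := L.submodule.finrank_quotient_add_finrank
  rw [L.finrank_submodule, hV] at this
  exact Nat.succ_injective this

/-- The basis of `V / B 0` given by the other vectors of a basis `B` of `V`. -/
theorem exists_quotient_basis (hV : finrank ℂ V = 5) {u : Fin 5 → V} (hu : LinearIndependent ℂ u) :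
    ∃ b : Basis (Fin 4) ℂ (TFibre (Projectivization.mk ℂ (u 0) (hu.ne_zero 0))),
      ∀ i, b i = (Projectivization.mk ℂ (u 0) (hu.ne_zero 0)).submodule.mkQ (u i.succ) := by
  have hli : LinearIndependent ℂ fun i : Fin 4 =>
      (Projectivization.mk ℂ (u 0) (hu.ne_zero 0)).submodule.mkQ (u i.succ) := by
    rw [Fintype.linearIndependent_iff] at hu ⊢
    intro g hg
    simp only [← map_smul, ← map_sum] at hg
    rw [Submodule.mkQ_apply, Submodule.Quotient.mk_eq_zero, Projectivization.submodule_mk,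
      Submodule.mem_span_singleton] at hg
    obtain ⟨c, hc⟩ := hg
    have := hu (Fin.cons (-c) g) (by simp [Fin.sum_univ_succ, hc])
    intro i
    exact this i.succ
  refine ⟨basisOfLinearIndependentOfCardEqFinrank hli (by rw [finrank_tFibre hV, Fintype.card_fin]),
    fun i => congrFun (coe_basisOfLinearIndependentOfCardEqFinrank _ _) i⟩

/-- A basis of `V / v` lifts to a basis of `V` which starts with `v`. -/
theorem exists_lift_basis (hV : finrank ℂ V = 5) {v : V} (hv : v ≠ 0)
    (b : Basis (Fin 4) ℂ (TFibre (Projectivization.mk ℂ v hv))) :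
    ∃ B : Basis (Fin 5) ℂ V, B 0 = v ∧
      ∀ i, (Projectivization.mk ℂ v hv).submodule.mkQ (B i.succ) = b i := by
  choose x hx using fun i => (Projectivization.mk ℂ v hv).submodule.mkQ_surjective (b i)
  have hli : LinearIndependent ℂ (Fin.cons v x : Fin 5 → V) := by
    rw [Fintype.linearIndependent_iff]
    intro g hg
    rw [Fin.sum_univ_succ] at hg
    simp only [Fin.cons_zero, Fin.cons_succ] at hg
    have h1 := congrArg (Projectivization.mk ℂ v hv).submodule.mkQ hg
    have hv' : (Projectivization.mk ℂ v hv).submodule.mkQ v = 0 := by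
      rw [Submodule.mkQ_apply, Submodule.Quotient.mk_eq_zero, Projectivization.submodule_mk]
      exact Submodule.mem_span_singleton_self v
    simp only [map_add, map_smul, hv', smul_zero, zero_add, map_sum, hx, map_zero] at h1
    have h2 := Fintype.linearIndependent_iff.1 b.linearIndependent _ h1
    simp only [h2, zero_smul, Finset.sum_const_zero, add_zero, smul_eq_zero, hv, or_false] at hg
    intro i
    induction i using Fin.cases with
    | zero => exact hg
    | succ i => exact h2 i
  refine ⟨basisOfLinearIndependentOfCardEqFinrank hli (by rw [hV, Fintype.card_fin]), ?_, ?_⟩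
  · simp
  · intro i
    rw [coe_basisOfLinearIndependentOfCardEqFinrank, Fin.cons_succ, hx]

/-- The points of the Grassmannian bundle with a basis of `V / V₁` whose products over the given
pairs generate `Ū`. -/
def planeLocus (V : Type*) [AddCommGroup V] [Module ℂ V] (s : Fin 3 → Fin 4 × Fin 4) : Set (Y3 V) :=
  {y | ∃ b : Basis (Fin 4) ℂ (TFibre y.base), y.space = plane s b}

/-- The frame given by a basis of `V` and three pairs of indices. -/
noncomputable def frameOf (hV : finrank ℂ V = 5) {s : Fin 3 → Fin 4 × Fin 4}
    (hs : ∀ {E : Type _} [AddCommGroup E] [Module ℂ E] (b : Basis (Fin 4) ℂ E),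
      LinearIndependent ℂ fun k => wedgeVec E (b (s k).1) (b (s k).2))
    {u : Fin 5 → V} (hu : LinearIndependent ℂ u) : Frame V where
  vec := u 0
  vec_ne := hu.ne_zero 0
  bivec k := wedgeVec V (u (s k).1.succ) (u (s k).2.succ)
  indep := by
    obtain ⟨b, hb⟩ := exists_quotient_basis hV hu
    simp only [map_wedgeVec, ← hb]
    exact hs b

variable {s : Fin 3 → Fin 4 × Fin 4}

theorem frameOf_mem_planeLocus (hV : finrank ℂ V = 5)
    (hs : ∀ {E : Type _} [AddCommGroup E] [Module ℂ E] (b : Basis (Fin 4) ℂ E),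
      LinearIndependent ℂ fun k => wedgeVec E (b (s k).1) (b (s k).2))
    {u : Fin 5 → V} (hu : LinearIndependent ℂ u) :
    (frameOf hV hs hu).toPoint ∈ planeLocus V s := by
  obtain ⟨b, hb⟩ := exists_quotient_basis hV hu
  refine ⟨b, ?_⟩
  refine congrArg (fun f => Submodule.span ℂ (Set.range f)) (funext fun k => ?_)
  exact (map_wedgeVec _ _ _).trans (congrArg₂ (fun x y => wedgeVec _ x y) (hb _).symm (hb _).symm)

theorem exists_frameOf_eq (hV : finrank ℂ V = 5)
    (hs : ∀ {E : Type _} [AddCommGroup E] [Module ℂ E] (b : Basis (Fin 4) ℂ E),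
      LinearIndependent ℂ fun k => wedgeVec E (b (s k).1) (b (s k).2))
    {y : Y3 V} (hy : y ∈ planeLocus V s) {v : V} (hv : v ≠ 0)
    (hyv : y.base = Projectivization.mk ℂ v hv) :
    ∃ B : Basis (Fin 5) ℂ V, B 0 = v ∧ (frameOf hV hs B.linearIndependent).toPoint = y := by
  obtain ⟨L, U, hU⟩ := y
  simp only at hyv
  subst hyv
  obtain ⟨b, hb⟩ := hy
  obtain ⟨B, hB, hBb⟩ := exists_lift_basis hV hv b
  refine ⟨B, hB, ?_⟩
  subst hB
  have key : Submodule.span ℂ (Set.range fun k =>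
      exteriorPower.map 2 (Projectivization.mk ℂ (B 0) hv).submodule.mkQ
        (wedgeVec V (B (s k).1.succ) (B (s k).2.succ))) = U := by
    refine Eq.trans ?_ hb.symm
    refine congrArg (fun f => Submodule.span ℂ (Set.range f)) (funext fun k => ?_)
    exact (map_wedgeVec _ _ _).trans (congrArg₂ (fun x y => wedgeVec _ x y) (hBb _) (hBb _))
  subst key
  rfl

end Bases

/-! ### Recovering `Ū` from its image; the exceptional set consists of ρ-planes. -/

section Contraction

variable {V : Type*} [AddCommGroup V] [Module ℂ V]

theorem eq_mk_of_mem {L : ℙ ℂ V} {v : V} (hv : v ≠ 0) (hvL : v ∈ L.submodule) :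
    L = Projectivization.mk ℂ v hv := by
  apply Projectivization.submodule_injective
  rw [Projectivization.submodule_mk]
  have : FiniteDimensional ℂ L.submodule := finiteDimensional_of_finrank L.finrank_submodule
  refine (Submodule.eq_of_le_of_finrank_eq
    ((Submodule.span_singleton_le_iff_mem _ _).2 hvL) ?_).symm
  rw [L.finrank_submodule, finrank_span_singleton hv]

/-- The product `a ∧ v` depends only on `a` modulo `v`, so the three chosen lifts and the single
vector `F.vec` suffice. -/
theorem toYbar_toPoint (F : Frame V) :
    toYbar F.toPoint =
      Submodule.span ℂ (Set.range fun k => wedgeRight V (F.bivec k) F.vec) := by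
  apply le_antisymm
  · refine Submodule.span_le.2 ?_
    rintro z ⟨a, ha, v, hv, hz⟩
    obtain rfl : z = wedgeRight V a v := Subtype.ext hz
    obtain ⟨c, rfl⟩ := Submodule.mem_span_singleton.1 hv
    have ha' : exteriorPower.map 2 (Projectivization.mk ℂ F.vec F.vec_ne).submodule.mkQ a ∈
      Submodule.span ℂ (Set.range fun k =>
        exteriorPower.map 2 (Projectivization.mk ℂ F.vec F.vec_ne).submodule.mkQ (F.bivec k)) := ha
    obtain ⟨g, hg⟩ := (Submodule.mem_span_range_iff_exists_fun ℂ).1 ha'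
    have h0 : exteriorPower.map 2 (Projectivization.mk ℂ F.vec F.vec_ne).submodule.mkQ
        (a - ∑ k, g k • F.bivec k) = 0 := by
      rw [map_sub, map_sum, sub_eq_zero]
      simp only [map_smul]
      exact hg.symm
    have h1 := wedgeRight_eq_zero_of_map_eq_zero (Projectivization.submodule_mk _ _) h0
    rw [map_sub, LinearMap.sub_apply, sub_eq_zero, map_sum, LinearMap.sum_apply] at h1
    rw [SetLike.mem_coe, map_smul, h1]
    refine Submodule.smul_mem _ _ (Submodule.sum_mem _ fun k _ => ?_)
    rw [map_smul, LinearMap.smul_apply]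
    exact Submodule.smul_mem _ _ (Submodule.subset_span ⟨k, rfl⟩)
  · refine Submodule.span_le.2 ?_
    rintro _ ⟨k, rfl⟩
    have hk : exteriorPower.map 2 (Projectivization.mk ℂ F.vec F.vec_ne).submodule.mkQ (F.bivec k) ∈
      Submodule.span ℂ (Set.range fun k =>
        exteriorPower.map 2 (Projectivization.mk ℂ F.vec F.vec_ne).submodule.mkQ (F.bivec k)) :=
      Submodule.subset_span ⟨k, rfl⟩
    exact Submodule.subset_span ⟨F.bivec k, hk, F.vec,
      Submodule.mem_span_singleton_self _, rfl⟩

/-- The nontrivial direction is injectivity of `toYbar` on fibres: the contraction `Λ` sends `Ū ∧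
V₁` back into `Ū`. -/
theorem map_mem_space_iff (y : Y3 V) {v : V} (hv : v ≠ 0) (hvL : v ∈ y.base.submodule)
    (a : ⋀[ℂ]^2 V) :
    exteriorPower.map 2 y.base.submodule.mkQ a ∈ y.space ↔ wedgeRight V a v ∈ toYbar y := by
  constructor
  · exact fun h => Submodule.subset_span ⟨a, h, v, hvL, rfl⟩
  intro h
  obtain ⟨φ, hφ⟩ := exists_dual_eq_one hv
  let Λ : ⋀[ℂ]^3 V →ₗ[ℂ] ExteriorAlgebra ℂ (TFibre y.base) :=
    (ExteriorAlgebra.map y.base.submodule.mkQ).toLinearMap ∘ₗ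
      (CliffordAlgebra.contractRight (Q := (0 : QuadraticForm ℂ V))).flip φ ∘ₗ (⋀[ℂ]^3 V).subtype
  have hΛ : ∀ b : ⋀[ℂ]^2 V, ∀ w ∈ y.base.submodule, Λ (wedgeRight V b w) =
      φ w • (exteriorPower.map 2 y.base.submodule.mkQ b : ExteriorAlgebra ℂ (TFibre y.base)) := by
    intro b w hw
    rw [coe_map]
    exact map_contractRight_mul _ φ hw _
  have hle : toYbar y ≤ (y.space.map (⋀[ℂ]^2 (TFibre y.base)).subtype).comap Λ := by
    refine Submodule.span_le.2 ?_
    rintro z ⟨b, hb, w, hw, hz⟩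
    obtain rfl : z = wedgeRight V b w := Subtype.ext hz
    rw [SetLike.mem_coe, Submodule.mem_comap, hΛ b w hw]
    exact Submodule.smul_mem _ _ ⟨_, hb, rfl⟩
  obtain ⟨x, hx, hxa⟩ := hle h
  rw [hΛ a v hvL, hφ, one_smul] at hxa
  rwa [← Subtype.ext hxa]

theorem map_two_mkQ_surjective (L : Submodule ℂ V) :
    Function.Surjective (exteriorPower.map (R := ℂ) 2 L.mkQ) :=
  exteriorPower.map_surjective L.mkQ_surjective

/-- A point of the Grassmannian bundle is determined by its base point and its image. -/
theorem eq_of_base_eq_of_toYbar_eq {y y' : Y3 V} (hb : y.base = y'.base)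
    (h : toYbar y = toYbar y') : y = y' := by
  have key : ∀ a, exteriorPower.map 2 y.base.submodule.mkQ a ∈ y.space ↔
      exteriorPower.map 2 y'.base.submodule.mkQ a ∈ y'.space := by
    intro a
    rw [map_mem_space_iff y y.base.rep_nonzero
        (by rw [Projectivization.submodule_eq]; exact Submodule.mem_span_singleton_self _),
      map_mem_space_iff y' y.base.rep_nonzero
        (by rw [← hb, Projectivization.submodule_eq]; exact Submodule.mem_span_singleton_self _), h]
  obtain ⟨L, U, hU⟩ := y
  obtain ⟨L', U', hU'⟩ := y'
  obtain rfl : L = L' := hb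
  have : U = U' := by
    ext x
    obtain ⟨a, rfl⟩ := map_two_mkQ_surjective L.submodule x
    exact key a
  subst this
  rfl

/-- The bivectors annihilated by `b 0` lie in the `ρ`-plane of a basis `b`. -/
theorem mem_plane_rhoPairs_of_mul_eq_zero {E : Type*} [AddCommGroup E] [Module ℂ E]
    (b : Basis (Fin 4) ℂ E) {x : ⋀[ℂ]^2 E}
    (h : (x : ExteriorAlgebra ℂ E) * ExteriorAlgebra.ι ℂ (b 0) = 0) : x ∈ plane rhoPairs b := by
  obtain ⟨c, rfl⟩ := exists_eq_bivector b x
  have key : ∀ t, wedgeForm E (bivector b c) (wedgeVec E (b 0) t) = 0 := by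
    intro t
    ext
    rw [coe_wedgeForm, coe_wedgeVec, ← mul_assoc, h, zero_mul]
    rfl
  have hw := wedgeVec_basis_eq_bivector b
  have h1 := key (b 1)
  have h2 := key (b 2)
  have h3 := key (b 3)
  simp only [hw, wedgeForm_bivector, smul_eq_zero, or_iff_left (vol_ne_zero b)] at h1 h2 h3
  rw [mem_plane_rhoPairs]
  simp at h1 h2 h3
  exact ⟨h3, h2, h1⟩

theorem mul_ι_eq_zero_of_mem_toYbar {y : Y3 V} {z : ⋀[ℂ]^3 V} (hz : z ∈ toYbar y) {v : V}
    (hv : v ∈ y.base.submodule) :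
    (z : ExteriorAlgebra ℂ V) * ExteriorAlgebra.ι ℂ v = 0 := by
  have hle : toYbar y ≤ LinearMap.ker ((LinearMap.mul ℂ (ExteriorAlgebra ℂ V)).flip
      (ExteriorAlgebra.ι ℂ v) ∘ₗ (⋀[ℂ]^3 V).subtype) := by
    refine Submodule.span_le.2 ?_
    rintro z ⟨b, hb, w, hw, hz⟩
    obtain ⟨c, rfl⟩ : ∃ c : ℂ, c • y.base.rep = v := by
      rwa [Projectivization.submodule_eq, Submodule.mem_span_singleton] at hv
    obtain ⟨d, rfl⟩ : ∃ d : ℂ, d • y.base.rep = w := by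
      rwa [Projectivization.submodule_eq, Submodule.mem_span_singleton] at hw
    change (z : ExteriorAlgebra ℂ V) * ExteriorAlgebra.ι ℂ (c • y.base.rep) = 0
    rw [hz, mul_assoc]
    simp
  exact hle hz

/-- After `x` and `v` are interchanged, the factor `v` can be cancelled modulo `L`, so that `b 0`
annihilates the reduction of `a`. -/
theorem map_mem_plane_rhoPairs {L : Submodule ℂ V} {v x : V} (hv : v ∈ L) (hv0 : v ≠ 0)
    (b : Basis (Fin 4) ℂ (V ⧸ L)) (hb : b 0 = L.mkQ x) {a : ⋀[ℂ]^2 V}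
    (h : (a : ExteriorAlgebra ℂ V) * ExteriorAlgebra.ι ℂ v * ExteriorAlgebra.ι ℂ x = 0) :
    exteriorPower.map 2 L.mkQ a ∈ plane rhoPairs b := by
  apply mem_plane_rhoPairs_of_mul_eq_zero
  have hanti : ExteriorAlgebra.ι ℂ x * ExteriorAlgebra.ι ℂ v =
      -(ExteriorAlgebra.ι ℂ v * ExteriorAlgebra.ι ℂ x) :=
    eq_neg_of_add_eq_zero_left (ExteriorAlgebra.ι_add_mul_swap x v)
  have h3 : (a : ExteriorAlgebra ℂ V) * ExteriorAlgebra.ι ℂ x * ExteriorAlgebra.ι ℂ v = 0 := by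
    rw [mul_assoc, hanti, mul_neg, ← mul_assoc, h, neg_zero]
  have h4 := map_mkQ_eq_zero_of_mul_eq_zero hv hv0 h3
  rwa [map_mul, ExteriorAlgebra.map_apply_ι, ← coe_map, ← hb] at h4

/-- The common image is annihilated by the base vectors of both points. These are independent, so
the second one has a nonzero class `e` in `V/V₁`; `e` annihilates `Ū`, and dimensions give `Ū = e ∧
(V/V₁)`. -/
theorem Prho_subset_planeLocus (hV : finrank ℂ V = 5) : Prho V ⊆ planeLocus V rhoPairs := by
  rintro y ⟨y', hne, hy⟩
  have hbase : y'.base ≠ y.base := fun h => hne (eq_of_base_eq_of_toYbar_eq h hy)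
  let v := y.base.rep
  let v' := y'.base.rep
  have hv : v ∈ y.base.submodule := by
    rw [Projectivization.submodule_eq]; exact Submodule.mem_span_singleton_self _
  have hv' : v' ∈ y'.base.submodule := by
    rw [Projectivization.submodule_eq]; exact Submodule.mem_span_singleton_self _
  have he : y.base.submodule.mkQ v' ≠ 0 := by
    rw [Submodule.mkQ_apply, Ne, Submodule.Quotient.mk_eq_zero]
    intro hmem
    apply hbase
    rw [eq_mk_of_mem y'.base.rep_nonzero hmem, Projectivization.mk_rep]
  obtain ⟨b, hb⟩ := exists_basis_zero_eq (finrank_tFibre hV y.base) he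
  refine ⟨b, ?_⟩
  have hle : y.space ≤ plane rhoPairs b := by
    intro x hx
    obtain ⟨a, rfl⟩ := map_two_mkQ_surjective y.base.submodule x
    have h1 := (map_mem_space_iff y y.base.rep_nonzero hv a).1 hx
    rw [← hy] at h1
    exact map_mem_plane_rhoPairs hv y.base.rep_nonzero b hb (mul_ι_eq_zero_of_mem_toYbar h1 hv')
  have : FiniteDimensional ℂ (TFibre y.base) := finiteDimensional_of_finrank (finrank_tFibre hV _)
  exact Submodule.eq_of_le_of_finrank_eq hle
    (by rw [y.finrank_space, finrank_plane (linearIndependent_rhoPairs b)])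

end Contraction

/-! ### The loci of ρ-planes and σ-planes in terms of bases. -/

section Loci

variable {V : Type*} [AddCommGroup V] [Module ℂ V]

theorem rho_span_eq {V₂ : Submodule ℂ V} {p q : V} (h : V₂ = Submodule.span ℂ {p, q}) :
    Submodule.span ℂ {z | ∃ x : V, ∃ y ∈ V₂, ∃ y' ∈ V₂,
      z = exteriorPower.ιMulti ℂ 3 ![x, y, y']} =
    LinearMap.range ((wedgeRight V).flip q ∘ₗ (wedgeVec V).flip p) := by
  subst h
  apply le_antisymm
  · rw [Submodule.span_le]
    rintro _ ⟨x, y, hy, y', hy', rfl⟩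
    obtain ⟨a, b, rfl⟩ := Submodule.mem_span_pair.1 hy
    obtain ⟨c, d, rfl⟩ := Submodule.mem_span_pair.1 hy'
    -- Since `⋀² V₂` is the line of `p ∧ q`, the product of two vectors of `V₂` is their determinant
    -- times `p ∧ q`.
    refine LinearMap.mem_range.2 ⟨(a * d - b * c) • x, ?_⟩
    rw [← wedgeRight_wedgeVec]
    change wedgeRight V (wedgeVec V ((a * d - b * c) • x) p) q = _
    simp only [map_add, map_smul, LinearMap.add_apply,
      LinearMap.smul_apply, wedgeRight_wedgeVec_right, wedgeRight_wedgeVec_swap x q p]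
    module
  · rintro _ ⟨x, rfl⟩
    have hp : p ∈ Submodule.span ℂ {p, q} := Submodule.mem_span_pair.2 ⟨1, 0, by simp⟩
    have hq : q ∈ Submodule.span ℂ {p, q} := Submodule.mem_span_pair.2 ⟨0, 1, by simp⟩
    have hz : ∃ x' : V, ∃ y ∈ Submodule.span ℂ {p, q}, ∃ y' ∈ Submodule.span ℂ {p, q},
        wedgeRight V (wedgeVec V x p) q = exteriorPower.ιMulti ℂ 3 ![x', y, y'] :=
      ⟨x, p, hp, q, hq, wedgeRight_wedgeVec x p q⟩
    exact Submodule.subset_span hz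

theorem toYbar_rho (hV : finrank ℂ V = 5) (B : Basis (Fin 5) ℂ V) :
    toYbar (frameOf hV linearIndependent_rhoPairs B.linearIndependent).toPoint =
      LinearMap.range ((wedgeRight V).flip (B 0) ∘ₗ (wedgeVec V).flip (B 1)) := by
  rw [toYbar_toPoint]
  have h : ∀ x, wedgeRight V (wedgeVec V (B 1) x) (B 0) =
      -((wedgeRight V).flip (B 0) ∘ₗ (wedgeVec V).flip (B 1)) x := by
    intro x
    rw [wedgeVec_swap, map_neg]
    rfl
  apply le_antisymm
  · rw [Submodule.span_le]
    rintro _ ⟨k, rfl⟩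
    fin_cases k
    · exact ⟨-B 2, by rw [map_neg]; exact (h _).symm⟩
    · exact ⟨-B 3, by rw [map_neg]; exact (h _).symm⟩
    · exact ⟨-B 4, by rw [map_neg]; exact (h _).symm⟩
  · rw [LinearMap.range_eq_map, ← B.span_eq, Submodule.map_span, Submodule.span_le]
    rintro _ ⟨_, ⟨i, rfl⟩, rfl⟩
    rw [SetLike.mem_coe, ← Submodule.neg_mem_iff, ← h]
    rcases (by fin_cases i <;> simp : i = 0 ∨ i = 1 ∨ i = 2 ∨ i = 3 ∨ i = 4) with
      rfl | rfl | rfl | rfl | rfl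
    · rw [wedgeRight_wedgeVec_right]
      exact Submodule.zero_mem _
    · rw [wedgeVec_self, map_zero]
      exact Submodule.zero_mem _
    · exact Submodule.subset_span ⟨0, rfl⟩
    · exact Submodule.subset_span ⟨1, rfl⟩
    · exact Submodule.subset_span ⟨2, rfl⟩

/-- Interchanging the two vectors of a basis of `V₂` changes the line `V₁` but not `V₂`; the two
resulting points lie over the same ρ-plane. -/
theorem exists_ne_toYbar_eq (hV : finrank ℂ V = 5) {W : Submodule ℂ (⋀[ℂ]^3 V)}
    (hW : W ∈ PrhoBar V) : ∃ y y' : Y3 V, y ≠ y' ∧ toYbar y = W ∧ toYbar y' = W := by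
  have : FiniteDimensional ℂ V := finiteDimensional_of_finrank hV
  obtain ⟨V₂, h2, rfl⟩ := hW
  have : FiniteDimensional ℂ V₂ := finiteDimensional_of_finrank h2
  let u := finBasisOfFinrankEq ℂ V₂ h2
  have hu : LinearIndependent ℂ (fun i => (u i : V)) :=
    u.linearIndependent.map' V₂.subtype V₂.ker_subtype
  obtain ⟨B, hB⟩ := exists_basis_extending hV _ hu (by norm_num)
  have h0 : B 0 = u 0 := hB 0
  have h1 : B 1 = u 1 := hB 1
  have hspan : V₂ = Submodule.span ℂ {B 0, B 1} := by
    have := congrArg (Submodule.map V₂.subtype) u.span_eq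
    rw [Submodule.map_span, ← Set.range_comp, Submodule.map_top, Submodule.range_subtype] at this
    rw [← this]
    congr 1
    ext x
    simp [Fin.exists_fin_two, h0, h1, eq_comm]
  have hspan' : V₂ = Submodule.span ℂ {B 1, B 0} := by
    rw [Set.pair_comm, hspan]
  let B' := B.reindex (Equiv.swap 0 1)
  have hB0 : B' 0 = B 1 := by simp [B', Basis.reindex_apply]
  have hB1 : B' 1 = B 0 := by simp [B', Basis.reindex_apply]
  refine ⟨(frameOf hV linearIndependent_rhoPairs B.linearIndependent).toPoint,
    (frameOf hV linearIndependent_rhoPairs B'.linearIndependent).toPoint, ?_, ?_, ?_⟩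
  · intro h
    have hb : Projectivization.mk ℂ (B 0) (B.ne_zero 0) =
      Projectivization.mk ℂ (B' 0) (B'.ne_zero 0) := congrArg Y3.base h
    obtain ⟨a, ha⟩ := (Projectivization.mk_eq_mk_iff' _ _ _ _ _).1 hb
    rw [hB0] at ha
    have := congrArg (fun x => B.repr x 0) ha
    simp at this
  · rw [toYbar_rho, rho_span_eq hspan']
  · rw [toYbar_rho, rho_span_eq hspan, hB0, hB1]

theorem planeLocus_rho_subset (hV : finrank ℂ V = 5) :
    planeLocus V rhoPairs ⊆ toYbar ⁻¹' PrhoBar V := by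
  intro y hy
  obtain ⟨B, -, rfl⟩ := exists_frameOf_eq hV linearIndependent_rhoPairs hy y.base.rep_nonzero
    y.base.mk_rep.symm
  refine ⟨Submodule.span ℂ {B 1, B 0}, ?_, ?_⟩
  · have hli : LinearIndependent ℂ ![B 1, B 0] := by
      have := B.linearIndependent.comp ![1, 0] (by decide)
      convert this using 1
      ext i
      fin_cases i <;> rfl
    have := finrank_span_eq_card hli
    rwa [Matrix.range_cons, Matrix.range_cons, Matrix.range_empty, Set.union_empty,
      Fintype.card_fin] at this
  · rw [toYbar_rho, rho_span_eq rfl]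

theorem preimage_PrhoBar_subset (hV : finrank ℂ V = 5) : toYbar ⁻¹' PrhoBar V ⊆ Prho V := by
  intro y hy
  obtain ⟨y₁, y₂, hne, h₁, h₂⟩ := exists_ne_toYbar_eq hV hy
  by_cases h : y₁ = y
  · exact ⟨y₂, fun h' => hne (h.trans h'.symm), h₂⟩
  · exact ⟨y₁, h, h₁⟩

/-- The exceptional set, the ρ-locus and the preimage of `PrhoBar` form a closed cycle of
inclusions, so all three agree. -/
theorem Prho_eq_planeLocus (hV : finrank ℂ V = 5) : Prho V = planeLocus V rhoPairs :=
  (Prho_subset_planeLocus hV).antisymm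
    ((planeLocus_rho_subset hV).trans (preimage_PrhoBar_subset hV))

theorem Prho_eq_preimage (hV : finrank ℂ V = 5) : Prho V = toYbar ⁻¹' PrhoBar V :=
  ((Prho_subset_planeLocus hV).trans (planeLocus_rho_subset hV)).antisymm
    (preimage_PrhoBar_subset hV)

theorem image_Prho (hV : finrank ℂ V = 5) : toYbar '' Prho V = PrhoBar V := by
  rw [Prho_eq_preimage hV, Set.image_preimage_eq_iff]
  intro W hW
  obtain ⟨y, -, -, h, -⟩ := exists_ne_toYbar_eq hV hW
  exact ⟨y, h⟩

/-- Here `V₄` is spanned by all basis vectors except `B 1`: index 0 of the quotient basis, which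
`sigmaPairs` omits, lifts to `B 1`. Products containing `B 0` vanish after multiplication by `B 0`.
-/
theorem sigma_span_eq (hV : finrank ℂ V = 5) (B : Basis (Fin 5) ℂ V) :
    Submodule.span ℂ {z | ∃ x ∈ Submodule.span ℂ (Set.range fun i : Fin 4 => B ((1 : Fin 5).succAbove i)),
      ∃ y ∈ Submodule.span ℂ (Set.range fun i : Fin 4 => B ((1 : Fin 5).succAbove i)),
      ∃ v ∈ Submodule.span ℂ {B 0}, z = exteriorPower.ιMulti ℂ 3 ![x, y, v]} =
    toYbar (frameOf hV linearIndependent_sigmaPairs B.linearIndependent).toPoint := by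
  rw [toYbar_toPoint]
  apply le_antisymm
  · rw [Submodule.span_le]
    rintro _ ⟨x, hx, y, hy, v, hv, rfl⟩
    obtain ⟨c, rfl⟩ := Submodule.mem_span_singleton.1 hv
    rw [← wedgeRight_wedgeVec, map_smul]
    refine Submodule.smul_mem _ _ ?_
    induction hx, hy using Submodule.span_induction₂ with
    | mem_mem x y hx hy =>
      obtain ⟨i, rfl⟩ := hx
      obtain ⟨j, rfl⟩ := hy
      have h0 : ∀ a, wedgeRight V (wedgeVec V a (B 0)) (B 0) = 0 := fun a =>
        wedgeRight_wedgeVec_right _ _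
      have h0' : ∀ a, wedgeRight V (wedgeVec V (B 0) a) (B 0) = 0 := fun a =>
        wedgeRight_wedgeVec_left _ _
      have hz := Submodule.zero_mem (Submodule.span ℂ (Set.range fun k =>
        wedgeRight V ((frameOf hV linearIndependent_sigmaPairs B.linearIndependent).bivec k)
          (frameOf hV linearIndependent_sigmaPairs B.linearIndependent).vec))
      have hm : ∀ k, wedgeRight V (wedgeVec V (B (sigmaPairs k).1.succ) (B (sigmaPairs k).2.succ))
          (B 0) ∈ Submodule.span ℂ (Set.range fun k =>
        wedgeRight V ((frameOf hV linearIndependent_sigmaPairs B.linearIndependent).bivec k)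
          (frameOf hV linearIndependent_sigmaPairs B.linearIndependent).vec) :=
        fun k => Submodule.subset_span ⟨k, rfl⟩
      have hn : ∀ a b, wedgeRight V (wedgeVec V a b) (B 0) ∈ Submodule.span ℂ (Set.range fun k =>
        wedgeRight V ((frameOf hV linearIndependent_sigmaPairs B.linearIndependent).bivec k)
          (frameOf hV linearIndependent_sigmaPairs B.linearIndependent).vec) →
          wedgeRight V (wedgeVec V b a) (B 0) ∈ Submodule.span ℂ (Set.range fun k =>
        wedgeRight V ((frameOf hV linearIndependent_sigmaPairs B.linearIndependent).bivec k)
          (frameOf hV linearIndependent_sigmaPairs B.linearIndependent).vec) := by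
        intro a b h
        rw [wedgeVec_swap, map_neg, LinearMap.neg_apply]
        exact Submodule.neg_mem _ h
      have hs : ∀ a, wedgeRight V (wedgeVec V a a) (B 0) = 0 := fun a => by
        rw [wedgeVec_self, map_zero, LinearMap.zero_apply]
      have e0 : (1 : Fin 5).succAbove 0 = 0 := rfl
      have e1 : (1 : Fin 5).succAbove 1 = 2 := rfl
      have e2 : (1 : Fin 5).succAbove 2 = 3 := rfl
      have e3 : (1 : Fin 5).succAbove 3 = 4 := rfl
      rcases (by fin_cases i <;> simp : i = 0 ∨ i = 1 ∨ i = 2 ∨ i = 3) with rfl | rfl | rfl | rfl <;>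
      rcases (by fin_cases j <;> simp : j = 0 ∨ j = 1 ∨ j = 2 ∨ j = 3) with rfl | rfl | rfl | rfl <;>
      simp only [e0, e1, e2, e3, h0, h0', hs, hz]
      exacts [hm 0, hm 1, hn _ _ (hm 0), hm 2, hn _ _ (hm 1), hn _ _ (hm 2)]
    | zero_left y hy => simp
    | zero_right x hx => simp
    | add_left x y z _ _ _ h1 h2 => simpa using Submodule.add_mem _ h1 h2
    | add_right x y z _ _ _ h1 h2 => simpa using Submodule.add_mem _ h1 h2
    | smul_left r x y _ _ h1 => simpa using Submodule.smul_mem _ r h1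
    | smul_right r x y _ _ h1 => simpa using Submodule.smul_mem _ r h1
  · rw [Submodule.span_le]
    rintro _ ⟨k, rfl⟩
    have hm : ∀ i : Fin 4, B ((1 : Fin 5).succAbove i) ∈ Submodule.span ℂ
        (Set.range fun i : Fin 4 => B ((1 : Fin 5).succAbove i)) :=
      fun i => Submodule.subset_span ⟨i, rfl⟩
    fin_cases k
    · exact Submodule.subset_span ⟨_, hm 1, _, hm 2, _, Submodule.mem_span_singleton_self _,
        wedgeRight_wedgeVec _ _ _⟩
    · exact Submodule.subset_span ⟨_, hm 1, _, hm 3, _, Submodule.mem_span_singleton_self _,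
        wedgeRight_wedgeVec _ _ _⟩
    · exact Submodule.subset_span ⟨_, hm 2, _, hm 3, _, Submodule.mem_span_singleton_self _,
        wedgeRight_wedgeVec _ _ _⟩

theorem toYbar_sigma_mem (hV : finrank ℂ V = 5) (B : Basis (Fin 5) ℂ V) :
    toYbar (frameOf hV linearIndependent_sigmaPairs B.linearIndependent).toPoint ∈ PsigmaBar V := by
  refine ⟨Submodule.span ℂ {B 0},
    Submodule.span ℂ (Set.range fun i : Fin 4 => B ((1 : Fin 5).succAbove i)), ?_, ?_, ?_,
    (sigma_span_eq hV B).symm⟩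
  · exact finrank_span_singleton (B.ne_zero 0)
  · have := finrank_span_eq_card (B.linearIndependent.comp (Fin.succAbove (1 : Fin 5))
      Fin.succAbove_right_injective)
    rwa [Fintype.card_fin] at this
  · rw [Submodule.span_singleton_le_iff_mem]
    exact Submodule.subset_span ⟨0, rfl⟩

theorem exists_fin_four {P : Fin 4 → Prop} : (∃ i, P i) ↔ P 0 ∨ P 1 ∨ P 2 ∨ P 3 := by
  simp [Fin.exists_fin_succ]

theorem exists_toYbar_sigma_eq (hV : finrank ℂ V = 5) {W : Submodule ℂ (⋀[ℂ]^3 V)}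
    (hW : W ∈ PsigmaBar V) : ∃ B : Basis (Fin 5) ℂ V,
      toYbar (frameOf hV linearIndependent_sigmaPairs B.linearIndependent).toPoint = W := by
  have : FiniteDimensional ℂ V := finiteDimensional_of_finrank hV
  obtain ⟨V₁, V₄, h1, h4, hle, rfl⟩ := hW
  obtain ⟨⟨v, hv⟩, hv0, hspan⟩ := finrank_eq_one_iff'.1 h1
  have hv0' : v ≠ 0 := fun h => hv0 (Subtype.ext h)
  have hV₁ : V₁ = Submodule.span ℂ {v} := by
    apply le_antisymm
    · intro w hw
      obtain ⟨c, hc⟩ := hspan ⟨w, hw⟩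
      exact Submodule.mem_span_singleton.2 ⟨c, congrArg Subtype.val hc⟩
    · rwa [Submodule.span_singleton_le_iff_mem]
  obtain ⟨c, hc⟩ := exists_basis_zero_eq (E := V₄) h4 (e := ⟨v, hle hv⟩)
    (fun h => hv0' (congrArg Subtype.val h))
  have hli : LinearIndependent ℂ (fun i => (c i : V)) :=
    c.linearIndependent.map' V₄.subtype V₄.ker_subtype
  obtain ⟨B', hB'⟩ := exists_basis_extending hV _ hli (by norm_num)
  -- The basis of `V₄` occupies positions 0 to 3 of `B'`; the swap moves the remaining vector to
  -- position 1, the one left out of `V₄`.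
  let σ : Equiv.Perm (Fin 5) := Equiv.swap 1 4
  let B := B'.reindex σ
  have h0 : B 0 = v := by
    have : B 0 = B' 0 := by rw [Basis.reindex_apply]; rfl
    rw [this]
    exact (hB' 0).trans (congrArg Subtype.val hc)
  have e0 : B ((1 : Fin 5).succAbove 0) = c 0 := by
    rw [Basis.reindex_apply]; exact hB' 0
  have e1 : B ((1 : Fin 5).succAbove 1) = c 2 := by
    rw [Basis.reindex_apply]; exact hB' 2
  have e2 : B ((1 : Fin 5).succAbove 2) = c 3 := by
    rw [Basis.reindex_apply]; exact hB' 3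
  have e3 : B ((1 : Fin 5).succAbove 3) = c 1 := by
    rw [Basis.reindex_apply]; exact hB' 1
  have hV₄ : V₄ = Submodule.span ℂ (Set.range fun i : Fin 4 => B ((1 : Fin 5).succAbove i)) := by
    have := congrArg (Submodule.map V₄.subtype) c.span_eq
    rw [Submodule.map_span, ← Set.range_comp, Submodule.map_top, Submodule.range_subtype] at this
    rw [← this]
    congr 1
    ext x
    rw [Set.mem_range, Set.mem_range, exists_fin_four, exists_fin_four, e0, e1, e2, e3]
    simp only [Function.comp_apply, Submodule.subtype_apply]
    tauto
  refine ⟨B, ?_⟩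
  rw [← sigma_span_eq, ← hV₄, h0, hV₁]

theorem planeLocus_rho_disjoint_sigma {y : Y3 V} (h : y ∈ planeLocus V rhoPairs) :
    y ∉ planeLocus V sigmaPairs := by
  rintro ⟨b', hb'⟩
  obtain ⟨b, hb⟩ := h
  exact plane_rhoPairs_ne_plane_sigmaPairs b b' (hb.symm.trans hb')

/-- Outside `Prho` a point is the whole fibre through it, so it equals the σ-point with the same
image. Conversely, a σ-point over the image of `Prho` would also be a ρ-point, contrary to
disjointness. -/
theorem preimage_PsigmaBar (hV : finrank ℂ V = 5) :
    toYbar ⁻¹' (PsigmaBar V \ toYbar '' Prho V) = planeLocus V sigmaPairs := by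
  ext y
  constructor
  · rintro ⟨h1, h2⟩
    obtain ⟨B, hB⟩ := exists_toYbar_sigma_eq hV h1
    have hy : y ∉ Prho V := fun h => h2 ⟨y, h, rfl⟩
    have : (frameOf hV linearIndependent_sigmaPairs B.linearIndependent).toPoint = y := by
      by_contra hne
      exact hy ⟨_, hne, hB⟩
    rw [← this]
    exact frameOf_mem_planeLocus hV _ _
  · intro hy
    constructor
    · obtain ⟨B, -, rfl⟩ := exists_frameOf_eq hV linearIndependent_sigmaPairs hy
        y.base.rep_nonzero y.base.mk_rep.symm
      exact toYbar_sigma_mem hV B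
    · rw [image_Prho hV]
      intro h
      have h' : y ∈ Prho V := by
        rw [Prho_eq_preimage hV]; exact h
      rw [Prho_eq_planeLocus hV] at h'
      exact planeLocus_rho_disjoint_sigma h' hy

theorem OG_eq_union (hV : finrank ℂ V = 5) :
    OG V = planeLocus V rhoPairs ∪ planeLocus V sigmaPairs := by
  ext y
  constructor
  · intro h
    obtain ⟨b, hb | hb⟩ := exists_plane_of_isIsotropic (finrank_tFibre hV y.base) y.finrank_space h
    · exact Or.inl ⟨b, hb⟩
    · exact Or.inr ⟨b, hb⟩
  · rintro (⟨b, hb⟩ | ⟨b, hb⟩)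
    · change IsIsotropic y.space
      rw [hb]
      exact isIsotropic_rhoPairs b
    · change IsIsotropic y.space
      rw [hb]
      exact isIsotropic_sigmaPairs b

theorem OG_eq_OGDual (hV : finrank ℂ V = 5) : OG V = OGDual V :=
  Set.ext fun y => (isIsotropic_dualSubspace_iff (finrank_tFibre hV y.base) y.space).symm

end Loci

/-! ### Polynomial maps and Zariski open conditions. -/

section Regular

variable {W M N P : Type*} [AddCommGroup W] [Module ℂ W] [AddCommGroup M] [Module ℂ M]
  [AddCommGroup N] [Module ℂ N] [AddCommGroup P] [Module ℂ P]

/-- Maps between vector spaces whose coordinates are polynomials in linear forms. -/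
def IsPolynomialMap (f : W → M) : Prop :=
  ∀ μ : Dual ℂ M, ∃ p : MvPolynomial (Dual ℂ W) ℂ, ∀ w, MvPolynomial.eval (fun l => l w) p = μ (f w)

theorem IsPolynomialMap.of_linear (f : W →ₗ[ℂ] M) : IsPolynomialMap f :=
  fun μ => ⟨MvPolynomial.X (μ ∘ₗ f), fun w => by simp⟩

theorem IsPolynomialMap.bilinear [FiniteDimensional ℂ M] {f : W → M} {g : W → N}
    (hf : IsPolynomialMap f) (hg : IsPolynomialMap g) (B : M →ₗ[ℂ] N →ₗ[ℂ] P) :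
    IsPolynomialMap fun w => B (f w) (g w) := by
  intro μ
  let b := finBasis ℂ M
  choose p hp using fun i => hf (b.coord i)
  choose q hq using fun i => hg (μ ∘ₗ B (b i))
  refine ⟨∑ i, p i * q i, fun w => ?_⟩
  change _ = μ (B (f w) (g w))
  conv_rhs => rw [← b.sum_repr (f w)]
  simp only [map_sum, map_mul, hp, hq, LinearMap.sum_apply, map_smul, LinearMap.smul_apply,
    smul_eq_mul]
  rfl

theorem IsPolynomialMap.pi {n : ℕ} {f : Fin n → W → M} (hf : ∀ k, IsPolynomialMap (f k)) :
    IsPolynomialMap fun w k => f k w := by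
  intro μ
  choose p hp using fun k => hf k (μ ∘ₗ LinearMap.single ℂ (fun _ => M) k)
  refine ⟨∑ k, p k, fun w => ?_⟩
  simp only [map_sum, hp, LinearMap.comp_apply]
  rw [← map_sum]
  congr 1
  exact LinearMap.sum_single_apply (fun _ => M) (fun k => f k w)

theorem IsPolynomialMap.prodMk {f : W → M} {g : W → N} (hf : IsPolynomialMap f)
    (hg : IsPolynomialMap g) : IsPolynomialMap fun w => (f w, g w) := by
  intro μ
  obtain ⟨p, hp⟩ := hf (μ ∘ₗ LinearMap.inl ℂ M N)
  obtain ⟨q, hq⟩ := hg (μ ∘ₗ LinearMap.inr ℂ M N)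
  refine ⟨p + q, fun w => ?_⟩
  rw [map_add, hp, hq, LinearMap.comp_apply, LinearMap.comp_apply, ← map_add]
  simp

theorem exists_dual_family {n : ℕ} {v : Fin n → M} (hv : LinearIndependent ℂ v) :
    ∃ μ : Fin n → Dual ℂ M, ∀ j i, μ j (v i) = if j = i then 1 else 0 := by
  choose μ hμ using fun j => ((Basis.span hv).coord j).exists_extend
  refine ⟨μ, fun j i => ?_⟩
  have h := LinearMap.congr_fun (hμ j) (Basis.span hv i)
  rw [Basis.coord_apply, Basis.repr_self, Finsupp.single_apply, LinearMap.comp_apply,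
    Submodule.subtype_apply, Basis.span_apply] at h
  rw [h]
  simp only [eq_comm]

/-- Linear independence of polynomial maps is an open condition in the Zariski topology. -/
theorem isOpen_setOf_linearIndependent {n : ℕ} {f : Fin n → W → M}
    (hf : ∀ i, IsPolynomialMap (f i)) :
    @IsOpen _ (zariskiTopology W) {w | LinearIndependent ℂ fun i => f i w} := by
  rw [@isOpen_iff_forall_mem_open _ (zariskiTopology W)]
  intro w₀ hw₀
  -- Linear forms dual to the family at `w₀` define a polynomial determinant equal to 1 at `w₀`;
  -- where it does not vanish, the family stays independent.
  obtain ⟨μ, hμ⟩ := exists_dual_family hw₀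
  choose p hp using fun j i => hf i (μ j)
  have hdet : ∀ w, MvPolynomial.eval (fun l => l w) (Matrix.det (Matrix.of p)) =
      Matrix.det (Matrix.of fun j i => μ j (f i w)) := by
    intro w
    rw [RingHom.map_det]
    congr 1
    ext j i
    simp [hp]
  refine ⟨{w | MvPolynomial.eval (fun l => l w) (Matrix.det (Matrix.of p)) ≠ 0}, ?_,
    TopologicalSpace.GenerateOpen.basic _ ⟨_, rfl⟩, ?_⟩
  · intro w hw
    rw [Set.mem_ofPred_eq, hdet] at hw
    refine Fintype.linearIndependent_iff.2 fun g hg => ?_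
    have : Matrix.mulVec (Matrix.of fun j i => μ j (f i w)) g = 0 := by
      ext j
      have := congrArg (μ j) hg
      simpa [Matrix.mulVec, dotProduct, mul_comm] using this
    exact congrFun (Matrix.eq_zero_of_mulVec_eq_zero hw this)
  · rw [Set.mem_ofPred_eq, hdet]
    have : Matrix.of (fun j i => μ j (f i w₀)) = 1 := by
      ext j i
      simp [hμ, Matrix.one_apply]
    rw [this, Matrix.det_one]
    exact one_ne_zero

theorem isOpen_setOf_frame {V : Type*} [AddCommGroup V] [Module ℂ V] {n : ℕ}
    {f : Fin n → V × (Fin 3 → ⋀[ℂ]^2 V) → M} (hf : ∀ i, IsPolynomialMap (f i)) :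
    IsOpen {F : Frame V | LinearIndependent ℂ fun i => f i (F.vec, F.bivec)} :=
  ⟨_, isOpen_setOf_linearIndependent hf, rfl⟩

end Regular

/-! ### Both loci are closed: rank conditions on frames. -/

section Closed

variable {V : Type*} [AddCommGroup V] [Module ℂ V]

theorem toPoint_mem_planeLocus_iff.{u} {V : Type u} [AddCommGroup V] [Module ℂ V]
    (hV : finrank ℂ V = 5) {s : Fin 3 → Fin 4 × Fin 4}
    (hs : ∀ {E : Type u} [AddCommGroup E] [Module ℂ E] (b : Basis (Fin 4) ℂ E),
      LinearIndependent ℂ fun k => wedgeVec E (b (s k).1) (b (s k).2)) (F : Frame V) :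
    F.toPoint ∈ planeLocus V s ↔
      ∃ b : Basis (Fin 4) ℂ (TFibre (Projectivization.mk ℂ F.vec F.vec_ne)), ∀ k,
        exteriorPower.map 2 (Projectivization.mk ℂ F.vec F.vec_ne).submodule.mkQ (F.bivec k) ∈
          plane s b := by
  constructor
  · rintro ⟨b, hb⟩
    have hle : Submodule.span ℂ (Set.range fun k => exteriorPower.map 2
        (Projectivization.mk ℂ F.vec F.vec_ne).submodule.mkQ (F.bivec k)) ≤ plane s b := hb.le
    exact ⟨b, fun k => hle (Submodule.subset_span ⟨k, rfl⟩)⟩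
  · rintro ⟨b, hb⟩
    have : FiniteDimensional ℂ (TFibre (Projectivization.mk ℂ F.vec F.vec_ne)) :=
      finiteDimensional_of_finrank (finrank_tFibre hV _)
    have hle : Submodule.span ℂ (Set.range fun k => exteriorPower.map 2
        (Projectivization.mk ℂ F.vec F.vec_ne).submodule.mkQ (F.bivec k)) ≤ plane s b := by
      rw [Submodule.span_le]
      rintro _ ⟨k, rfl⟩
      exact hb k
    have heq : Submodule.span ℂ (Set.range fun k => exteriorPower.map 2
        (Projectivization.mk ℂ F.vec F.vec_ne).submodule.mkQ (F.bivec k)) = plane s b :=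
      Submodule.eq_of_le_of_finrank_eq hle
        (by rw [finrank_span_eq_card F.indep, finrank_plane (hs b), Fintype.card_fin])
    exact ⟨b, heq⟩

theorem exists_linearIndependent_of_le_finrank_range {A M : Type*} [AddCommGroup A] [Module ℂ A]
    [FiniteDimensional ℂ A] [AddCommGroup M] [Module ℂ M] (T : A →ₗ[ℂ] M) {n : ℕ}
    (h : n ≤ finrank ℂ (LinearMap.range T)) : ∃ x : Fin n → A, LinearIndependent ℂ fun i => T (x i) := by
  let b := finBasis ℂ (LinearMap.range T)
  choose x hx using fun i => (b i).2
  refine ⟨x ∘ Fin.castLE h, ?_⟩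
  have := (b.linearIndependent.map' _ (LinearMap.range T).ker_subtype).comp (Fin.castLE h)
    (Fin.castLE_injective h)
  have h' : (fun i => T ((x ∘ Fin.castLE h) i)) =
      ((LinearMap.range T).subtype ∘ b) ∘ Fin.castLE h := funext fun i => hx _
  rwa [h']

/-- The linear map `x ↦ (a₁ ∧ v ∧ x, a₂ ∧ v ∧ x, a₃ ∧ v ∧ x)` of a frame. -/
noncomputable def Frame.mulMap (F : Frame V) : V →ₗ[ℂ] (Fin 3 → ⋀[ℂ]^4 V) :=
  LinearMap.pi fun k => wedgeForm V (F.bivec k) ∘ₗ wedgeVec V F.vec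

theorem Frame.mulMap_eq_zero_iff (F : Frame V) (x : V) : F.mulMap x = 0 ↔ ∀ k,
    (F.bivec k : ExteriorAlgebra ℂ V) * ExteriorAlgebra.ι ℂ F.vec * ExteriorAlgebra.ι ℂ x = 0 := by
  rw [funext_iff]
  refine forall_congr' fun k => ?_
  change wedgeForm V (F.bivec k) (wedgeVec V F.vec x) = 0 ↔ _
  rw [Subtype.ext_iff, coe_wedgeForm, coe_wedgeVec, ← mul_assoc]
  rfl

/-- The kernel of `F.mulMap` always contains `F.vec`. A ρ-plane `e ∧ (V/V₁)` means that a lift of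
`e` is a further kernel vector, that is, rank at most three. -/
theorem Frame.toPoint_mem_rho_iff (hV : finrank ℂ V = 5) (F : Frame V) :
    F.toPoint ∈ planeLocus V rhoPairs ↔
      ¬ ∃ x : Fin 4 → V, LinearIndependent ℂ fun i => F.mulMap (x i) := by
  have : FiniteDimensional ℂ V := finiteDimensional_of_finrank hV
  have hrank := LinearMap.finrank_range_add_finrank_ker F.mulMap
  rw [hV] at hrank
  constructor
  · rintro h ⟨x, hx⟩
    -- Read as a point of the exceptional set, it comes with another point of the same image, whose
    -- base vector is the second kernel vector.
    rw [← Prho_eq_planeLocus hV] at h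
    obtain ⟨y', hne, hy⟩ := h
    have hmem : y'.base.rep ∈ y'.base.submodule := by
      rw [Projectivization.submodule_eq]; exact Submodule.mem_span_singleton_self _
    have h1 : F.mulMap y'.base.rep = 0 := by
      rw [F.mulMap_eq_zero_iff]
      intro k
      have h2 : wedgeRight V (F.bivec k) F.vec ∈ toYbar y' := by
        rw [hy, toYbar_toPoint]
        exact Submodule.subset_span ⟨k, rfl⟩
      exact mul_ι_eq_zero_of_mem_toYbar h2 hmem
    have h2 : F.mulMap F.vec = 0 := by
      rw [F.mulMap_eq_zero_iff]
      intro k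
      rw [mul_assoc, ExteriorAlgebra.ι_sq_zero, mul_zero]
    have h3 : LinearIndependent ℂ ![F.vec, y'.base.rep] := by
      rw [LinearIndependent.pair_iff' F.vec_ne]
      intro a ha
      apply hne
      refine eq_of_base_eq_of_toYbar_eq ?_ hy
      conv_lhs => rw [← y'.base.mk_rep]
      exact (Projectivization.mk_eq_mk_iff' _ _ _ _ F.vec_ne).2 ⟨a, ha⟩
    have h4 : 2 ≤ finrank ℂ (LinearMap.ker F.mulMap) := by
      have hle : Submodule.span ℂ (Set.range ![F.vec, y'.base.rep]) ≤ LinearMap.ker F.mulMap := by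
        rw [Submodule.span_le]
        rintro _ ⟨i, rfl⟩
        fin_cases i
        · exact h2
        · exact h1
      have := Submodule.finrank_mono hle
      rwa [finrank_span_eq_card h3, Fintype.card_fin] at this
    have h5 : 4 ≤ finrank ℂ (LinearMap.range F.mulMap) := by
      have hle : Submodule.span ℂ (Set.range fun i => F.mulMap (x i)) ≤
          LinearMap.range F.mulMap := by
        rw [Submodule.span_le]
        rintro _ ⟨i, rfl⟩
        exact ⟨_, rfl⟩
      have := Submodule.finrank_mono hle
      rwa [finrank_span_eq_card hx, Fintype.card_fin] at this
    omega
  · intro h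
    have h3 : ¬ 4 ≤ finrank ℂ (LinearMap.range F.mulMap) :=
      fun h4 => h (exists_linearIndependent_of_le_finrank_range _ h4)
    have h4 : ¬ LinearMap.ker F.mulMap ≤ Submodule.span ℂ {F.vec} := by
      intro hle
      have := Submodule.finrank_mono hle
      rw [finrank_span_singleton F.vec_ne] at this
      omega
    obtain ⟨x, hx, hx'⟩ := SetLike.not_le_iff_exists.1 h4
    have he : (Projectivization.mk ℂ F.vec F.vec_ne).submodule.mkQ x ≠ 0 := by
      rwa [Submodule.mkQ_apply, Ne, Submodule.Quotient.mk_eq_zero, Projectivization.submodule_mk]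
    obtain ⟨b, hb⟩ := exists_basis_zero_eq
      (finrank_tFibre hV (Projectivization.mk ℂ F.vec F.vec_ne)) he
    refine (toPoint_mem_planeLocus_iff hV linearIndependent_rhoPairs F).2 ⟨b, fun k => ?_⟩
    refine map_mem_plane_rhoPairs (v := F.vec) ?_ F.vec_ne b hb
      ((F.mulMap_eq_zero_iff x).1 hx k)
    rw [Projectivization.submodule_mk]
    exact Submodule.mem_span_singleton_self _

theorem isClosed_planeLocus_rho (hV : finrank ℂ V = 5) : IsClosed (planeLocus V rhoPairs) := by
  have : FiniteDimensional ℂ V := finiteDimensional_of_finrank hV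
  rw [← isOpen_compl_iff, isOpen_coinduced]
  have h : Frame.toPoint ⁻¹' (planeLocus V rhoPairs)ᶜ = ⋃ x : Fin 4 → V,
      {F : Frame V | LinearIndependent ℂ fun i => F.mulMap (x i)} := by
    ext F
    rw [Set.mem_preimage, Set.mem_compl_iff, F.toPoint_mem_rho_iff hV, not_not, Set.mem_iUnion]
    rfl
  rw [h]
  refine isOpen_iUnion fun x => ?_
  refine isOpen_setOf_frame (f := fun i w k => wedgeForm V (w.2 k) (wedgeVec V w.1 (x i)))
    fun i => IsPolynomialMap.pi fun k => ?_
  refine IsPolynomialMap.bilinear (f := fun w : V × (Fin 3 → ⋀[ℂ]^2 V) => w.2 k)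
    (g := fun w => wedgeVec V w.1 (x i)) ?_ ?_ (wedgeForm V)
  · exact IsPolynomialMap.of_linear (LinearMap.proj k ∘ₗ LinearMap.snd ℂ V (Fin 3 → ⋀[ℂ]^2 V))
  · exact IsPolynomialMap.of_linear ((wedgeVec V).flip (x i) ∘ₗ LinearMap.fst ℂ V (Fin 3 → ⋀[ℂ]^2 V))

theorem mkQ_contract (L : Submodule ℂ V) (l : Dual ℂ (V ⧸ L)) (a : ⋀[ℂ]^2 V) :
    L.mkQ (contract V (l ∘ₗ L.mkQ) a) = contract (V ⧸ L) l (exteriorPower.map 2 L.mkQ a) := by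
  have : L.mkQ ∘ₗ contract V (l ∘ₗ L.mkQ) = contract (V ⧸ L) l ∘ₗ exteriorPower.map 2 L.mkQ := by
    refine bivector_hom_ext fun x y => ?_
    simp only [LinearMap.comp_apply, map_wedgeVec, contract_wedgeVec, map_sub, map_smul]
  exact LinearMap.congr_fun this a

/-- Contraction with `b.coord 0` reads off exactly the three coordinates on products containing `b
0`. -/
theorem mem_plane_sigmaPairs_iff_contract {E : Type*} [AddCommGroup E] [Module ℂ E]
    (b : Basis (Fin 4) ℂ E) (x : ⋀[ℂ]^2 E) :
    x ∈ plane sigmaPairs b ↔ contract E (b.coord 0) x = 0 := by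
  obtain ⟨c, rfl⟩ := exists_eq_bivector b x
  have h : contract E (b.coord 0) (bivector b c) = c 0 • b 1 + c 1 • b 2 + c 2 • b 3 := by
    simp [bivector]
  rw [mem_plane_sigmaPairs, h]
  constructor
  · rintro ⟨h0, h1, h2⟩
    simp [h0, h1, h2]
  · intro h
    have := Fintype.linearIndependent_iff.1 b.linearIndependent ![0, c 0, c 1, c 2]
      (by simpa [Fin.sum_univ_four] using h)
    exact ⟨this 1, this 2, this 3⟩

/-- The linear map `l ↦ (l(v), (l ⌟ a₁) ∧ v, (l ⌟ a₂) ∧ v, (l ⌟ a₃) ∧ v)` of a frame. -/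
noncomputable def Frame.contractMap (F : Frame V) : Dual ℂ V →ₗ[ℂ] ℂ × (Fin 3 → ⋀[ℂ]^2 V) :=
  (Dual.eval ℂ V F.vec).prod
    (LinearMap.pi fun k => (wedgeVec V).flip F.vec ∘ₗ (contract V).flip (F.bivec k))

/-- The component `l(v)` tests whether `l` descends to `V/V₁`; multiplication by `v` tests vanishing
modulo `v` without leaving a fixed vector space. -/
theorem Frame.contractMap_eq_zero_iff (F : Frame V) (l : Dual ℂ V) :
    F.contractMap l = 0 ↔ l F.vec = 0 ∧ ∀ k,
      (Projectivization.mk ℂ F.vec F.vec_ne).submodule.mkQ (contract V l (F.bivec k)) = 0 := by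
  change ((l F.vec, fun k => wedgeVec V (contract V l (F.bivec k)) F.vec) :
    ℂ × (Fin 3 → ⋀[ℂ]^2 V)) = (0, 0) ↔ _
  rw [Prod.mk.injEq, funext_iff]
  refine and_congr Iff.rfl (forall_congr' fun k => ?_)
  have hmem : F.vec ∈ (Projectivization.mk ℂ F.vec F.vec_ne).submodule := by
    rw [Projectivization.submodule_mk]
    exact Submodule.mem_span_singleton_self _
  constructor
  · intro h
    have h1 := congrArg (Subtype.val) h
    rw [coe_wedgeVec] at h1
    have h2 := map_mkQ_eq_zero_of_mul_eq_zero hmem F.vec_ne h1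
    rwa [ExteriorAlgebra.map_apply_ι, ExteriorAlgebra.ι_eq_zero_iff] at h2
  · intro h
    rw [Submodule.mkQ_apply, Submodule.Quotient.mk_eq_zero, Projectivization.submodule_mk,
      Submodule.mem_span_singleton] at h
    obtain ⟨c, hc⟩ := h
    rw [← hc, map_smul, LinearMap.smul_apply, wedgeVec_self, smul_zero]
    rfl

/-- A nonzero kernel element descends to a form on `V/V₁` that contracts `Ū` to zero; taken as first
coordinate of a basis, it exhibits `Ū` as a σ-plane. -/
theorem Frame.toPoint_mem_sigma_iff (hV : finrank ℂ V = 5) (F : Frame V) :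
    F.toPoint ∈ planeLocus V sigmaPairs ↔ ∃ l ≠ 0, F.contractMap l = 0 := by
  rw [toPoint_mem_planeLocus_iff hV linearIndependent_sigmaPairs F]
  have hmem : F.vec ∈ (Projectivization.mk ℂ F.vec F.vec_ne).submodule := by
    rw [Projectivization.submodule_mk]
    exact Submodule.mem_span_singleton_self _
  constructor
  · rintro ⟨b, hb⟩
    refine ⟨b.coord 0 ∘ₗ (Projectivization.mk ℂ F.vec F.vec_ne).submodule.mkQ, ?_, ?_⟩
    · intro h
      obtain ⟨x, hx⟩ := (Projectivization.mk ℂ F.vec F.vec_ne).submodule.mkQ_surjective (b 0)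
      have h1 := LinearMap.congr_fun h x
      rw [LinearMap.comp_apply, hx, Basis.coord_apply, Basis.repr_self,
        Finsupp.single_eq_same] at h1
      exact one_ne_zero h1
    · rw [F.contractMap_eq_zero_iff]
      constructor
      · rw [LinearMap.comp_apply, Submodule.mkQ_apply, (Submodule.Quotient.mk_eq_zero _).2 hmem,
          map_zero]
      · intro k
        rw [mkQ_contract]
        exact (mem_plane_sigmaPairs_iff_contract b _).1 (hb k)
  · rintro ⟨l, hl, h⟩
    rw [F.contractMap_eq_zero_iff] at h
    have hle : (Projectivization.mk ℂ F.vec F.vec_ne).submodule ≤ LinearMap.ker l := by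
      rw [Projectivization.submodule_mk, Submodule.span_singleton_le_iff_mem]
      exact h.1
    obtain ⟨m, rfl⟩ : ∃ m, m ∘ₗ (Projectivization.mk ℂ F.vec F.vec_ne).submodule.mkQ = l :=
      ⟨_, Submodule.liftQ_mkQ _ l hle⟩
    have hm : m ≠ 0 := by
      rintro rfl
      exact hl (LinearMap.zero_comp _)
    obtain ⟨b, rfl⟩ := exists_basis_coord_zero_eq (finrank_tFibre hV _) hm
    refine ⟨b, fun k => ?_⟩
    rw [mem_plane_sigmaPairs_iff_contract, ← mkQ_contract]
    exact h.2 k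

theorem isClosed_planeLocus_sigma (hV : finrank ℂ V = 5) : IsClosed (planeLocus V sigmaPairs) := by
  have : FiniteDimensional ℂ V := finiteDimensional_of_finrank hV
  rw [← isOpen_compl_iff, isOpen_coinduced]
  let d := (finBasisOfFinrankEq ℂ V hV).dualBasis
  have h : Frame.toPoint ⁻¹' (planeLocus V sigmaPairs)ᶜ =
      {F : Frame V | LinearIndependent ℂ fun i => F.contractMap (d i)} := by
    ext F
    rw [Set.mem_preimage, Set.mem_compl_iff, F.toPoint_mem_sigma_iff hV, Set.mem_ofPred_eq]
    constructor
    · intro h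
      refine d.linearIndependent.map' F.contractMap ?_
      rw [LinearMap.ker_eq_bot']
      intro l hl
      by_contra hne
      exact h ⟨l, hne, hl⟩
    · rintro h ⟨l, hl, h0⟩
      apply hl
      rw [← d.sum_repr l, map_sum] at h0
      simp only [map_smul] at h0
      have := Fintype.linearIndependent_iff.1 h _ h0
      exact d.repr.map_eq_zero_iff.1 (Finsupp.ext this)
  rw [h]
  refine isOpen_setOf_frame
    (f := fun i w => (d i w.1, fun k => wedgeVec V (contract V (d i) (w.2 k)) w.1))
    fun i => IsPolynomialMap.prodMk ?_ (IsPolynomialMap.pi fun k => ?_)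
  · exact IsPolynomialMap.of_linear (d i ∘ₗ LinearMap.fst ℂ V (Fin 3 → ⋀[ℂ]^2 V))
  · refine IsPolynomialMap.bilinear
      (f := fun w : V × (Fin 3 → ⋀[ℂ]^2 V) => contract V (d i) (w.2 k)) (g := fun w => w.1)
      ?_ ?_ (wedgeVec V)
    · exact IsPolynomialMap.of_linear
        (contract V (d i) ∘ₗ LinearMap.proj k ∘ₗ LinearMap.snd ℂ V (Fin 3 → ⋀[ℂ]^2 V))
    · exact IsPolynomialMap.of_linear (LinearMap.fst ℂ V (Fin 3 → ⋀[ℂ]^2 V))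

end Closed

/-! ### Connectedness of both loci and the components of their union. -/

section Connected

variable {V : Type*} [AddCommGroup V] [Module ℂ V]

/-- The excluded parameters are roots of a determinant polynomial whose value at 0 is 1, so they are
finite in number. Removing a countable set from `ℂ`, of real dimension two, leaves a connected set.
-/
theorem isPreconnected_setOf_linearIndependent_lineMap {n : ℕ} (B B' : Basis (Fin n) ℂ V) :
    IsPreconnected {t : ℂ | LinearIndependent ℂ fun i => B i + t • (B' i - B i)} := by
  let p : Polynomial ℂ := Matrix.det ((1 : Matrix (Fin n) (Fin n) (Polynomial ℂ)) +
    (Polynomial.X : Polynomial ℂ) • (B.toMatrix (fun i => B' i - B i)).map Polynomial.C)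
  have hp : ∀ t, p.eval t = B.det fun i => B i + t • (B' i - B i) := by
    intro t
    rw [← Polynomial.coe_evalRingHom, RingHom.map_det, Basis.det_apply]
    congr 1
    ext i j
    have h : (1 : Matrix (Fin n) (Fin n) ℂ) i j = B.repr (B j) i := by
      rw [← B.toMatrix_self, Basis.toMatrix_apply]
    rw [Basis.toMatrix_apply, B.repr.map_add, B.repr.map_smul, Finsupp.add_apply,
      Finsupp.smul_apply, ← h]
    rcases eq_or_ne i j with rfl | hij
    · simp only [RingHom.mapMatrix_apply, Matrix.map_apply, Matrix.add_apply, Matrix.smul_apply,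
        Matrix.one_apply_eq, Basis.toMatrix_apply, Polynomial.coe_evalRingHom, Polynomial.eval_add,
        Polynomial.eval_one, smul_eq_mul, Polynomial.eval_mul, Polynomial.eval_X, Polynomial.eval_C]
    · simp only [RingHom.mapMatrix_apply, Matrix.map_apply, Matrix.add_apply, Matrix.smul_apply,
        Matrix.one_apply_ne hij, Basis.toMatrix_apply, Polynomial.coe_evalRingHom,
        Polynomial.eval_add, Polynomial.eval_zero, smul_eq_mul, Polynomial.eval_mul,
        Polynomial.eval_X, Polynomial.eval_C]
  have hp0 : p ≠ 0 := by
    intro h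
    have h0 := hp 0
    simp only [h, Polynomial.eval_zero, zero_smul, add_zero] at h0
    rw [B.det_self] at h0
    exact zero_ne_one h0
  have hc : {t : ℂ | LinearIndependent ℂ fun i => B i + t • (B' i - B i)}ᶜ.Countable := by
    refine (p.rootSet_finite ℂ).countable.mono fun t ht => ?_
    rw [Polynomial.mem_rootSet]
    refine ⟨hp0, ?_⟩
    rw [Polynomial.coe_aeval_eq_eval, hp]
    by_contra hne
    exact ht ((Basis.is_basis_iff_det B).2 (isUnit_iff_ne_zero.2 hne)).1
  have := hc.isConnected_compl_of_one_lt_rank (by simp)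
  rw [compl_compl] at this
  exact this.isPreconnected

/-- This is the passage from the usual topology of `ℂ` to the Zariski topology: polynomials in
continuous functions are continuous, so connected sets of parameters have Zariski connected images.
-/
theorem continuous_frame {X : Type*} [TopologicalSpace X] {f : X → Frame V}
    (hf : ∀ l : Dual ℂ (V × (Fin 3 → ⋀[ℂ]^2 V)), Continuous fun x => l ((f x).vec, (f x).bivec)) :
    Continuous f := by
  rw [continuous_induced_rng]
  refine continuous_generateFrom_iff.2 ?_
  rintro _ ⟨p, rfl⟩
  have : Continuous fun x => MvPolynomial.eval (fun l : Dual ℂ (V × (Fin 3 → ⋀[ℂ]^2 V)) =>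
      l ((f x).vec, (f x).bivec)) p :=
    (MvPolynomial.continuous_eval p).comp (continuous_pi hf)
  exact isOpen_ne.preimage this

/-- `C` is the image of the segment from `B` to `B'`. The last clause serves the fibrewise
statement: a common first vector stays fixed along the segment. -/
theorem exists_isPreconnected_planeLocus.{u} {V : Type u} [AddCommGroup V] [Module ℂ V]
    (hV : finrank ℂ V = 5) {s : Fin 3 → Fin 4 × Fin 4}
    (hs : ∀ {E : Type u} [AddCommGroup E] [Module ℂ E] (b : Basis (Fin 4) ℂ E),
      LinearIndependent ℂ fun k => wedgeVec E (b (s k).1) (b (s k).2))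
    (B B' : Basis (Fin 5) ℂ V) :
    ∃ C ⊆ planeLocus V s, (frameOf hV hs B.linearIndependent).toPoint ∈ C ∧
      (frameOf hV hs B'.linearIndependent).toPoint ∈ C ∧ IsPreconnected C ∧
      ∀ L : ℙ ℂ V, B 0 = L.rep → B' 0 = L.rep → C ⊆ fibre L := by
  let T := {t : ℂ | LinearIndependent ℂ fun i => B i + t • (B' i - B i)}
  have : PreconnectedSpace T :=
    Subtype.preconnectedSpace (isPreconnected_setOf_linearIndependent_lineMap B B')
  let F : T → Frame V := fun t => frameOf hV hs t.2
  have hF : Continuous F := by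
    refine continuous_frame fun l => ?_
    -- Splitting `l` into its component on the vector and those on the three bivectors makes it
    -- visibly polynomial in `t`.
    have h : ∀ t : T, l ((F t).vec, (F t).bivec) =
        l (B 0 + t.1 • (B' 0 - B 0), 0) + ∑ k, (l ∘ₗ LinearMap.inr ℂ V (Fin 3 → ⋀[ℂ]^2 V) ∘ₗ
          LinearMap.single ℂ (fun _ => ⋀[ℂ]^2 V) k)
            (wedgeVec V (B (s k).1.succ + t.1 • (B' (s k).1.succ - B (s k).1.succ))
              (B (s k).2.succ + t.1 • (B' (s k).2.succ - B (s k).2.succ))) := by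
      intro t
      simp only [LinearMap.comp_apply]
      rw [← map_sum, ← map_sum, ← map_add]
      congr 1
      refine Prod.ext ?_ ?_
      · rw [Prod.fst_add, LinearMap.inr_apply, add_zero]
        rfl
      · rw [Prod.snd_add, LinearMap.inr_apply, zero_add]
        exact (LinearMap.sum_single_apply (fun _ => ⋀[ℂ]^2 V) (F t).bivec).symm
    have h0 : ∀ x y : V, ∀ t : ℂ, l (x + t • y, 0) = l (x, 0) + t * l (y, 0) := by
      intro x y t
      rw [← smul_eq_mul, ← map_smul, ← map_add]
      simp
    simp only [h, h0, map_add, map_smul, LinearMap.add_apply, LinearMap.smul_apply, smul_eq_mul]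
    fun_prop
  have h0 : LinearIndependent ℂ fun i => B i + (0 : ℂ) • (B' i - B i) := by
    simpa using B.linearIndependent
  have h1 : LinearIndependent ℂ fun i => B i + (1 : ℂ) • (B' i - B i) := by
    simpa using B'.linearIndependent
  have hcongr : ∀ {u v : Fin 5 → V} (hu : LinearIndependent ℂ u) (hv : LinearIndependent ℂ v),
      u = v → frameOf hV hs hu = frameOf hV hs hv := by
    rintro u v hu hv rfl
    rfl
  have hpt : Continuous fun t => (F t).toPoint :=
    (continuous_coinduced_rng (f := Frame.toPoint (V := V))).comp hF
  refine ⟨Set.range fun t => (F t).toPoint, ?_, ⟨⟨0, h0⟩, ?_⟩, ⟨⟨1, h1⟩, ?_⟩,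
    isPreconnected_range hpt, ?_⟩
  · rintro _ ⟨t, rfl⟩
    exact frameOf_mem_planeLocus hV hs t.2
  · exact congrArg Frame.toPoint (hcongr _ _ (by simp))
  · exact congrArg Frame.toPoint (hcongr _ _ (by simp))
  · rintro L hB hB' _ ⟨t, rfl⟩
    have hvec : (F t).vec = L.rep := by
      change B 0 + t.1 • (B' 0 - B 0) = L.rep
      rw [hB, hB', sub_self, smul_zero, add_zero]
    change Projectivization.mk ℂ (F t).vec (F t).vec_ne = L
    exact (Projectivization.mk_eq_mk_iff' ℂ _ _ _ L.rep_nonzero).2 ⟨1, by rw [one_smul, hvec]⟩ |>.trans L.mk_rep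

theorem isConnected_planeLocus.{u} {V : Type u} [AddCommGroup V] [Module ℂ V]
    (hV : finrank ℂ V = 5) {s : Fin 3 → Fin 4 × Fin 4}
    (hs : ∀ {E : Type u} [AddCommGroup E] [Module ℂ E] (b : Basis (Fin 4) ℂ E),
      LinearIndependent ℂ fun k => wedgeVec E (b (s k).1) (b (s k).2)) :
    IsConnected (planeLocus V s) := by
  have := finiteDimensional_of_finrank hV
  constructor
  · exact ⟨_, frameOf_mem_planeLocus hV hs (finBasisOfFinrankEq ℂ V hV).linearIndependent⟩
  · refine isPreconnected_of_forall_pair fun x hx y hy => ?_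
    obtain ⟨B, -, rfl⟩ := exists_frameOf_eq hV hs hx x.base.rep_nonzero x.base.mk_rep.symm
    obtain ⟨B', -, rfl⟩ := exists_frameOf_eq hV hs hy y.base.rep_nonzero y.base.mk_rep.symm
    obtain ⟨C, h1, h2, h3, h4, -⟩ := exists_isPreconnected_planeLocus hV hs B B'
    exact ⟨C, h1, h2, h3, h4⟩

theorem isConnected_planeLocus_inter_fibre.{u} {V : Type u} [AddCommGroup V] [Module ℂ V]
    (hV : finrank ℂ V = 5) {s : Fin 3 → Fin 4 × Fin 4}
    (hs : ∀ {E : Type u} [AddCommGroup E] [Module ℂ E] (b : Basis (Fin 4) ℂ E),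
      LinearIndependent ℂ fun k => wedgeVec E (b (s k).1) (b (s k).2)) (L : ℙ ℂ V) :
    IsConnected (planeLocus V s ∩ fibre L) := by
  constructor
  · have hE := finrank_tFibre hV L
    have := finiteDimensional_of_finrank hE
    let b := finBasisOfFinrankEq ℂ (TFibre L) hE
    exact ⟨⟨L, plane s b, finrank_plane (hs b)⟩, ⟨b, rfl⟩, rfl⟩
  · refine isPreconnected_of_forall_pair fun x hx y hy => ?_
    obtain ⟨B, hB, rfl⟩ := exists_frameOf_eq hV hs hx.1 L.rep_nonzero (hx.2.trans L.mk_rep.symm)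
    obtain ⟨B', hB', rfl⟩ := exists_frameOf_eq hV hs hy.1 L.rep_nonzero (hy.2.trans L.mk_rep.symm)
    obtain ⟨C, h1, h2, h3, h4, h5⟩ := exists_isPreconnected_planeLocus hV hs B B'
    exact ⟨C, Set.subset_inter h1 (h5 L hB hB'), h2, h3, h4⟩

/-- A connected subset of `P ∪ Q` lies in one of these disjoint closed sets, so no component exceeds
`P ∩ F` or `Q ∩ F`. The set `F` need not be closed. -/
theorem componentsOf_union {X : Type*} [TopologicalSpace X] {P Q F : Set X} (hP : IsClosed P)
    (hQ : IsClosed Q) (hPQ : Disjoint P Q) (hPc : IsConnected (P ∩ F)) (hQc : IsConnected (Q ∩ F)) :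
    componentsOf ((P ∪ Q) ∩ F) = {P ∩ F, Q ∩ F} := by
  have key : ∀ {P Q : Set X}, IsClosed P → IsClosed Q → Disjoint P Q → IsConnected (P ∩ F) →
      ∀ x ∈ P ∩ F, connectedComponentIn ((P ∪ Q) ∩ F) x = P ∩ F := by
    intro P Q hP hQ hPQ hPc x hx
    have hsub : P ∩ F ⊆ (P ∪ Q) ∩ F := Set.inter_subset_inter_left _ Set.subset_union_left
    refine (Set.Subset.antisymm ?_ (hPc.isPreconnected.subset_connectedComponentIn hx hsub))
    have hc := connectedComponentIn_subset ((P ∪ Q) ∩ F) x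
    rcases isPreconnected_iff_subset_of_disjoint_closed.1
      (isPreconnected_connectedComponentIn (F := (P ∪ Q) ∩ F) (x := x)) P Q hP hQ
      (fun y hy => (hc hy).1) (by rw [hPQ.inter_eq, Set.inter_empty]) with h | h
    · exact fun y hy => ⟨h hy, (hc hy).2⟩
    · exact (hPQ.notMem_of_mem_left hx.1 (h (mem_connectedComponentIn (hsub hx)))).elim
  ext C
  constructor
  · rintro ⟨x, ⟨hx | hx, hF⟩, rfl⟩
    · exact Or.inl (key hP hQ hPQ hPc x ⟨hx, hF⟩)
    · rw [Set.union_comm]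
      exact Or.inr (key hQ hP hPQ.symm hQc x ⟨hx, hF⟩)
  · rintro (rfl | rfl)
    · obtain ⟨x, hx⟩ := hPc.nonempty
      exact ⟨x, ⟨Or.inl hx.1, hx.2⟩, (key hP hQ hPQ hPc x hx).symm⟩
    · obtain ⟨x, hx⟩ := hQc.nonempty
      refine ⟨x, ⟨Or.inr hx.1, hx.2⟩, ?_⟩
      rw [Set.union_comm]
      exact (key hQ hP hPQ.symm hQc x hx).symm

end Connected

/-! ### The proper transform and the Veronese images. -/

section Loci

variable {V : Type*} [AddCommGroup V] [Module ℂ V]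

/-- The closure adds nothing, since the σ-locus is closed and disjoint from the exceptional set. -/
theorem Psigma_eq_planeLocus (hV : finrank ℂ V = 5) : Psigma V = planeLocus V sigmaPairs := by
  rw [Psigma, preimage_PsigmaBar hV, (isClosed_planeLocus_sigma hV).closure_eq]

theorem disjoint_planeLocus : Disjoint (planeLocus V rhoPairs) (planeLocus V sigmaPairs) :=
  Set.disjoint_left.2 fun _ => planeLocus_rho_disjoint_sigma

theorem map_pluckerLine_rhoPairs_eq {E : Type*} [AddCommGroup E] [Module ℂ E]
    (b : Basis (Fin 4) ℂ E) {S : Submodule ℂ E} (hS : S = Submodule.span ℂ {b 0}) :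
    (pluckerLine (plane rhoPairs b)).map (spinDecomposition E) = Submodule.span ℂ
      {s | ∃ e ∈ S, ∃ m : ⋀[ℂ]^4 E, s = (squareForm (Dual.eval ℂ E e) m, 0)} := by
  subst hS
  exact (map_pluckerLine_rhoPairs b).trans (span_squareForm_eval b).symm

theorem map_pluckerLine_sigmaPairs_eq {E : Type*} [AddCommGroup E] [Module ℂ E]
    (b : Basis (Fin 4) ℂ E) {S : Submodule ℂ (Dual ℂ E)}
    (hS : S = Submodule.span ℂ {b.coord 0}) :
    (pluckerLine (plane sigmaPairs b)).map (spinDecomposition E) = Submodule.span ℂ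
      {s | ∃ l ∈ S, ∃ m : ⋀[ℂ]^4 E ⊗[ℂ] ⋀[ℂ]^4 E, s = (0, squareForm l m)} := by
  subst hS
  exact (map_pluckerLine_sigmaPairs b).trans (span_squareForm_coord b).symm

theorem spinEmbedding_eq_veroneseT {L : ℙ ℂ V} (b : Basis (Fin 4) ℂ (TFibre L))
    {U : Submodule ℂ (⋀[ℂ]^2 (TFibre L))} (hU : finrank ℂ U = 3) (h : U = plane rhoPairs b)
    {q : ℙ ℂ (TFibre L)} (hq : q.submodule = Submodule.span ℂ {b 0}) :
    spinEmbedding ⟨L, U, hU⟩ = veroneseT ⟨L, q⟩ := by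
  subst h
  exact congrArg (Sigma.mk L) (map_pluckerLine_rhoPairs_eq b hq)

theorem spinEmbedding_eq_veroneseTDual {L : ℙ ℂ V} (b : Basis (Fin 4) ℂ (TFibre L))
    {U : Submodule ℂ (⋀[ℂ]^2 (TFibre L))} (hU : finrank ℂ U = 3) (h : U = plane sigmaPairs b)
    {q : ℙ ℂ (Dual ℂ (TFibre L))} (hq : q.submodule = Submodule.span ℂ {b.coord 0}) :
    spinEmbedding ⟨L, U, hU⟩ = veroneseTDual ⟨L, q⟩ := by
  subst h
  exact congrArg (Sigma.mk L) (map_pluckerLine_sigmaPairs_eq b hq)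

theorem spinEmbedding_image_rho (hV : finrank ℂ V = 5) :
    spinEmbedding '' planeLocus V rhoPairs = Set.range (veroneseT (V := V)) := by
  ext z
  constructor
  · rintro ⟨⟨L, U, hU⟩, ⟨b, hb⟩, rfl⟩
    exact ⟨⟨L, Projectivization.mk ℂ (b 0) (b.ne_zero 0)⟩, (spinEmbedding_eq_veroneseT b hU hb
      (Projectivization.submodule_mk _ _)).symm⟩
  · rintro ⟨⟨L, q⟩, rfl⟩
    obtain ⟨b, hb⟩ := exists_basis_zero_eq (finrank_tFibre hV L) q.rep_nonzero
    refine ⟨⟨L, plane rhoPairs b, finrank_plane (linearIndependent_rhoPairs b)⟩, ⟨b, rfl⟩,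
      spinEmbedding_eq_veroneseT b _ rfl ?_⟩
    rw [hb, q.submodule_eq]

theorem spinEmbedding_image_sigma (hV : finrank ℂ V = 5) :
    spinEmbedding '' planeLocus V sigmaPairs = Set.range (veroneseTDual (V := V)) := by
  ext z
  constructor
  · rintro ⟨⟨L, U, hU⟩, ⟨b, hb⟩, rfl⟩
    have h0 : b.coord 0 ≠ 0 := fun h => by
      have := LinearMap.congr_fun h (b 0)
      rw [Basis.coord_apply, Basis.repr_self, Finsupp.single_eq_same] at this
      exact one_ne_zero this
    exact ⟨⟨L, Projectivization.mk ℂ (b.coord 0) h0⟩, (spinEmbedding_eq_veroneseTDual b hU hb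
      (Projectivization.submodule_mk _ _)).symm⟩
  · rintro ⟨⟨L, q⟩, rfl⟩
    obtain ⟨b, hb⟩ := exists_basis_coord_zero_eq (finrank_tFibre hV L) q.rep_nonzero
    refine ⟨⟨L, plane sigmaPairs b, finrank_plane (linearIndependent_sigmaPairs b)⟩, ⟨b, rfl⟩,
      spinEmbedding_eq_veroneseTDual b _ rfl ?_⟩
    rw [hb, q.submodule_eq]

end Loci
end DoubleSpin

theorem mainTheorem12 {V : Type*} [AddCommGroup V] [Module ℂ V]
    (hV : Module.finrank ℂ V = 5) :
    -- the double spin decomposition is an isomorphism on every fibre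
    (∀ L : Projectivization ℂ V,
      Function.Bijective (DoubleSpin.spinDecomposition (DoubleSpin.TFibre L))) ∧
    -- the exceptional set is the inverse image of the locus of `ρ`-planes, which it is contracted to
    (DoubleSpin.Prho V = DoubleSpin.toYbar ⁻¹' DoubleSpin.PrhoBar V ∧
      DoubleSpin.toYbar '' DoubleSpin.Prho V = DoubleSpin.PrhoBar V) ∧
    -- the images of the two loci under the double spin embedding
    DoubleSpin.spinEmbedding '' DoubleSpin.Prho V =
      Set.range (DoubleSpin.veroneseT (V := V)) ∧
    DoubleSpin.spinEmbedding '' DoubleSpin.Psigma V =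
      Set.range (DoubleSpin.veroneseTDual (V := V)) ∧
    -- the two loci are the two connected components of the relative orthogonal Grassmannian
    DoubleSpin.OG V = DoubleSpin.OGDual V ∧
    DoubleSpin.Prho V ≠ DoubleSpin.Psigma V ∧
    DoubleSpin.componentsOf (DoubleSpin.OG V) = {DoubleSpin.Prho V, DoubleSpin.Psigma V} ∧
    -- and the same holds on every fibre over `ℙ(V)`
    ∀ L : Projectivization ℂ V,
      DoubleSpin.Prho V ∩ DoubleSpin.fibre L ≠ DoubleSpin.Psigma V ∩ DoubleSpin.fibre L ∧
      DoubleSpin.componentsOf (DoubleSpin.OG V ∩ DoubleSpin.fibre L) =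
        {DoubleSpin.Prho V ∩ DoubleSpin.fibre L, DoubleSpin.Psigma V ∩ DoubleSpin.fibre L} := by
  have hρ := DoubleSpin.Prho_eq_planeLocus hV
  have hσ := DoubleSpin.Psigma_eq_planeLocus hV
  have hOG := DoubleSpin.OG_eq_union hV
  have hρ' := DoubleSpin.isClosed_planeLocus_rho hV
  have hσ' := DoubleSpin.isClosed_planeLocus_sigma hV
  have hne : ∀ {P Q F : Set (DoubleSpin.Y3 V)}, Disjoint P Q → IsConnected (P ∩ F) →
      P ∩ F ≠ Q ∩ F := by
    intro P Q F hPQ hP h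
    obtain ⟨x, hx⟩ := hP.nonempty
    exact hPQ.notMem_of_mem_left hx.1 (h ▸ hx).1
  have hd := DoubleSpin.disjoint_planeLocus (V := V)
  have hρc := DoubleSpin.isConnected_planeLocus hV DoubleSpin.linearIndependent_rhoPairs
  have hσc := DoubleSpin.isConnected_planeLocus hV DoubleSpin.linearIndependent_sigmaPairs
  -- With `F` the whole space, the global statement becomes an instance of the fibrewise argument.
  rw [← Set.inter_univ (DoubleSpin.planeLocus V _)] at hρc hσc
  refine ⟨fun L => ?_, ⟨?_, ?_⟩, ?_, ?_, ?_, ?_, ?_, fun L => ?_⟩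
  · exact DoubleSpin.bijective_spinDecomposition (DoubleSpin.finrank_tFibre hV L)
  · exact DoubleSpin.Prho_eq_preimage hV
  · exact DoubleSpin.image_Prho hV
  · exact (congrArg _ hρ).trans (DoubleSpin.spinEmbedding_image_rho hV)
  · exact (congrArg _ hσ).trans (DoubleSpin.spinEmbedding_image_sigma hV)
  · exact DoubleSpin.OG_eq_OGDual hV
  · rw [hρ, hσ]
    simpa using hne hd hρc
  · rw [hρ, hσ, hOG]
    simpa using DoubleSpin.componentsOf_union hρ' hσ' hd hρc hσc
  · have hρL := DoubleSpin.isConnected_planeLocus_inter_fibre hV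
      DoubleSpin.linearIndependent_rhoPairs L
    have hσL := DoubleSpin.isConnected_planeLocus_inter_fibre hV
      DoubleSpin.linearIndependent_sigmaPairs L
    rw [hρ, hσ, hOG]
    exact ⟨hne hd hρL, DoubleSpin.componentsOf_union hρ' hσ' hd hρL hσL⟩
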